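/- Let $(X_t,J_t)_{t\ge 0}$ be a spectrally negative Markov additive process: $J$ is an irreducible continuous-time Markov chain on $\{1,\dots,d\}$ with transition rate matrix $(q_{ij})$ and stationary distribution $\pi$; $X_0=0$; while $J$ is in state $i$, $X$ moves like a Lévy process $X^{(i)}$ without upward jumps; and when $J$ jumps from $i$ to $j\neq i$, $X$ makes an additional jump distributed as $U_{ij}\le 0$ (the chain, the Lévy processes and the jumps, i.i.d. for each $(i,j)$, being independent). Assume that $X^{(i)}_1$, and $U_{ij}$ whenever $q_{ij}>0$, have finite means and that $\sum_i\pi_i\,\mathbb E X^{(i)}_1+\sum_{i}\sum_{j\ne i}\pi_iq_{ij}\,\mathbb E U_{ij}<0$. Write $\underline X_t:=\inf_{0\le s\le t}X_s$ and $\tau(y):=\inf\{t\ge 0: X_t\le -y\}$, and let $Q_t:=X_t+\max\{Q_0,-\underline X_t\}$ be the workload, in stationarity at time $0$: $Q_0\ge 0$ is conditionally independent of $(X,J)$ given $J_0$, and the law of $(Q_t,J_t)$ does not depend on $t$. Let $\vartheta>0$, let $T$ be exponentially distributed with mean $1/\vartheta$, independent of $(Q_0,X,J)$, and put $$\gamma(\vartheta):=\mathrm{Cov}(Q_0,Q_T),\quad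 \kappa_i(\alpha):=\mathbb E\big(e^{-\alpha Q_0}1_{\{J_0=i\}}\big),\quad \kappa(\alpha):=\mathbb E\,e^{-\alpha Q_0},\quad \nu_i(\vartheta):=\mathbb E_iX_T,$$ where $\mathbb E_i$ is the expectation given $J_0=i$. For complex $\eta\neq0$ let $$\bar\Omega_i(\eta,\vartheta):=\frac{1-\mathbb E_i e^{\eta\underline X_T}}{\eta},\qquad \bar\Omega_i(0,\vartheta):=-\mathbb E_i\underline X_T ,$$ the latter being the limit of the former as $\eta\downarrow0$, and let $\bar\Omega_i'$ be the derivative with respect to $\eta$. Assume that there are complex numbers $\zeta_{ij}$ and $\eta_j$ with $\mathrm{Re}\,\eta_j>0$ $(i,j=1,\dots,d)$ such that on $(0,\infty)$ the measure $\mathbb P(Q_0\in dx,\,J_0=i)$ has the density $$p_i(x)=\sum_{j=1}^d\zeta_{ij}e^{-\eta_jx},\qquad x>0,\ i=1,\dots,d$$ (an atom at $0$ is allowed). Then $Q_0$ and $Q_T$ have finite second moments, $X_T$ is integrable under each $\mathbb P_i$, $\kappa$ is twice continuously differentiable and each $\kappa_i$ is differentiable at $0$, and each $\bar\Omega_i(\cdot,\vartheta)$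 is complex differentiable at every $\eta_j$. For all $i$ and all $\eta$ with $\mathrm{Re}\,\eta\ge 0$, $$\bar\Omega_i(\eta,\vartheta)=\int_0^\infty e^{-\eta y}\,\mathbb E_ie^{-\vartheta\tau(y)}\,dy$$ with an absolutely convergent integral (where $e^{-\vartheta\tau(y)}:=0$ if $\tau(y)=\infty$), and $$\gamma(\vartheta)=\kappa''(0)-\kappa'(0)^2+\sum_{i=1}^d\sum_{j=1}^d\frac{\zeta_{ij}}{\eta_j^2}\Big(\bar\Omega_i(0,\vartheta)-\bar\Omega_i(\eta_j,\vartheta)+\eta_j\,\bar\Omega_i'(\eta_j,\vartheta)\Big)-\sum_{i=1}^d\nu_i(\vartheta)\,\kappa_i'(0).$$ -/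

import Mathlib

open MeasureTheory ProbabilityTheory Filter Topology Set
open scoped NNReal ENNReal

namespace MAPQueue

variable {Ω : Type*} [MeasurableSpace Ω] {d : ℕ}

/-! ### Paths -/

/-- The path `f` is right-continuous with left limits. -/
def IsCadlag {E : Type*} [TopologicalSpace E] (f : ℝ≥0 → E) : Prop :=
  (∀ t, ContinuousWithinAt f (Ici t) t) ∧ ∀ t, ∃ l, Tendsto f (𝓝[<] t) (𝓝 l)

/-- The transition epochs of a path `f` up to and including time `t`. -/
def epochs (f : ℝ≥0 → Fin d) (t : ℝ≥0) : Set ℝ≥0 :=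
  {s | s ≤ t ∧ Function.leftLim f s ≠ f s}

/-! ### The background process -/

/-- `q` is a transition rate matrix: nonnegative off the diagonal, zero row sums. -/
structure IsRateMatrix (q : Matrix (Fin d) (Fin d) ℝ) : Prop where
  nonneg : ∀ i j, i ≠ j → 0 ≤ q i j
  row_sum : ∀ i, ∑ j, q i j = 0

/-- Every state can be reached from every state through positive rates. -/
def IsIrreducibleRate (q : Matrix (Fin d) (Fin d) ℝ) : Prop :=
  ∀ i j, Relation.ReflTransGen (fun a b => a ≠ b ∧ 0 < q a b) i j

/-- `π` is a stationary distribution of the rate matrix `q`. -/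
structure IsStationaryDist (q : Matrix (Fin d) (Fin d) ℝ) (π : Fin d → ℝ) : Prop where
  nonneg : ∀ i, 0 ≤ π i
  sum_eq_one : ∑ i, π i = 1
  stationary : Matrix.vecMul π q = 0

/-- `J` is a continuous-time Markov chain with rate matrix `q` (and some initial law), with
right-continuous paths with left limits: its finite-dimensional distributions are given by the
transition matrices `exp (t q)`. -/
structure IsMarkovChain (μ : Measure Ω) (q : Matrix (Fin d) (Fin d) ℝ)
    (J : ℝ≥0 → Ω → Fin d) : Prop where
  measurable : ∀ t, Measurable (J t)
  cadlag : ∀ᵐ ω ∂μ, IsCadlag (fun t => J t ω)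
  markov : ∀ (n : ℕ) (t : Fin (n + 1) → ℝ≥0), Monotone t → ∀ a : Fin (n + 1) → Fin d,
    μ.real {ω | ∀ k, J (t k) ω = a k} =
      μ.real {ω | J (t 0) ω = a 0} *
        ∏ k : Fin n, NormedSpace.exp (((t k.succ : ℝ) - (t k.castSucc : ℝ)) • q)
          (a k.castSucc) (a k.succ)

/-! ### Lévy processes -/

/-- `L` is a spectrally negative Lévy process: a Lévy process without upward jumps. -/
structure IsSpectrallyNegativeLevy (μ : Measure Ω) (L : ℝ≥0 → Ω → ℝ) : Prop where
  measurable : ∀ t, Measurable (L t)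
  zero : ∀ᵐ ω ∂μ, L 0 ω = 0
  indep_increments : HasIndepIncrements L μ
  stationary_increments : ∀ s t, IdentDistrib (fun ω => L (s + t) ω - L s ω) (L t) μ μ
  cadlag : ∀ᵐ ω ∂μ, IsCadlag (fun t => L t ω)
  no_upward_jumps : ∀ᵐ ω ∂μ, ∀ t, L t ω ≤ Function.leftLim (fun s => L s ω) t

/-! ### Spectrally negative Markov additive processes -/

/-- `(X, J)` is the spectrally negative Markov additive process built from the background chain `J`
with rate matrix `q`, the Lévy processes `L i` and the jumps `U n i j`. While `J` stays in state `i`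
the process `X` moves like `L i`; if the `n`-th transition of `J` goes from `i` to `j`, then `X`
makes at that epoch the jump `U n i j`. -/
structure IsSNMAP (μ : Measure Ω) (q : Matrix (Fin d) (Fin d) ℝ) (J : ℝ≥0 → Ω → Fin d)
    (L : Fin d → ℝ≥0 → Ω → ℝ) (U : ℕ → Fin d → Fin d → Ω → ℝ) (X : ℝ≥0 → Ω → ℝ) : Prop where
  rate : IsRateMatrix q
  irreducible : IsIrreducibleRate q
  chain : IsMarkovChain μ q J
  levy : ∀ i, IsSpectrallyNegativeLevy μ (L i)
  jump_measurable : ∀ n i j, Measurable (U n i j)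
  jump_identDistrib : ∀ n i j, IdentDistrib (U n i j) (U 0 i j) μ μ
  jump_nonpos : ∀ n i j, i ≠ j → ∀ᵐ ω ∂μ, U n i j ω ≤ 0
  levy_indep : iIndepFun (fun i ω t => L i t ω) μ
  jump_indep : iIndepFun (fun (p : ℕ × Fin d × Fin d) ω => U p.1 p.2.1 p.2.2 ω) μ
  levy_jump_indep : IndepFun (fun ω i t => L i t ω) (fun ω n i j => U n i j ω) μ
  chain_indep : IndepFun (fun ω t => J t ω)
    (fun ω => ((fun i t => L i t ω), (fun n i j => U n i j ω))) μ
  measurable : ∀ t, Measurable (X t)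
  zero : ∀ᵐ ω ∂μ, X 0 ω = 0
  sojourn : ∀ᵐ ω ∂μ, ∀ s t, s ≤ t → (∀ u ∈ Icc s t, J u ω = J s ω) →
    X t ω - X s ω = L (J s ω) t ω - L (J s ω) s ω
  transition : ∀ᵐ ω ∂μ, ∀ t, Function.leftLim (fun s => J s ω) t ≠ J t ω →
    X t ω = Function.leftLim (fun s => X s ω) t +
      U (epochs (fun s => J s ω) t).ncard (Function.leftLim (fun s => J s ω) t) (J t ω) ω

/-- Stability: the mean increments exist and the mean drift is negative. (The mean of `L i 1` is the
derivative at `0` of its cumulant generating function.) -/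
structure IsStableInput (μ : Measure Ω) (q : Matrix (Fin d) (Fin d) ℝ) (π : Fin d → ℝ)
    (L : Fin d → ℝ≥0 → Ω → ℝ) (U : ℕ → Fin d → Fin d → Ω → ℝ) : Prop where
  integrable_levy : ∀ i, Integrable (L i 1) μ
  integrable_jump : ∀ i j, i ≠ j → 0 < q i j → Integrable (U 0 i j) μ
  drift_neg : (∑ i, π i * ∫ ω, L i 1 ω ∂μ) +
    ∑ i, ∑ j ∈ Finset.univ.erase i, π i * q i j * ∫ ω, U 0 i j ω ∂μ < 0

/-! ### The workload -/

/-- The running minimum (infimum over `[0, t]`) of `X`. -/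
noncomputable def runInf (X : ℝ≥0 → Ω → ℝ) (t : ℝ≥0) (ω : Ω) : ℝ :=
  ⨅ u : Iic t, X u ω

/-- The workload at time `t`, when the input is `X` and the initial workload is `Q₀`. -/
noncomputable def workload (X : ℝ≥0 → Ω → ℝ) (Q₀ : Ω → ℝ) (t : ℝ≥0) (ω : Ω) : ℝ :=
  X t ω + max (Q₀ ω) (-runInf X t ω)

/-- The queue with input `(X, J)` and initial workload `Q₀` is in stationarity at time `0`: the
initial workload is nonnegative, given `J 0` it does not depend on the input after time `0`, and the
law of (workload, background state) does not change with time. -/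
structure IsStationaryQueue (μ : Measure Ω) (X : ℝ≥0 → Ω → ℝ) (J : ℝ≥0 → Ω → Fin d)
    (Q₀ : Ω → ℝ) : Prop where
  measurable : Measurable Q₀
  nonneg : ∀ᵐ ω ∂μ, 0 ≤ Q₀ ω
  condIndep : ∀ i, IndepFun Q₀ (fun ω => ((fun t => X t ω), (fun t => J t ω)))
    (cond μ (J 0 ⁻¹' {i}))
  stationary : ∀ t, IdentDistrib (fun ω => (workload X Q₀ t ω, J t ω))
    (fun ω => (Q₀ ω, J 0 ω)) μ μ

/-- `p i` is on `(0, ∞)` a density of the measure `P(Q₀ ∈ dx, J₀ = i)` (which may have an atom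
at `0`). -/
def IsWorkloadDensity (μ : Measure Ω) (J : ℝ≥0 → Ω → Fin d) (Q₀ : Ω → ℝ)
    (p : Fin d → ℝ → ℝ) : Prop :=
  ∀ i, (∀ x, 0 < x → 0 ≤ p i x) ∧
    ((μ.restrict (J 0 ⁻¹' {i})).map Q₀).restrict (Ioi 0) =
      (volume.restrict (Ioi 0)).withDensity (fun x => ENNReal.ofReal (p i x))

/-- `κ_i(α) = E (exp (-α Q₀); J₀ = i)`. -/
noncomputable def kappaState (μ : Measure Ω) (J : ℝ≥0 → Ω → Fin d) (Q₀ : Ω → ℝ) (i : Fin d)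
    (α : ℝ) : ℝ :=
  ∫ ω in J 0 ⁻¹' {i}, Real.exp (-α * Q₀ ω) ∂μ

/-- `κ(α) = E exp (-α Q₀)`. -/
noncomputable def kappa (μ : Measure Ω) (Q₀ : Ω → ℝ) (α : ℝ) : ℝ :=
  ∫ ω, Real.exp (-α * Q₀ ω) ∂μ

/-- The random variable `Q_T`. -/
noncomputable def workloadAt (X : ℝ≥0 → Ω → ℝ) (Q₀ : Ω → ℝ) (T : Ω → ℝ) (ω : Ω) : ℝ :=
  workload X Q₀ (T ω).toNNReal ω

/-- `γ = Cov(Q_0, Q_T)`. -/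
noncomputable def gamma (μ : Measure Ω) (X : ℝ≥0 → Ω → ℝ) (Q₀ : Ω → ℝ) (T : Ω → ℝ) : ℝ :=
  covariance Q₀ (workloadAt X Q₀ T) μ

/-! ### Quantities under `P_i`, the conditional law given `J 0 = i` -/

/-- The probability measure `P_i`. -/
noncomputable def lawFrom (μ : Measure Ω) (J : ℝ≥0 → Ω → Fin d) (i : Fin d) : Measure Ω :=
  cond μ (J 0 ⁻¹' {i})

/-- `ν_i = E_i X_T`. -/
noncomputable def nu (μ : Measure Ω) (X : ℝ≥0 → Ω → ℝ) (J : ℝ≥0 → Ω → Fin d) (T : Ω → ℝ)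
    (i : Fin d) : ℝ :=
  ∫ ω, X (T ω).toNNReal ω ∂(lawFrom μ J i)

/-- `τ(y) = inf {t ≥ 0 : X_t ≤ -y}`, which is `∞` if the level `-y` is never reached. -/
noncomputable def tau (X : ℝ≥0 → Ω → ℝ) (y : ℝ) (ω : Ω) : ℝ≥0∞ :=
  ⨅ (t : ℝ≥0) (_ : X t ω ≤ -y), (t : ℝ≥0∞)

open Classical in
/-- `ξ_i(y, θ) = E_i exp (-θ τ(y))`, with `exp (-∞) = 0`. -/
noncomputable def xi (μ : Measure Ω) (X : ℝ≥0 → Ω → ℝ) (J : ℝ≥0 → Ω → Fin d) (θ : ℝ)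
    (i : Fin d) (y : ℝ) : ℝ :=
  ∫ ω, (if tau X y ω = ∞ then 0 else Real.exp (-θ * (tau X y ω).toReal)) ∂(lawFrom μ J i)

/-- `Ω_i(η) = E_i exp (η X̲_T)`, where `X̲` is the running minimum. -/
noncomputable def Om (μ : Measure Ω) (X : ℝ≥0 → Ω → ℝ) (J : ℝ≥0 → Ω → Fin d) (T : Ω → ℝ)
    (i : Fin d) (η : ℂ) : ℂ :=
  ∫ ω, Complex.exp (η * (runInf X (T ω).toNNReal ω : ℂ)) ∂(lawFrom μ J i)

open Classical in
/-- `Ω̄_i(η) = (1 - Ω_i(η)) / η`, and for `η = 0` the limit of this, which is `-E_i X̲_T`. -/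
noncomputable def OmBar (μ : Measure Ω) (X : ℝ≥0 → Ω → ℝ) (J : ℝ≥0 → Ω → Fin d) (T : Ω → ℝ)
    (i : Fin d) (η : ℂ) : ℂ :=
  if η = 0 then ((-∫ ω, runInf X (T ω).toNNReal ω ∂(lawFrom μ J i) : ℝ) : ℂ)
  else (1 - Om μ X J T i η) / η

end MAPQueue

open MAPQueue

/-! Put Y = -X̲_T. Since max(Q₀, Y) = Q₀ + (Y - Q₀)⁺, the workload is Q_T = X_T + Q₀ + (Y - Q₀)⁺
(`IsSNMAP.ae_workloadAt_eq`), so E Q₀Q_T splits into E Q₀X_T, E Q₀² and E Q₀(Y - Q₀)⁺. Under P_i the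
initial workload is independent of (T, X) (`IsSNMAP.indepFun_workload_randomTime`), so the first
term factorizes state by state into E_i X_T and κ_i'(0). The second is κ''(0). By stationarity E Q_T
= E Q₀, so the product of means is κ'(0)². In the third term the density replaces Q₀: what remains
is the transform of x E_i(Y - x)⁺ at η_j. Integrating exp(-zx) x (y - x) over [0, y] in closed form
and averaging over y = Y gives precisely the combination of values and derivative of `OmBar` in the
formula (`integral_cexp_mul_overshoot`, `OmBar_combination`). An atom of Q₀ at 0 contributes
nothing, because the integrand has the factor Q₀. The transform identity rests on {Y ≥ y} = {τ(y) ≤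
T}, whose P_i-probability is E_i exp(-ϑτ(y)) (`IsSNMAP.xi_eq`), and on Fubini. The equality of
events holds because paths without upward jumps are lower semicontinuous and attain their infimum.
Most of the work is integrability. The exponential density gives Q₀ exponential moments, and Q_T has
the law of Q₀. For Y, stationarity replaces a maximal inequality: -X̲_M ≤ Q_M - X_M with E Q_M = E
Q₀, so a bound on E(-X_M)⁺ that is linear in M suffices (`IsSNMAP.exists_lintegral_neg_le`). To get
it, the state is frozen at the left end of each cell of a grid of mesh 1/n. Given the states, the
frozen Lévy increments have first absolute moment O(M) uniformly in n, because an independent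
centred summand cannot decrease E|·|; the number of state changes has mean O(M), because the
off-diagonal entries of exp(q/n) are O(1/n). Fatou's lemma then passes to X. Only jumps with
positive rate are assumed integrable, so transitions of rate zero must be shown not to occur
(`IsSNMAP.ae_rate_pos`); and stationarity with irreducibility gives every initial state positive
probability, so that each P_i is a probability measure. -/

namespace MAPQueue

/-! ### Right-continuous paths without upward jumps -/

/-- A right-continuous, lower semicontinuous path; every right-continuous path with left limits
and without upward jumps is of this kind. -/
structure IsRegularPath (f : ℝ≥0 → ℝ) : Prop where
  rightCont : ∀ t, ContinuousWithinAt f (Ici t) t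
  lsc : LowerSemicontinuous f

/-- Lower semicontinuity on a compact interval: the infimum is attained, which a path with upward
jumps need not satisfy. -/
theorem IsRegularPath.exists_isMinOn {f : ℝ≥0 → ℝ} (hf : IsRegularPath f) (t : ℝ≥0) :
    ∃ u ≤ t, (∀ v ≤ t, f u ≤ f v) ∧ ⨅ v : Iic t, f v = f u := by
  have hK : IsCompact (Iic t) := by
    rw [← Icc_bot]; exact isCompact_Icc
  obtain ⟨u, hu, hmin⟩ := LowerSemicontinuousOn.exists_isMinOn (s := Iic t) ⟨t, self_mem_Iic⟩ hK
    (hf.lsc.lowerSemicontinuousOn _)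
  have h : ∀ v ≤ t, f u ≤ f v := fun v hv => hmin hv
  refine ⟨u, hu, h, le_antisymm ?_ ?_⟩
  · exact ciInf_le ⟨f u, by rintro _ ⟨v, rfl⟩; exact h v v.2⟩ (⟨u, hu⟩ : Iic t)
  · have : Nonempty (Iic t) := ⟨⟨u, hu⟩⟩
    exact le_ciInf fun v => h v v.2

theorem IsRegularPath.iInf_le {f : ℝ≥0 → ℝ} (hf : IsRegularPath f) {s t : ℝ≥0} (hst : s ≤ t) :
    ⨅ v : Iic t, f v ≤ f s := by
  obtain ⟨u, -, h, e⟩ := hf.exists_isMinOn t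
  rw [e]; exact h s hst

theorem IsRegularPath.iInf_anti {f : ℝ≥0 → ℝ} (hf : IsRegularPath f) {s t : ℝ≥0} (hst : s ≤ t) :
    ⨅ v : Iic t, f v ≤ ⨅ v : Iic s, f v := by
  obtain ⟨u, hu, -, e⟩ := hf.exists_isMinOn s
  rw [e]; exact hf.iInf_le (hu.trans hst)

/-- The smallest multiple of `1 / n` exceeding `t`. -/
noncomputable def gridAbove (n : ℕ) (t : ℝ≥0) : ℝ≥0 := (⌊n * t⌋₊ + 1 : ℕ) / n

theorem lt_gridAbove {n : ℕ} (hn : 0 < n) (t : ℝ≥0) : t < gridAbove n t := by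
  have hn' : (0 : ℝ≥0) < n := by exact_mod_cast hn
  rw [gridAbove, lt_div_iff₀ hn', mul_comm]
  push_cast
  exact Nat.lt_floor_add_one _

theorem gridAbove_le {n : ℕ} (hn : 0 < n) (t : ℝ≥0) : gridAbove n t ≤ t + 1 / n := by
  have hn' : (0 : ℝ≥0) < n := by exact_mod_cast hn
  rw [gridAbove, div_le_iff₀ hn', add_mul, one_div, inv_mul_cancel₀ hn'.ne', mul_comm t]
  push_cast
  gcongr
  exact Nat.floor_le (by positivity)

theorem tendsto_gridAbove (t : ℝ≥0) :
    Tendsto (fun n => gridAbove n t) atTop (𝓝[>] t) := by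
  refine tendsto_nhdsWithin_iff.2 ⟨?_, ?_⟩
  · have h : Tendsto (fun n : ℕ => t + 1 / (n : ℝ≥0)) atTop (𝓝 (t + 0)) :=
      tendsto_const_nhds.add (tendsto_one_div_atTop_nhds_zero_nat (𝕜 := ℝ≥0))
    rw [add_zero] at h
    refine tendsto_of_tendsto_of_tendsto_of_le_of_le' tendsto_const_nhds h ?_ ?_
    · filter_upwards [eventually_gt_atTop 0] with n hn using (lt_gridAbove hn t).le
    · filter_upwards [eventually_gt_atTop 0] with n hn using gridAbove_le hn t
  · filter_upwards [eventually_gt_atTop 0] with n hn using lt_gridAbove hn t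

/-- Evaluation of a right-continuous path, as a jointly measurable function. -/
noncomputable def pathEval (x : ℝ≥0 × (ℝ≥0 → ℝ)) : ℝ :=
  limsup (fun n : ℕ => x.2 (gridAbove n x.1)) atTop

/-- For fixed `n` the evaluation point takes countably many values, so joint measurability reduces
to that of single coordinates. -/
theorem measurable_pathEval : Measurable pathEval := by
  refine Measurable.limsup fun n => ?_
  have h : Measurable (fun y : ℕ × (ℝ≥0 → ℝ) => y.2 ((y.1 + 1 : ℕ) / n)) :=
    measurable_from_prod_countable_right fun k =>
      measurable_pi_apply (((k + 1 : ℕ) : ℝ≥0) / n)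
  have h2 : Measurable (fun x : ℝ≥0 × (ℝ≥0 → ℝ) => (⌊(n : ℝ≥0) * x.1⌋₊, x.2)) := by fun_prop
  exact h.comp h2

theorem IsRegularPath.pathEval_eq {f : ℝ≥0 → ℝ} (hf : IsRegularPath f) (t : ℝ≥0) :
    pathEval (t, f) = f t :=
  (((hf.rightCont t).mono Ioi_subset_Ici_self).tendsto.comp (tendsto_gridAbove t)).limsup_eq

/-- The running minimum of a regular path, as a jointly measurable function. -/
noncomputable def pathInf (x : ℝ≥0 × (ℝ≥0 → ℝ)) : ℝ :=
  ⨅ k : ℕ × ℕ, pathEval (min ((k.1 : ℝ≥0) / k.2) x.1, x.2)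

theorem measurable_pathInf : Measurable pathInf := by
  refine Measurable.iInf fun k => measurable_pathEval.comp ?_
  fun_prop

theorem IsRegularPath.pathInf_eq {f : ℝ≥0 → ℝ} (hf : IsRegularPath f) (t : ℝ≥0) :
    pathInf (t, f) = ⨅ v : Iic t, f v := by
  obtain ⟨u, hu, h, e⟩ := hf.exists_isMinOn t
  rw [e, pathInf]
  simp only [hf.pathEval_eq]
  have hb : BddBelow (range fun k : ℕ × ℕ => f (min ((k.1 : ℝ≥0) / k.2) t)) :=
    ⟨f u, by rintro _ ⟨k, rfl⟩; exact h _ (min_le_right _ _)⟩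
  refine le_antisymm (le_of_forall_pos_le_add fun ε hε => ?_)
    (le_ciInf fun k => h _ (min_le_right _ _))
  have hr : ∀ᶠ s in 𝓝[≥] u, f s < f u + ε :=
    (hf.rightCont u).eventually_lt_const (by linarith)
  -- Grid points just above the minimizer `u` may exceed `t`; capped at `t` they still approach `u`
  -- from the right, also when `u = t`.
  have hg : Tendsto (fun n => min (gridAbove n u) t) atTop (𝓝[≥] u) := by
    refine tendsto_nhdsWithin_iff.2 ⟨?_, ?_⟩
    · have := ((tendsto_gridAbove u).mono_right nhdsWithin_le_nhds).min
        (tendsto_const_nhds (x := t))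
      rwa [min_eq_left hu] at this
    · filter_upwards [eventually_gt_atTop 0] with n hn
      exact le_min (lt_gridAbove hn u).le hu
  obtain ⟨n, hn⟩ := (hg.eventually hr).exists
  exact (ciInf_le hb (⌊n * u⌋₊ + 1, n)).trans hn.le

theorem IsRegularPath.iInf_le_neg_iff {Ω : Type*} {X : ℝ≥0 → Ω → ℝ} {ω : Ω}
    (hf : IsRegularPath fun t => X t ω) (y : ℝ) (t : ℝ≥0) :
    runInf X t ω ≤ -y ↔ tau X y ω ≤ t := by
  constructor
  · intro h
    obtain ⟨u, hu, -, e⟩ := hf.exists_isMinOn t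
    have e' : runInf X t ω = X u ω := e
    rw [e'] at h
    exact (iInf₂_le u h).trans (by exact_mod_cast hu)
  · intro h
    by_contra! hlt
    -- The path exceeds `-y` on all of `[0, t]`, hence a little beyond `t`, which keeps the passage
    -- time strictly above `t`.
    have hr : ∀ᶠ s in 𝓝[≥] t, -y < X s ω :=
      (hf.lsc t (-y) (hlt.trans_le (hf.iInf_le le_rfl))).filter_mono nhdsWithin_le_nhds
    obtain ⟨b, hb, hsub⟩ := (mem_nhdsGE_iff_exists_Ico_subset).1 hr
    have : (b : ℝ≥0∞) ≤ tau X y ω := by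
      refine le_iInf₂ fun s hs => ?_
      by_contra! hsb
      have hsb' : s < b := by exact_mod_cast hsb
      rcases le_total s t with hst | hst
      · exact absurd (hlt.trans_le (hf.iInf_le hst)) (not_lt.2 hs)
      · exact absurd (hsub ⟨hst, hsb'⟩) (not_lt.2 hs)
    have hbt : b ≤ t := by exact_mod_cast this.trans h
    exact absurd hb (not_lt.2 hbt)

end MAPQueue

namespace MAPQueue

/-! ### Paths with left limits -/

theorem IsCadlag.tendsto_leftLim {E : Type*} [TopologicalSpace E] {f : ℝ≥0 → E}
    (hf : IsCadlag f) (t : ℝ≥0) : Tendsto f (𝓝[<] t) (𝓝 (Function.leftLim f t)) :=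
  tendsto_leftLim_of_tendsto (hf.2 t)

/-- Lower semicontinuity is checked on each side: right-continuity on the right, and a left limit at
least the value on the left. -/
theorem IsCadlag.isRegularPath {f : ℝ≥0 → ℝ} (hf : IsCadlag f)
    (h : ∀ t, f t ≤ Function.leftLim f t) : IsRegularPath f := by
  refine ⟨hf.1, fun t y hy => ?_⟩
  rw [← nhdsLT_sup_nhdsGE, eventually_sup]
  exact ⟨(hf.tendsto_leftLim t).eventually_const_lt (hy.trans_le (h t)),
    (hf.1 t).eventually_const_lt hy⟩

/-! ### Càdlàg paths in a discrete space and their transition epochs -/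

section Discrete

variable {E : Type*} [TopologicalSpace E] [DiscreteTopology E] {f : ℝ≥0 → E}

theorem IsCadlag.eventually_eq_leftLim (hf : IsCadlag f) (t : ℝ≥0) :
    ∀ᶠ s in 𝓝[<] t, f s = Function.leftLim f t := by
  have h := hf.tendsto_leftLim t
  rw [nhds_discrete] at h
  exact tendsto_pure.1 h

theorem IsCadlag.eventually_eq_right (hf : IsCadlag f) (t : ℝ≥0) :
    ∀ᶠ s in 𝓝[≥] t, f s = f t := by
  have h := (hf.1 t).tendsto
  rw [nhds_discrete] at h
  exact tendsto_pure.1 h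

theorem IsCadlag.exists_lt_eq_leftLim (hf : IsCadlag f) {t : ℝ≥0} (ht : 0 < t) :
    ∃ a < t, ∀ s ∈ Ico a t, f s = Function.leftLim f t := by
  obtain ⟨a, ha, h⟩ := (mem_nhdsLT_iff_exists_mem_Ico_Ioo_subset ht).1
    (hf.eventually_eq_leftLim t)
  obtain ⟨b, hab, hbt⟩ := exists_between ha.2
  exact ⟨b, hbt, fun s hs => h ⟨hab.trans_le hs.1, hs.2⟩⟩

theorem IsCadlag.exists_gt_eq (hf : IsCadlag f) (t : ℝ≥0) :
    ∃ b > t, ∀ s ∈ Ico t b, f s = f t := by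
  obtain ⟨b, hb, h⟩ := (mem_nhdsGE_iff_exists_Ico_subset).1 (hf.eventually_eq_right t)
  exact ⟨b, hb, fun s hs => h hs⟩

theorem leftLim_eq_of_forall_Ico {a t : ℝ≥0} (hat : a < t) {c : E} (h : ∀ s ∈ Ico a t, f s = c) :
    Function.leftLim f t = c := by
  have : (𝓝[<] t).NeBot := nhdsLT_neBot_of_exists_lt ⟨a, hat⟩
  refine leftLim_eq_of_tendsto (tendsto_const_nhds.congr' ?_)
  filter_upwards [Ico_mem_nhdsLT hat] with s hs using (h s hs).symm

/-- At the least element `Function.leftLim` defaults to the value itself, so time `0` is never an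
epoch. -/
theorem leftLim_zero {F : Type*} [TopologicalSpace F] (g : ℝ≥0 → F) :
    Function.leftLim g 0 = g 0 :=
  leftLim_eq_of_isBot fun _ => zero_le

/-- Without epochs the path is continuous on a connected interval, hence constant in a discrete
space. -/
theorem IsCadlag.eq_of_forall_leftLim_eq (hf : IsCadlag f) {a b : ℝ≥0}
    (h : ∀ s ∈ Ioc a b, Function.leftLim f s = f s) {u : ℝ≥0} (hu : u ∈ Icc a b) :
    f u = f a := by
  have hc : ContinuousOn f (Icc a b) := by
    intro s hs
    rcases hs.1.eq_or_lt with rfl | has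
    · exact (hf.1 a).mono Icc_subset_Ici_self
    · refine ContinuousAt.continuousWithinAt ?_
      have hl := hf.tendsto_leftLim s
      rw [h s ⟨has, hs.2⟩] at hl
      rw [ContinuousAt, ← nhdsLT_sup_nhdsGE]
      exact hl.sup (hf.1 s)
  exact isPreconnected_Icc.constant hc hu ⟨le_rfl, hu.1.trans hu.2⟩

theorem IsCadlag.eventually_leftLim_eq (hf : IsCadlag f) (t : ℝ≥0) :
    ∀ᶠ s in 𝓝[≠] t, Function.leftLim f s = f s := by
  have key : ∀ (S : Set ℝ≥0) (c : E), IsOpen S → (∀ᶠ s in 𝓝[S] t, f s = c) →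
      ∀ᶠ s in 𝓝[S] t, Function.leftLim f s = f s := by
    intro S c hS h
    filter_upwards [eventually_eventually_nhdsWithin.2 h, self_mem_nhdsWithin] with s hs hsS
    rw [hS.nhdsWithin_eq hsS] at hs
    refine ContinuousWithinAt.leftLim_eq (ContinuousAt.continuousWithinAt ?_)
    rw [ContinuousAt, hs.self_of_nhds]
    exact tendsto_const_nhds.congr' (hs.mono fun _ h => h.symm)
  rw [← nhdsLT_sup_nhdsGT, eventually_sup]
  exact ⟨key _ _ isOpen_Iio (hf.eventually_eq_leftLim t),
    key _ _ isOpen_Ioi ((hf.eventually_eq_right t).filter_mono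
      (nhdsWithin_mono _ Ioi_subset_Ici_self))⟩

end Discrete

variable {d : ℕ}

/-- Infinitely many epochs would accumulate in the compact interval, but the path is constant close
to any point on either side. -/
theorem IsCadlag.finite_epochs {J : ℝ≥0 → Fin d} (hJ : IsCadlag J) (t : ℝ≥0) :
    (epochs J t).Finite := by
  by_contra hinf
  have hK : IsCompact (Iic t) := by rw [← Icc_bot]; exact isCompact_Icc
  obtain ⟨x, -, hx⟩ := Set.Infinite.exists_accPt_of_subset_isCompact hinf hK fun s hs => hs.1
  rw [accPt_iff_frequently_nhdsNE] at hx
  exact hx ((hJ.eventually_leftLim_eq x).mono fun s hs h => h.2 hs)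

theorem epochs_pos {J : ℝ≥0 → Fin d} {t s : ℝ≥0} (h : s ∈ epochs J t) : 0 < s := by
  refine pos_iff_ne_zero.2 ?_
  rintro rfl
  exact h.2 (leftLim_zero J)

/-! ### A modulated path -/

/-- The path `X` is built from the chain path `J`, the paths `l i` and the jumps `u n i j`. -/
structure IsModulatedPath (J : ℝ≥0 → Fin d) (l : Fin d → ℝ≥0 → ℝ) (u : ℕ → Fin d → Fin d → ℝ)
    (X : ℝ≥0 → ℝ) : Prop where
  chain : IsCadlag J
  levy : ∀ i, IsCadlag (l i)
  levy_jump : ∀ i t, l i t ≤ Function.leftLim (l i) t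
  jump_nonpos : ∀ n i j, i ≠ j → u n i j ≤ 0
  sojourn : ∀ s t, s ≤ t → (∀ v ∈ Icc s t, J v = J s) → X t - X s = l (J s) t - l (J s) s
  transition : ∀ t, Function.leftLim J t ≠ J t →
    X t = Function.leftLim X t +
      u (epochs J t).ncard (Function.leftLim J t) (J t)

namespace IsModulatedPath

variable {J : ℝ≥0 → Fin d} {l : Fin d → ℝ≥0 → ℝ} {u : ℕ → Fin d → Fin d → ℝ} {X : ℝ≥0 → ℝ}

theorem tendsto_left (h : IsModulatedPath J l u X) {a t : ℝ≥0} (hat : a < t) {i : Fin d}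
    (hi : ∀ s ∈ Ico a t, J s = i) :
    Tendsto X (𝓝[<] t) (𝓝 (X a + (Function.leftLim (l i) t - l i a))) := by
  have h1 : Tendsto (fun s => X a + (l i s - l i a)) (𝓝[<] t)
      (𝓝 (X a + (Function.leftLim (l i) t - l i a))) :=
    tendsto_const_nhds.add (((h.levy i).tendsto_leftLim t).sub tendsto_const_nhds)
  refine h1.congr' ?_
  filter_upwards [Ico_mem_nhdsLT hat] with s hs
  have ha : J a = i := hi a ⟨le_rfl, hat⟩
  have := h.sojourn a s hs.1 fun v hv => by rw [hi v ⟨hv.1, hv.2.trans_lt hs.2⟩, ha]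
  rw [ha] at this
  linarith

theorem leftLim_eq (h : IsModulatedPath J l u X) {a t : ℝ≥0} (hat : a < t) {i : Fin d}
    (hi : ∀ s ∈ Ico a t, J s = i) :
    Function.leftLim X t = X a + (Function.leftLim (l i) t - l i a) := by
  have : (𝓝[<] t).NeBot := nhdsLT_neBot_of_exists_lt ⟨a, hat⟩
  exact leftLim_eq_of_tendsto (h.tendsto_left hat hi)

/-- On each side of a time `X` is locally a translate of a single Lévy path. A discontinuity is
either one of that path or, at an epoch, the jump `u`; neither goes upward. -/
theorem isRegularPath (h : IsModulatedPath J l u X) : IsRegularPath X := by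
  refine IsCadlag.isRegularPath ⟨fun t => ?_, fun t => ?_⟩ fun t => ?_
  · obtain ⟨b, hb, hJ⟩ := h.chain.exists_gt_eq t
    have h1 : Tendsto (fun s => X t + (l (J t) s - l (J t) t)) (𝓝[≥] t)
        (𝓝 (X t + (l (J t) t - l (J t) t))) :=
      tendsto_const_nhds.add (((h.levy _).1 t).tendsto.sub tendsto_const_nhds)
    rw [sub_self, add_zero] at h1
    refine h1.congr' ?_
    filter_upwards [Ico_mem_nhdsGE hb] with s hs
    have := h.sojourn t s hs.1 fun v hv => hJ v ⟨hv.1, hv.2.trans_lt hs.2⟩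
    linarith
  · rcases eq_zero_or_pos t with rfl | ht
    -- There is nothing to the left of `0`, so any limit will do.
    · exact ⟨0, by simp⟩
    · obtain ⟨a, hat, hJ⟩ := h.chain.exists_lt_eq_leftLim ht
      exact ⟨_, h.tendsto_left hat hJ⟩
  · rcases eq_zero_or_pos t with rfl | ht
    · exact (leftLim_zero X).ge
    · by_cases hep : Function.leftLim J t = J t
      · obtain ⟨a, hat, hJ⟩ := h.chain.exists_lt_eq_leftLim ht
        rw [h.leftLim_eq hat hJ, hep]
        have ha : J a = J t := by rw [hJ a ⟨le_rfl, hat⟩, hep]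
        have := h.sojourn a t hat.le fun v hv => by
          rcases hv.2.eq_or_lt with rfl | hvt
          · exact ha.symm
          · rw [hJ v ⟨hv.1, hvt⟩, hep, ha]
        rw [ha] at this
        linarith [h.levy_jump (J t) t]
      · rw [h.transition t hep]
        linarith [h.jump_nonpos (epochs J t).ncard _ _ hep]

/-- The error made on `[a, b]` when the state is frozen at time `a`. -/
def freezeError (J : ℝ≥0 → Fin d) (l : Fin d → ℝ≥0 → ℝ) (X : ℝ≥0 → ℝ) (a b : ℝ≥0) : ℝ :=
  X b - X a - (l (J a) b - l (J a) a)

theorem freezeError_eq_zero (h : IsModulatedPath J l u X) {a b : ℝ≥0} (hab : a ≤ b)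
    (hno : ∀ s ∈ Ioc a b, Function.leftLim J s = J s) : freezeError J l X a b = 0 := by
  rw [freezeError, h.sojourn a b hab fun v hv => h.chain.eq_of_forall_leftLim_eq hno hv, sub_self]

theorem eq_of_unique_epoch (h : IsModulatedPath J l u X) {a b σ : ℝ≥0} (hσ : σ ∈ Ioc a b)
    (huniq : ∀ s ∈ Ioc a b, s ≠ σ → Function.leftLim J s = J s) :
    (∀ v ∈ Ico a σ, J v = Function.leftLim J σ) ∧ ∀ v ∈ Icc σ b, J v = J σ := by
  have h1 : ∀ v ∈ Ico a σ, J v = J a := fun v hv =>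
    h.chain.eq_of_forall_leftLim_eq (a := a) (b := v)
      (fun s hs => huniq s ⟨hs.1, hs.2.trans (hv.2.le.trans hσ.2)⟩ (hs.2.trans_lt hv.2).ne)
      ⟨hv.1, le_rfl⟩
  refine ⟨fun v hv => ?_, fun v hv => ?_⟩
  · rw [h1 v hv, leftLim_eq_of_forall_Ico hσ.1 h1]
  · exact h.chain.eq_of_forall_leftLim_eq (a := σ) (b := b)
      (fun s hs => huniq s ⟨hσ.1.trans hs.1, hs.2⟩ hs.1.ne') hv

/-- After the epoch the frozen path follows the old Lévy process instead of the new one, which gives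
the bracket. It is an inequality because the old process may itself jump at `σ`; that jump is
downward and enters only the frozen path. -/
theorem le_freezeError (h : IsModulatedPath J l u X) {a b σ : ℝ≥0} (hσ : σ ∈ Ioc a b)
    (hep : Function.leftLim J σ ≠ J σ)
    (huniq : ∀ s ∈ Ioc a b, s ≠ σ → Function.leftLim J s = J s) :
    u (epochs J σ).ncard (Function.leftLim J σ) (J σ) +
        ((l (J σ) b - l (J σ) σ) - (l (Function.leftLim J σ) b - l (Function.leftLim J σ) σ)) ≤
      freezeError J l X a b := by
  obtain ⟨hl, hr⟩ := h.eq_of_unique_epoch hσ huniq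
  have h1 := h.transition σ hep
  have h2 := h.leftLim_eq hσ.1 hl
  have h3 := h.sojourn σ b hσ.2 hr
  have h4 := h.levy_jump (Function.leftLim J σ) σ
  rw [freezeError, hl a ⟨le_rfl, hσ.1⟩]
  linarith

end IsModulatedPath

end MAPQueue

/-! ### Approximation of a modulated path on a grid -/

namespace MAPQueue

variable {d : ℕ}

/-- The sum of the increments of `l i` over those of the first `K` cells of the grid of mesh `1 / n`
at whose left end the state is `i`. -/
noncomputable def frozenSum (l : Fin d → ℝ≥0 → ℝ) (n K : ℕ) (a : ℕ → Fin d) (i : Fin d) : ℝ :=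
  ∑ k ∈ Finset.range K with a k = i, (l i (((k + 1 : ℕ) : ℝ≥0) / n) - l i ((k : ℝ≥0) / n))

/-- The number of changes of a sequence of states in its first `K` steps. -/
def changes (K : ℕ) (a : ℕ → Fin d) : ℕ :=
  ((Finset.range K).filter fun k => a k ≠ a (k + 1)).card

/-- The index of the cell `(k / n, (k + 1) / n]` that contains `σ > 0`. -/
noncomputable def cellIndex (n : ℕ) (σ : ℝ≥0) : ℕ := ⌈n * σ⌉₊ - 1

theorem mem_cell {n : ℕ} (hn : 0 < n) {σ : ℝ≥0} (hσ : 0 < σ) :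
    σ ∈ Ioc ((cellIndex n σ : ℝ≥0) / n) (((cellIndex n σ + 1 : ℕ) : ℝ≥0) / n) := by
  have hn' : (0 : ℝ≥0) < n := by exact_mod_cast hn
  have hpos : 0 < ⌈n * σ⌉₊ := Nat.ceil_pos.2 (by positivity)
  have h1 : cellIndex n σ + 1 = ⌈n * σ⌉₊ := Nat.sub_add_cancel hpos
  constructor
  · rw [div_lt_iff₀ hn', mul_comm σ]
    exact Nat.lt_ceil.1 (by omega)
  · rw [le_div_iff₀ hn', mul_comm σ, h1]
    exact Nat.le_ceil _

theorem cellIndex_eq {n k : ℕ} (hn : 0 < n) {σ : ℝ≥0}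
    (h : σ ∈ Ioc ((k : ℝ≥0) / n) (((k + 1 : ℕ) : ℝ≥0) / n)) : cellIndex n σ = k := by
  have hn' : (0 : ℝ≥0) < n := by exact_mod_cast hn
  have h1 := (div_lt_iff₀ hn').1 h.1
  have h2 := (le_div_iff₀ hn').1 h.2
  rw [mul_comm] at h1 h2
  have h3 : k < ⌈n * σ⌉₊ := Nat.lt_ceil.2 h1
  have h4 : ⌈n * σ⌉₊ ≤ k + 1 := Nat.ceil_le.2 h2
  rw [cellIndex]; omega

theorem cellIndex_lt {n M : ℕ} (hn : 0 < n) {σ : ℝ≥0} (hσ : 0 < σ) (hM : σ ≤ M) :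
    cellIndex n σ < n * M := by
  have hpos : 0 < ⌈n * σ⌉₊ := Nat.ceil_pos.2 (by positivity)
  have : ⌈n * σ⌉₊ ≤ n * M := Nat.ceil_le.2 (by push_cast; gcongr)
  rw [cellIndex]; omega

theorem cell_right_le {n M k : ℕ} (hn : 0 < n) (hk : k < n * M) :
    ((k + 1 : ℕ) : ℝ≥0) / n ≤ M := by
  have hn' : (0 : ℝ≥0) < n := by exact_mod_cast hn
  rw [div_le_iff₀ hn', mul_comm]
  exact_mod_cast hk

theorem cell_right_eq {n k : ℕ} : ((k + 1 : ℕ) : ℝ≥0) / n = k / n + 1 / n := by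
  push_cast; rw [add_div]

theorem tendsto_cell_right {σ : ℝ≥0} (hσ : 0 < σ) :
    Tendsto (fun n : ℕ => ((cellIndex n σ + 1 : ℕ) : ℝ≥0) / n) atTop (𝓝[≥] σ) := by
  refine tendsto_nhdsWithin_iff.2 ⟨?_, ?_⟩
  · have h : Tendsto (fun n : ℕ => σ + 1 / (n : ℝ≥0)) atTop (𝓝 (σ + 0)) :=
      tendsto_const_nhds.add (tendsto_one_div_atTop_nhds_zero_nat (𝕜 := ℝ≥0))
    rw [add_zero] at h
    refine tendsto_of_tendsto_of_tendsto_of_le_of_le' tendsto_const_nhds h ?_ ?_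
    · filter_upwards [eventually_gt_atTop 0] with n hn using (mem_cell hn hσ).2
    · filter_upwards [eventually_gt_atTop 0] with n hn
      rw [cell_right_eq]
      gcongr
      exact (mem_cell hn hσ).1.le
  · filter_upwards [eventually_gt_atTop 0] with n hn using (mem_cell hn hσ).2

/-- For a fine enough grid every cell contains at most one epoch. -/
theorem eventually_unique_epoch {J : ℝ≥0 → Fin d} (hJ : IsCadlag J) (M : ℕ) :
    ∀ᶠ n : ℕ in atTop, 0 < n ∧ ∀ σ ∈ epochs J M, ∀ s ∈ Ioc ((cellIndex n σ : ℝ≥0) / n)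
      (((cellIndex n σ + 1 : ℕ) : ℝ≥0) / n), s ≠ σ → Function.leftLim J s = J s := by
  have hfin := hJ.finite_epochs M
  -- The epochs are finitely many, so the mesh eventually falls below all their gaps.
  have hsep : ∀ᶠ n : ℕ in atTop, ∀ σ ∈ epochs J M, ∀ s ∈ epochs J M, σ < s → σ + 1 / n < s := by
    rw [hfin.eventually_all]
    intro σ _
    rw [hfin.eventually_all]
    intro s _
    by_cases hσs : σ < s
    · have h : Tendsto (fun n : ℕ => σ + 1 / (n : ℝ≥0)) atTop (𝓝 (σ + 0)) :=
        tendsto_const_nhds.add (tendsto_one_div_atTop_nhds_zero_nat (𝕜 := ℝ≥0))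
      rw [add_zero] at h
      filter_upwards [h.eventually_lt_const hσs] with n hn _ using hn
    · exact Eventually.of_forall fun n h => absurd h hσs
  filter_upwards [hsep, eventually_gt_atTop 0] with n hn hn0
  refine ⟨hn0, fun σ hσ s hs hne => ?_⟩
  by_contra hep
  have hσ0 := epochs_pos hσ
  have hsM : s ∈ epochs J M :=
    ⟨hs.2.trans (cell_right_le hn0 (cellIndex_lt hn0 hσ0 hσ.1)), hep⟩
  have key : ∀ {x y : ℝ≥0}, x ∈ epochs J M → y ∈ epochs J M →
      x ∈ Ioc ((cellIndex n σ : ℝ≥0) / n) (((cellIndex n σ + 1 : ℕ) : ℝ≥0) / n) →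
      y ∈ Ioc ((cellIndex n σ : ℝ≥0) / n) (((cellIndex n σ + 1 : ℕ) : ℝ≥0) / n) → ¬ x < y := by
    intro x y hx hy hxc hyc hxy
    have h1 := hn x hx y hy hxy
    have h2 := hyc.2
    rw [cell_right_eq] at h2
    exact absurd (h1.trans_le h2) (not_lt.2 (by gcongr; exact hxc.1.le))
  rcases lt_or_gt_of_ne hne with hlt | hlt
  · exact key hsM hσ hs (mem_cell hn0 hσ0) hlt
  · exact key hσ hsM (mem_cell hn0 hσ0) hs hlt

/-- The running count identifies the epoch: no two transitions use a jump with the same index. -/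
theorem ncard_epochs_lt {J : ℝ≥0 → Fin d} (hJ : IsCadlag J) {M : ℝ≥0} {σ s : ℝ≥0}
    (hs : s ∈ epochs J M) (h : σ < s) : (epochs J σ).ncard < (epochs J s).ncard := by
  refine Set.ncard_lt_ncard ?_ (hJ.finite_epochs s)
  refine ⟨fun x hx => ⟨hx.1.trans h.le, hx.2⟩, fun hsub => ?_⟩
  exact absurd (hsub (⟨le_rfl, hs.2⟩ : s ∈ epochs J s)).1 (not_le.2 h)

namespace IsModulatedPath

variable {J : ℝ≥0 → Fin d} {l : Fin d → ℝ≥0 → ℝ} {u : ℕ → Fin d → Fin d → ℝ} {X : ℝ≥0 → ℝ}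

theorem eventually_states (h : IsModulatedPath J l u X) (M : ℕ) :
    ∀ᶠ n : ℕ in atTop, ∀ σ ∈ epochs J M, cellIndex n σ < n * M ∧
      J ((cellIndex n σ : ℝ≥0) / n) = Function.leftLim J σ ∧
      J (((cellIndex n σ + 1 : ℕ) : ℝ≥0) / n) = J σ := by
  filter_upwards [eventually_unique_epoch h.chain M] with n hn σ hσ
  have hc := mem_cell hn.1 (epochs_pos hσ)
  obtain ⟨hl, hr⟩ := h.eq_of_unique_epoch hc (hn.2 σ hσ)
  exact ⟨cellIndex_lt hn.1 (epochs_pos hσ) hσ.1, hl _ ⟨le_rfl, hc.1⟩, hr _ ⟨hc.2, le_rfl⟩⟩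

/-- The increment of `X` telescopes over the cells, and freezing is exact on cells without an epoch.
Each remaining cell has one epoch and costs its jump plus a term that vanishes with the mesh; `ε`
absorbs the sum of these terms. -/
theorem sum_frozenSum_le (h : IsModulatedPath J l u X) (M : ℕ) {B : ℕ → ℝ} (hB0 : ∀ m, 0 ≤ B m)
    (hB : ∀ σ ∈ epochs J M, |u (epochs J σ).ncard (Function.leftLim J σ) (J σ)| ≤
      B (epochs J σ).ncard) {ε : ℝ} (hε : 0 < ε) :
    ∀ᶠ n : ℕ in atTop,
      ∑ i, frozenSum l n (n * M) (fun k => J ((k : ℝ≥0) / n)) i -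
        ∑ m ∈ Finset.Icc 1 (changes (n * M) fun k => J ((k : ℝ≥0) / n)), B m - ε ≤ X M - X 0 := by
  classical
  have hfin := h.chain.finite_epochs M
  set E := hfin.toFinset with hE
  have memE : ∀ {σ}, σ ∈ E ↔ σ ∈ epochs J M := by simp [hE]
  -- The bracket of `le_freezeError`. It tends to `0` by right-continuity, as the right end of the
  -- cell decreases to `σ`.
  let δ : ℕ → ℝ≥0 → ℝ := fun n σ =>
    (l (J σ) (((cellIndex n σ + 1 : ℕ) : ℝ≥0) / n) - l (J σ) σ) -
      (l (Function.leftLim J σ) (((cellIndex n σ + 1 : ℕ) : ℝ≥0) / n) -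
        l (Function.leftLim J σ) σ)
  have hδ : Tendsto (fun n => ∑ σ ∈ E, δ n σ) atTop (𝓝 0) := by
    rw [← Finset.sum_const_zero (s := E)]
    refine tendsto_finsetSum _ fun σ hσ => ?_
    have hc := tendsto_cell_right (epochs_pos (memE.1 hσ))
    have ht : ∀ i, Tendsto (fun n : ℕ => l i (((cellIndex n σ + 1 : ℕ) : ℝ≥0) / n) - l i σ) atTop
        (𝓝 0) := fun i => by
      have := (((h.levy i).1 σ).tendsto.comp hc).sub_const (l i σ)
      rwa [sub_self] at this
    have := (ht (J σ)).sub (ht (Function.leftLim J σ))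
    rwa [sub_zero] at this
  filter_upwards [eventually_unique_epoch h.chain M, h.eventually_states M,
    hδ.eventually_const_lt (neg_lt_zero.2 hε)] with n hn hst hδn
  obtain ⟨hn0, huniq⟩ := hn
  have hinj : Set.InjOn (cellIndex n) E := by
    intro σ hσ s hs hcell
    by_contra hne
    have hs' := mem_cell hn0 (epochs_pos (memE.1 hs))
    rw [← hcell] at hs'
    exact (memE.1 hs).2 (huniq σ (memE.1 hσ) s hs' (Ne.symm hne))
  have hXsum : X M - X 0 - ∑ i, frozenSum l n (n * M) (fun k => J ((k : ℝ≥0) / n)) i =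
      ∑ k ∈ Finset.range (n * M),
        freezeError J l X ((k : ℝ≥0) / n) (((k + 1 : ℕ) : ℝ≥0) / n) := by
    have h1 : ∑ i, frozenSum l n (n * M) (fun k => J ((k : ℝ≥0) / n)) i =
        ∑ k ∈ Finset.range (n * M), (l (J ((k : ℝ≥0) / n)) (((k + 1 : ℕ) : ℝ≥0) / n) -
          l (J ((k : ℝ≥0) / n)) ((k : ℝ≥0) / n)) := by
      simp only [frozenSum, Finset.sum_filter]
      rw [Finset.sum_comm]
      refine Finset.sum_congr rfl fun k _ => ?_
      simp
    have h2 : X M - X 0 = ∑ k ∈ Finset.range (n * M),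
        (X (((k + 1 : ℕ) : ℝ≥0) / n) - X ((k : ℝ≥0) / n)) := by
      have hn' : (n : ℝ≥0) ≠ 0 := by exact_mod_cast hn0.ne'
      rw [Finset.sum_range_sub (fun k : ℕ => X ((k : ℝ≥0) / n))]
      push_cast
      rw [mul_div_cancel_left₀ _ hn', zero_div]
    rw [h1, h2, ← Finset.sum_sub_distrib]
    rfl
  have hE2 : ∑ k ∈ Finset.range (n * M),
        freezeError J l X ((k : ℝ≥0) / n) (((k + 1 : ℕ) : ℝ≥0) / n) =
      ∑ σ ∈ E, freezeError J l X ((cellIndex n σ : ℝ≥0) / n)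
        (((cellIndex n σ + 1 : ℕ) : ℝ≥0) / n) := by
    rw [← Finset.sum_image (g := cellIndex n)
      (f := fun k : ℕ => freezeError J l X ((k : ℝ≥0) / n) (((k + 1 : ℕ) : ℝ≥0) / n)) hinj]
    symm
    refine Finset.sum_subset ?_ ?_
    · intro k hk
      obtain ⟨σ, hσ, rfl⟩ := Finset.mem_image.1 hk
      exact Finset.mem_range.2 (hst σ (memE.1 hσ)).1
    · intro k hk hnot
      refine h.freezeError_eq_zero (by gcongr; exact Nat.le_succ k) fun s hs => ?_
      by_contra hep
      refine hnot (Finset.mem_image.2 ⟨s, memE.2 ⟨hs.2.trans ?_, hep⟩, cellIndex_eq hn0 hs⟩)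
      exact cell_right_le hn0 (Finset.mem_range.1 hk)
  have hlow : ∑ σ ∈ E, (u (epochs J σ).ncard (Function.leftLim J σ) (J σ) + δ n σ) ≤
      ∑ σ ∈ E, freezeError J l X ((cellIndex n σ : ℝ≥0) / n)
        (((cellIndex n σ + 1 : ℕ) : ℝ≥0) / n) := by
    refine Finset.sum_le_sum fun σ hσ => ?_
    have hσ' := memE.1 hσ
    exact h.le_freezeError (mem_cell hn0 (epochs_pos hσ')) hσ'.2 (huniq σ hσ')
  -- Every epoch is seen as a change of state across its own cell, so counting on the grid misses
  -- none.
  have hcardE : E.card ≤ changes (n * M) fun k => J ((k : ℝ≥0) / n) := by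
    rw [← Finset.card_image_of_injOn hinj]
    refine Finset.card_le_card fun k hk => ?_
    obtain ⟨σ, hσ, rfl⟩ := Finset.mem_image.1 hk
    obtain ⟨h1, h2, h3⟩ := hst σ (memE.1 hσ)
    refine Finset.mem_filter.2 ⟨Finset.mem_range.2 h1, ?_⟩
    beta_reduce
    rw [h2, h3]
    exact (memE.1 hσ).2
  have hjump : -∑ m ∈ Finset.Icc 1 (changes (n * M) fun k => J ((k : ℝ≥0) / n)), B m ≤
      ∑ σ ∈ E, u (epochs J σ).ncard (Function.leftLim J σ) (J σ) := by
    -- The jump indices are distinct, at least `1` and at most the number of changes, so the sum of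
    -- the `B` over the epochs is part of the sum over `Finset.Icc`.
    have hinj2 : Set.InjOn (fun σ => (epochs J σ).ncard) E := by
      intro σ hσ s hs hc
      rcases lt_trichotomy σ s with hlt | heq | hlt
      · exact absurd hc (ncard_epochs_lt h.chain (memE.1 hs) hlt).ne
      · exact heq
      · exact absurd hc (ncard_epochs_lt h.chain (memE.1 hσ) hlt).ne'
    have h1 : ∑ σ ∈ E, B (epochs J σ).ncard ≤
        ∑ m ∈ Finset.Icc 1 (changes (n * M) fun k => J ((k : ℝ≥0) / n)), B m := by
      rw [← Finset.sum_image (g := fun σ => (epochs J σ).ncard) (f := B) hinj2]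
      refine Finset.sum_le_sum_of_subset_of_nonneg (fun m hm => ?_) fun m _ _ => hB0 m
      obtain ⟨σ, hσ, rfl⟩ := Finset.mem_image.1 hm
      have hσ' := memE.1 hσ
      refine Finset.mem_Icc.2 ⟨?_, le_trans ?_ hcardE⟩
      · exact (Set.ncard_pos (h.chain.finite_epochs σ)).2 ⟨σ, le_rfl, hσ'.2⟩
      · rw [hE, ← Set.ncard_eq_toFinset_card _ hfin]
        exact Set.ncard_le_ncard (fun x hx => ⟨hx.1.trans hσ'.1, hx.2⟩) hfin
    have h2 : -∑ σ ∈ E, B (epochs J σ).ncard ≤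
        ∑ σ ∈ E, u (epochs J σ).ncard (Function.leftLim J σ) (J σ) := by
      rw [← Finset.sum_neg_distrib]
      exact Finset.sum_le_sum fun σ hσ =>
        (neg_le_neg (hB σ (memE.1 hσ))).trans (neg_abs_le _)
    linarith
  rw [Finset.sum_add_distrib] at hlow
  linarith

end IsModulatedPath

end MAPQueue

namespace MAPQueue

variable {Ω : Type*} [MeasurableSpace Ω] {μ : Measure Ω} {d : ℕ}

/-! ### Sums of independent random variables -/

/-- By Fubini `A + b` is integrable for almost every value `b` of `B`; one such `b` is enough. -/
theorem integrable_left_of_integrable_add [IsProbabilityMeasure μ] {A B : Ω → ℝ}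
    (hA : Measurable A) (hB : Measurable B) (hAB : IndepFun A B μ)
    (h : Integrable (fun ω => A ω + B ω) μ) : Integrable A μ := by
  have hm := (indepFun_iff_map_prod_eq_prod_map_map hA.aemeasurable hB.aemeasurable).1 hAB
  have := Measure.isProbabilityMeasure_map (μ := μ) hA.aemeasurable
  have := Measure.isProbabilityMeasure_map (μ := μ) hB.aemeasurable
  have h1 : Integrable (fun p : ℝ × ℝ => p.1 + p.2) ((μ.map A).prod (μ.map B)) := by
    rw [← hm]
    exact (integrable_map_measure (by fun_prop) (by fun_prop)).2 h
  obtain ⟨b, hb⟩ := h1.prod_left_ae.exists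
  have h2 : Integrable id (μ.map A) := by
    have := hb.sub (integrable_const b)
    refine this.congr (Eventually.of_forall fun x => ?_)
    simp
  exact (integrable_map_measure (g := id) (by fun_prop) hA.aemeasurable).1 h2

/-- With `A` frozen at `a`, `|a| = |E (a + B)| ≤ E |a + B|`. -/
theorem integral_abs_le_integral_abs_add [IsProbabilityMeasure μ] {A B : Ω → ℝ}
    (hA : Measurable A) (hB : Measurable B) (hAB : IndepFun A B μ) (hAi : Integrable A μ)
    (hBi : Integrable B μ) (hB0 : ∫ ω, B ω ∂μ = 0) :
    ∫ ω, |A ω| ∂μ ≤ ∫ ω, |A ω + B ω| ∂μ := by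
  have hm := (indepFun_iff_map_prod_eq_prod_map_map hA.aemeasurable hB.aemeasurable).1 hAB
  have := Measure.isProbabilityMeasure_map (μ := μ) hA.aemeasurable
  have := Measure.isProbabilityMeasure_map (μ := μ) hB.aemeasurable
  have hAi' : Integrable id (μ.map A) := (integrable_map_measure (by fun_prop) (by fun_prop)).2 hAi
  have hBi' : Integrable id (μ.map B) := (integrable_map_measure (by fun_prop) (by fun_prop)).2 hBi
  have hB0' : ∫ b, b ∂(μ.map B) = 0 := by
    rw [integral_map hB.aemeasurable (by fun_prop), hB0]
  have hsum : Integrable (fun p : ℝ × ℝ => |p.1 + p.2|) ((μ.map A).prod (μ.map B)) :=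
    ((hAi'.comp_fst _).add (hBi'.comp_snd _)).abs
  have h1 : ∫ ω, |A ω + B ω| ∂μ = ∫ a, ∫ b, |a + b| ∂(μ.map B) ∂(μ.map A) := by
    rw [← integral_prod (f := fun p : ℝ × ℝ => |p.1 + p.2|) hsum, ← hm,
      integral_map (by fun_prop) (by fun_prop)]
  have h2 : ∫ ω, |A ω| ∂μ = ∫ a, |a| ∂(μ.map A) := by
    rw [integral_map hA.aemeasurable (by fun_prop)]
  rw [h1, h2]
  refine integral_mono hAi'.abs hsum.integral_prod_left fun a => ?_
  have h3 : ∫ b, (a + b) ∂(μ.map B) = a := by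
    rw [integral_add (g := fun b : ℝ => b) (integrable_const a) hBi', hB0']
    simp
  calc |a| = |∫ b, (a + b) ∂(μ.map B)| := by rw [h3]
    _ ≤ ∫ b, |a + b| ∂(μ.map B) := abs_integral_le_integral_abs

/-- Conditioning on a discrete random variable that is independent of the rest. -/
theorem lintegral_comp_le_of_indepFun {α β : Type*} [Fintype α] [MeasurableSpace α]
    [MeasurableSingletonClass α] [MeasurableSpace β] {A : Ω → α} {Z : Ω → β}
    (hA : Measurable A) (hZ : Measurable Z) (hAZ : IndepFun A Z μ) {F : α → β → ℝ≥0∞}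
    (hF : ∀ a, Measurable (F a)) {c : α → ℝ≥0∞} (hc : ∀ a, ∫⁻ ω, F a (Z ω) ∂μ ≤ c a) :
    ∫⁻ ω, F (A ω) (Z ω) ∂μ ≤ ∫⁻ ω, c (A ω) ∂μ := by
  classical
  let I : α → α → ℝ≥0∞ := fun a => Set.indicator {a} 1
  have hI : ∀ a, Measurable (I a) := fun a => measurable_one.indicator (measurableSet_singleton a)
  have key : ∀ (G : α → ℝ≥0∞) (x : α), G x = ∑ a, I a x * G a := by
    intro G x
    rw [Finset.sum_eq_single x]
    · simp [I]
    · intro b _ hb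
      simp [I, Ne.symm hb]
    · simp
  calc ∫⁻ ω, F (A ω) (Z ω) ∂μ = ∫⁻ ω, ∑ a, I a (A ω) * F a (Z ω) ∂μ :=
        lintegral_congr fun ω => key (fun a => F a (Z ω)) (A ω)
    _ = ∑ a, ∫⁻ ω, I a (A ω) * F a (Z ω) ∂μ :=
        lintegral_finsetSum _ fun a _ => ((hI a).comp hA).mul ((hF a).comp hZ)
    _ = ∑ a, (∫⁻ ω, I a (A ω) ∂μ) * ∫⁻ ω, F a (Z ω) ∂μ :=
        Finset.sum_congr rfl fun a _ => lintegral_mul_eq_lintegral_mul_lintegral_of_indepFun''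
          ((hI a).comp hA).aemeasurable ((hF a).comp hZ).aemeasurable
          (hAZ.comp (hI a) (hF a))
    _ ≤ ∑ a, (∫⁻ ω, I a (A ω) ∂μ) * c a := by gcongr with a; exact hc a
    _ = ∑ a, ∫⁻ ω, I a (A ω) * c a ∂μ :=
        Finset.sum_congr rfl fun a _ => (lintegral_mul_const _ ((hI a).comp hA)).symm
    _ = ∫⁻ ω, ∑ a, I a (A ω) * c a ∂μ :=
        (lintegral_finsetSum _ fun a _ => ((hI a).comp hA).mul_const _).symm
    _ = ∫⁻ ω, c (A ω) ∂μ := lintegral_congr fun ω => (key c (A ω)).symm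

/-! ### Increments of a Lévy process -/

/-- The increment of `L` over the cell `(k / n, (k + 1) / n]`. -/
noncomputable def cellIncr (L : ℝ≥0 → Ω → ℝ) (n k : ℕ) (ω : Ω) : ℝ :=
  L (((k + 1 : ℕ) : ℝ≥0) / n) ω - L ((k : ℝ≥0) / n) ω

namespace IsSpectrallyNegativeLevy

variable {L : ℝ≥0 → Ω → ℝ}

theorem measurable_cellIncr (hL : IsSpectrallyNegativeLevy μ L) (n k : ℕ) :
    Measurable (cellIncr L n k) :=
  (hL.measurable _).sub (hL.measurable _)

theorem iIndepFun_cellIncr (hL : IsSpectrallyNegativeLevy μ L) (n : ℕ) :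
    iIndepFun (cellIncr L n) μ :=
  hL.indep_increments.nat (t := fun k : ℕ => (k : ℝ≥0) / n) fun a b hab => by
    dsimp only; gcongr

theorem identDistrib_cellIncr (hL : IsSpectrallyNegativeLevy μ L) (n k : ℕ) :
    IdentDistrib (cellIncr L n k) (L (1 / n)) μ μ := by
  have := hL.stationary_increments ((k : ℝ≥0) / n) (1 / n)
  rwa [← cell_right_eq] at this

theorem sum_cellIncr (hL : IsSpectrallyNegativeLevy μ L) {n : ℕ} (hn : 0 < n) (M : ℕ) :
    ∀ᵐ ω ∂μ, ∑ k ∈ Finset.range (n * M), cellIncr L n k ω = L M ω := by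
  have hn' : (n : ℝ≥0) ≠ 0 := by exact_mod_cast hn.ne'
  filter_upwards [hL.zero] with ω h0
  simp only [cellIncr]
  rw [Finset.sum_range_sub (fun k : ℕ => L ((k : ℝ≥0) / n) ω)]
  push_cast
  rw [mul_div_cancel_left₀ _ hn', zero_div, h0, sub_zero]

/-- `L 1` is the first cell increment plus the independent sum of the others, so its integrability
descends to the increment. -/
theorem integrable_cellIncr [IsProbabilityMeasure μ] (hL : IsSpectrallyNegativeLevy μ L)
    (h1 : Integrable (L 1) μ) {n : ℕ} (hn : 0 < n) (k : ℕ) : Integrable (cellIncr L n k) μ := by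
  have h0 : Integrable (cellIncr L n 0) μ := by
    have hind := (hL.iIndepFun_cellIncr n).indepFun_finsetSum_of_notMem
      (hL.measurable_cellIncr n) (s := (Finset.range n).erase 0) (i := 0) (by simp)
    rw [Finset.sum_fn] at hind
    refine integrable_left_of_integrable_add (hL.measurable_cellIncr n 0)
      (Finset.measurable_sum _ fun k _ => hL.measurable_cellIncr n k) hind.symm ?_
    have hs := hL.sum_cellIncr hn 1
    refine h1.congr ?_
    filter_upwards [hs] with ω hω
    rw [mul_one, Nat.cast_one] at hω
    rw [← hω, ← Finset.add_sum_erase _ _ (Finset.mem_range.2 hn)]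
  exact ((hL.identDistrib_cellIncr n k).trans (hL.identDistrib_cellIncr n 0).symm).integrable_iff.2
    h0

theorem integral_cellIncr [IsProbabilityMeasure μ] (hL : IsSpectrallyNegativeLevy μ L)
    (h1 : Integrable (L 1) μ) {n : ℕ} (hn : 0 < n) (k : ℕ) :
    n * ∫ ω, cellIncr L n k ω ∂μ = ∫ ω, L 1 ω ∂μ := by
  have hs := hL.sum_cellIncr hn 1
  have h2 : ∫ ω, L 1 ω ∂μ = ∫ ω, ∑ k ∈ Finset.range n, cellIncr L n k ω ∂μ := by
    refine integral_congr_ae ?_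
    filter_upwards [hs] with ω hω
    rw [← Nat.cast_one, ← hω, mul_one]
  rw [h2, integral_finsetSum _ fun k _ => hL.integrable_cellIncr h1 hn k,
    Finset.sum_congr rfl fun j _ => ((hL.identDistrib_cellIncr n j).trans
      (hL.identDistrib_cellIncr n k).symm).integral_eq]
  simp

theorem integral_abs_nat_le [IsProbabilityMeasure μ] (hL : IsSpectrallyNegativeLevy μ L)
    (h1 : Integrable (L 1) μ) (M : ℕ) :
    Integrable (L M) μ ∧ ∫ ω, |L M ω| ∂μ ≤ M * ∫ ω, |L 1 ω| ∂μ := by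
  have hs := hL.sum_cellIncr one_pos M
  have hint : ∀ k, Integrable (cellIncr L 1 k) μ := hL.integrable_cellIncr h1 one_pos
  have hsum : Integrable (fun ω => ∑ k ∈ Finset.range (1 * M), cellIncr L 1 k ω) μ :=
    integrable_finsetSum _ fun k _ => hint k
  refine ⟨hsum.congr hs, ?_⟩
  calc ∫ ω, |L M ω| ∂μ = ∫ ω, |∑ k ∈ Finset.range (1 * M), cellIncr L 1 k ω| ∂μ := by
        refine integral_congr_ae ?_
        filter_upwards [hs] with ω hω
        rw [hω]
    _ ≤ ∫ ω, ∑ k ∈ Finset.range (1 * M), |cellIncr L 1 k ω| ∂μ :=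
        integral_mono hsum.abs (integrable_finsetSum _ fun k _ => (hint k).abs)
          fun ω => Finset.abs_sum_le_sum_abs _ _
    _ = ∑ k ∈ Finset.range (1 * M), ∫ ω, |cellIncr L 1 k ω| ∂μ :=
        integral_finsetSum _ fun k _ => (hint k).abs
    _ = ∑ k ∈ Finset.range (1 * M), ∫ ω, |L 1 ω| ∂μ := by
        refine Finset.sum_congr rfl fun k _ => ?_
        have h := (hL.identDistrib_cellIncr 1 k).comp (measurable_abs (α := ℝ))
        have e := h.integral_eq
        simpa using e
    _ = M * ∫ ω, |L 1 ω| ∂μ := by simp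

/-- Any sum of cell increments inside `[0, M]` is bounded in mean, uniformly in the grid. -/
theorem integral_abs_sum_cellIncr_le [IsProbabilityMeasure μ] (hL : IsSpectrallyNegativeLevy μ L)
    (h1 : Integrable (L 1) μ) {n : ℕ} (hn : 0 < n) (M : ℕ) {S : Finset ℕ}
    (hS : S ⊆ Finset.range (n * M)) :
    ∫ ω, |∑ k ∈ S, cellIncr L n k ω| ∂μ ≤ M * (3 * ∫ ω, |L 1 ω| ∂μ) := by
  have hn' : (0 : ℝ) < n := by exact_mod_cast hn
  set m := ∫ ω, L 1 ω ∂μ with hm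
  have hint := hL.integrable_cellIncr h1 hn
  have hc : ∀ k, ∫ ω, cellIncr L n k ω ∂μ = m / n := fun k => by
    rw [eq_div_iff hn'.ne', mul_comm, hL.integral_cellIncr h1 hn k]
  have hmabs : |m| ≤ ∫ ω, |L 1 ω| ∂μ := abs_integral_le_integral_abs
  set R := Finset.range (n * M)
  -- Once centred, the increments outside `S` form an independent mean-zero summand. Adding them
  -- completes the sum to `L M - M m`, a bound that no longer sees `S` or the mesh.
  have hind : IndepFun (fun ω => ∑ k ∈ S, (cellIncr L n k ω - m / n))
      (fun ω => ∑ k ∈ R \ S, (cellIncr L n k ω - m / n)) μ := by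
    have h := (hL.iIndepFun_cellIncr n).indepFun_finset S (R \ S) Finset.disjoint_sdiff
      (hL.measurable_cellIncr n)
    have h2 := h.comp (φ := fun x : S → ℝ => ∑ k, (x k - m / n))
      (ψ := fun x : (R \ S : Finset ℕ) → ℝ => ∑ k, (x k - m / n)) (by fun_prop) (by fun_prop)
    convert h2 using 1
    · ext ω
      exact (Finset.sum_coe_sort S fun k => cellIncr L n k ω - m / n).symm
    · ext ω
      exact (Finset.sum_coe_sort (R \ S) fun k => cellIncr L n k ω - m / n).symm
  have hmeas : ∀ S' : Finset ℕ, Measurable fun ω => ∑ k ∈ S', (cellIncr L n k ω - m / n) :=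
    fun S' => Finset.measurable_sum _ fun k _ => (hL.measurable_cellIncr n k).sub_const _
  have hinteg : ∀ S' : Finset ℕ, Integrable (fun ω => ∑ k ∈ S', (cellIncr L n k ω - m / n)) μ :=
    fun S' => integrable_finsetSum _ fun k _ => (hint k).sub (integrable_const _)
  have hzero : ∫ ω, ∑ k ∈ R \ S, (cellIncr L n k ω - m / n) ∂μ = 0 := by
    rw [integral_finsetSum (f := fun k ω => cellIncr L n k ω - m / n) _
      fun k _ => (hint k).sub (integrable_const _)]
    refine Finset.sum_eq_zero fun k _ => ?_
    rw [integral_sub (hint k) (integrable_const _), hc k]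
    simp
  have hJ := integral_abs_le_integral_abs_add (hmeas S) (hmeas (R \ S)) hind (hinteg S)
    (hinteg (R \ S)) hzero
  obtain ⟨hLM, hLM2⟩ := hL.integral_abs_nat_le h1 M
  -- The mean `m` costs one `M E |L 1|` here and another when the centring of the sum over `S` is
  -- undone: hence the factor `3`.
  have hR : ∫ ω, |∑ k ∈ S, (cellIncr L n k ω - m / n) +
      ∑ k ∈ R \ S, (cellIncr L n k ω - m / n)| ∂μ ≤ 2 * M * ∫ ω, |L 1 ω| ∂μ := by
    calc _ = ∫ ω, |L M ω - M * m| ∂μ := by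
          refine integral_congr_ae ?_
          filter_upwards [hL.sum_cellIncr hn M] with ω hω
          rw [add_comm (∑ k ∈ S, _), Finset.sum_sdiff hS, Finset.sum_sub_distrib, hω]
          simp only [R, Finset.sum_const, Finset.card_range, nsmul_eq_mul]
          push_cast
          congr 2
          field_simp
      _ ≤ ∫ ω, (|L M ω| + M * |m|) ∂μ := by
          refine integral_mono (hLM.sub (integrable_const _)).abs
            (hLM.abs.add (integrable_const _)) fun ω => ?_
          refine (abs_sub _ _).trans ?_
          rw [abs_mul, Nat.abs_cast]
      _ = ∫ ω, |L M ω| ∂μ + M * |m| := by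
          rw [integral_add hLM.abs (integrable_const _)]; simp
      _ ≤ 2 * M * ∫ ω, |L 1 ω| ∂μ := by
          have : (M : ℝ) * |m| ≤ M * ∫ ω, |L 1 ω| ∂μ := by gcongr
          linarith
  have hcard : (S.card : ℝ) ≤ n * M := by
    have := Finset.card_le_card hS
    rw [Finset.card_range] at this
    exact_mod_cast this
  calc ∫ ω, |∑ k ∈ S, cellIncr L n k ω| ∂μ
      ≤ ∫ ω, (|∑ k ∈ S, (cellIncr L n k ω - m / n)| + M * |m|) ∂μ := by
        refine integral_mono (integrable_finsetSum _ fun k _ => hint k).abs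
          ((hinteg S).abs.add (integrable_const _)) fun ω => ?_
        have e : ∑ k ∈ S, cellIncr L n k ω =
            ∑ k ∈ S, (cellIncr L n k ω - m / n) + S.card * (m / n) := by
          rw [Finset.sum_sub_distrib]; simp
        have e2 : |(S.card : ℝ) * (m / n)| ≤ M * |m| := by
          rw [abs_mul, abs_div, Nat.abs_cast, Nat.abs_cast]
          calc (S.card : ℝ) * (|m| / n) ≤ n * M * (|m| / n) := by gcongr
            _ = M * |m| := by field_simp
        dsimp only
        rw [e]
        exact (abs_add_le _ _).trans (by gcongr)
    _ = ∫ ω, |∑ k ∈ S, (cellIncr L n k ω - m / n)| ∂μ + M * |m| := by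
        rw [integral_add (hinteg S).abs (integrable_const _)]; simp
    _ ≤ M * (3 * ∫ ω, |L 1 ω| ∂μ) := by
        have : (M : ℝ) * |m| ≤ M * ∫ ω, |L 1 ω| ∂μ := by gcongr
        linarith

end IsSpectrallyNegativeLevy

end MAPQueue

namespace MAPQueue

variable {Ω : Type*} [MeasurableSpace Ω] {μ : Measure Ω} {d : ℕ}

/-! ### The background chain -/

/-- The transition matrix over a time step of length `1 / n`. -/
noncomputable def stepMatrix (q : Matrix (Fin d) (Fin d) ℝ) (n : ℕ) : Matrix (Fin d) (Fin d) ℝ :=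
  NormedSpace.exp ((1 / n : ℝ) • q)

section
attribute [local instance] Matrix.linftyOpNormedRing Matrix.linftyOpNormedAlgebra

theorem hasDerivAt_exp_smul_apply (q : Matrix (Fin d) (Fin d) ℝ) (i j : Fin d) :
    HasDerivAt (fun t : ℝ => (NormedSpace.exp (t • q) : Matrix (Fin d) (Fin d) ℝ) i j)
      (q i j) 0 := by
  have h := hasDerivAt_exp_smul_const (𝕂 := ℝ) q 0
  rw [zero_smul, NormedSpace.exp_zero, one_mul] at h
  exact hasDerivAt_pi.1 (hasDerivAt_pi.1 h i) j

end

/-- The derivative of the exponential at `0` along the times `1 / n`. Off the diagonal it shows that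
a step from `i` to `j` has probability `O(1 / n)`, and `o(1 / n)` when the rate is zero. -/
theorem tendsto_stepMatrix (q : Matrix (Fin d) (Fin d) ℝ) (i j : Fin d) :
    Tendsto (fun n : ℕ => n * (stepMatrix q n i j - (1 : Matrix (Fin d) (Fin d) ℝ) i j)) atTop
      (𝓝 (q i j)) := by
  have h := (hasDerivAt_iff_tendsto_slope_zero.1 (hasDerivAt_exp_smul_apply q i j))
  have hn : Tendsto (fun n : ℕ => (1 / n : ℝ)) atTop (𝓝[≠] 0) := by
    refine tendsto_nhdsWithin_iff.2 ⟨tendsto_one_div_atTop_nhds_zero_nat, ?_⟩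
    filter_upwards [eventually_gt_atTop 0] with n hn
    have : (0 : ℝ) < n := by exact_mod_cast hn
    exact (by positivity : (0 : ℝ) < 1 / n).ne'
  refine (h.comp hn).congr fun n => ?_
  simp [stepMatrix]

namespace IsMarkovChain

variable {q : Matrix (Fin d) (Fin d) ℝ} {J : ℝ≥0 → Ω → Fin d}

theorem real_pair (hJ : IsMarkovChain μ q J) {s t : ℝ≥0} (hst : s ≤ t) (i j : Fin d) :
    μ.real {ω | J s ω = i ∧ J t ω = j} =
      μ.real {ω | J s ω = i} *
        (NormedSpace.exp (((t : ℝ) - s) • q) : Matrix (Fin d) (Fin d) ℝ) i j := by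
  have h := hJ.markov 1 ![s, t] (by
    intro a b hab
    fin_cases a <;> fin_cases b <;> simp_all) ![i, j]
  simpa [Fin.forall_fin_two] using h

theorem real_step (hJ : IsMarkovChain μ q J) (n k : ℕ) (i j : Fin d) :
    μ.real {ω | J ((k : ℝ≥0) / n) ω = i ∧ J (((k + 1 : ℕ) : ℝ≥0) / n) ω = j} =
      μ.real {ω | J ((k : ℝ≥0) / n) ω = i} * stepMatrix q n i j := by
  have e : (((((k + 1 : ℕ) : ℝ≥0) / n : ℝ≥0) : ℝ) - (((k : ℝ≥0) / n : ℝ≥0) : ℝ)) = 1 / n := by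
    rw [cell_right_eq]
    push_cast
    ring
  rw [hJ.real_pair (by gcongr; exact Nat.le_succ k), stepMatrix, e]

/-- The absolute value avoids having to show that the entries of the matrix exponential are
nonnegative. -/
theorem measure_step_le [IsProbabilityMeasure μ] (hJ : IsMarkovChain μ q J) (n k : ℕ)
    (i j : Fin d) :
    μ {ω | J ((k : ℝ≥0) / n) ω = i ∧ J (((k + 1 : ℕ) : ℝ≥0) / n) ω = j} ≤
      ENNReal.ofReal |stepMatrix q n i j| := by
  rw [← ofReal_measureReal, hJ.real_step]
  refine ENNReal.ofReal_le_ofReal ?_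
  calc μ.real {ω | J ((k : ℝ≥0) / n) ω = i} * stepMatrix q n i j
      ≤ μ.real {ω | J ((k : ℝ≥0) / n) ω = i} * |stepMatrix q n i j| := by
        gcongr; exact le_abs_self _
    _ ≤ 1 * |stepMatrix q n i j| := by gcongr; exact measureReal_le_one
    _ = |stepMatrix q n i j| := one_mul _

theorem exists_stepMatrix_bound (q : Matrix (Fin d) (Fin d) ℝ) :
    ∃ C : ℝ, 0 ≤ C ∧ ∀ n : ℕ, ∀ i j, i ≠ j → n * |stepMatrix q n i j| ≤ C := by
  have h : ∀ i j, ∃ C : ℝ, 0 ≤ C ∧ (i ≠ j → ∀ n : ℕ, n * |stepMatrix q n i j| ≤ C) := by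
    intro i j
    by_cases hij : i = j
    · exact ⟨0, le_rfl, fun h => absurd hij h⟩
    · obtain ⟨C, hC⟩ := (tendsto_stepMatrix q i j).norm.bddAbove_range
      refine ⟨C, ?_, fun _ n => ?_⟩
      · exact (norm_nonneg _).trans (hC ⟨0, rfl⟩)
      · have := hC ⟨n, rfl⟩
        simpa [Matrix.one_apply_ne hij, abs_mul] using this
  choose C hC0 hC using h
  refine ⟨∑ i, ∑ j, C i j, Finset.sum_nonneg fun i _ => Finset.sum_nonneg fun j _ => hC0 i j,
    fun n i j hij => (hC i j hij n).trans ?_⟩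
  calc C i j ≤ ∑ j, C i j := Finset.single_le_sum (fun j _ => hC0 i j) (Finset.mem_univ j)
    _ ≤ ∑ i, ∑ j, C i j := Finset.single_le_sum (f := fun i => ∑ j, C i j)
        (fun i _ => Finset.sum_nonneg fun j _ => hC0 i j) (Finset.mem_univ i)

/-- The mean number of changes of state on the grid is bounded, uniformly in the mesh. -/
theorem exists_lintegral_changes_le [IsProbabilityMeasure μ] (hJ : IsMarkovChain μ q J) :
    ∃ C : ℝ≥0, ∀ n M : ℕ,
      ∫⁻ ω, (changes (n * M) (fun k => J ((k : ℝ≥0) / n) ω) : ℝ≥0∞) ∂μ ≤ M * C := by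
  classical
  obtain ⟨C, hC0, hC⟩ := exists_stepMatrix_bound q
  refine ⟨d * d * C.toNNReal, fun n M => ?_⟩
  have hset : ∀ k : ℕ, MeasurableSet {ω | J ((k : ℝ≥0) / n) ω ≠ J (((k + 1 : ℕ) : ℝ≥0) / n) ω} :=
    fun k => (measurableSet_eq_fun (hJ.measurable _) (hJ.measurable _)).compl
  have h1 : ∀ ω, (changes (n * M) (fun k => J ((k : ℝ≥0) / n) ω) : ℝ≥0∞) =
      ∑ k ∈ Finset.range (n * M), {ω | J ((k : ℝ≥0) / n) ω ≠
        J (((k + 1 : ℕ) : ℝ≥0) / n) ω}.indicator (1 : Ω → ℝ≥0∞) ω := by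
    intro ω
    simp only [changes, Finset.card_filter, Set.indicator_apply, mem_ofPred_eq, Pi.one_apply]
    push_cast
    rfl
  have h2 : ∀ k : ℕ, μ {ω | J ((k : ℝ≥0) / n) ω ≠ J (((k + 1 : ℕ) : ℝ≥0) / n) ω} ≤
      ∑ i : Fin d, ∑ j : Fin d, if i ≠ j then ENNReal.ofReal |stepMatrix q n i j| else 0 := by
    intro k
    have hsub : {ω | J ((k : ℝ≥0) / n) ω ≠ J (((k + 1 : ℕ) : ℝ≥0) / n) ω} ⊆
        ⋃ i ∈ (Finset.univ : Finset (Fin d)), ⋃ j ∈ (Finset.univ : Finset (Fin d)),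
          {ω | i ≠ j ∧ J ((k : ℝ≥0) / n) ω = i ∧ J (((k + 1 : ℕ) : ℝ≥0) / n) ω = j} := by
      intro ω hω
      simp only [mem_iUnion]
      exact ⟨_, Finset.mem_univ _, _, Finset.mem_univ _, hω, rfl, rfl⟩
    refine (measure_mono hsub).trans ((measure_biUnion_finset_le _ _).trans
      (Finset.sum_le_sum fun i _ => (measure_biUnion_finset_le _ _).trans
        (Finset.sum_le_sum fun j _ => ?_)))
    split_ifs with hij
    · exact (measure_mono fun ω hω => hω.2).trans (hJ.measure_step_le n k i j)
    · rw [show {ω | i ≠ j ∧ J ((k : ℝ≥0) / n) ω = i ∧ J (((k + 1 : ℕ) : ℝ≥0) / n) ω = j} = ∅ from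
        eq_empty_of_forall_notMem fun ω hω => hij hω.1]
      simp
  simp only [h1]
  rw [lintegral_finsetSum _ fun k _ => measurable_one.indicator (hset k)]
  calc ∑ k ∈ Finset.range (n * M), ∫⁻ ω, {ω | J ((k : ℝ≥0) / n) ω ≠
        J (((k + 1 : ℕ) : ℝ≥0) / n) ω}.indicator (1 : Ω → ℝ≥0∞) ω ∂μ
      ≤ ∑ k ∈ Finset.range (n * M), ∑ i : Fin d, ∑ j : Fin d,
          if i ≠ j then ENNReal.ofReal |stepMatrix q n i j| else 0 := by
        refine Finset.sum_le_sum fun k _ => ?_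
        rw [lintegral_indicator_one (hset k)]
        exact h2 k
    _ = M * ∑ i : Fin d, ∑ j : Fin d,
          if i ≠ j then (n : ℝ≥0∞) * ENNReal.ofReal |stepMatrix q n i j| else 0 := by
        rw [Finset.sum_const, Finset.card_range, nsmul_eq_mul, Nat.cast_mul, mul_comm (n : ℝ≥0∞),
          mul_assoc]
        simp only [Finset.mul_sum, mul_ite, mul_zero]
    _ ≤ M * ∑ i : Fin d, ∑ j : Fin d, (C.toNNReal : ℝ≥0∞) := by
        gcongr with i _ j _
        split_ifs with hij
        · rw [← ENNReal.ofReal_natCast, ← ENNReal.ofReal_mul (by positivity)]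
          exact ENNReal.ofReal_le_ofReal (hC n i j hij)
        · exact zero_le
    _ = M * ((d * d * C.toNNReal : ℝ≥0) : ℝ≥0∞) := by
        simp [mul_assoc]

/-- Along the grid, a transition of rate zero does not occur in the limit. -/
theorem ae_frequently_no_step [IsProbabilityMeasure μ] (hJ : IsMarkovChain μ q J) {i j : Fin d}
    (hij : i ≠ j) (hq : q i j = 0) (M : ℕ) :
    ∀ᵐ ω ∂μ, ∃ᶠ n : ℕ in atTop, ∀ k < n * M,
      ¬ (J ((k : ℝ≥0) / n) ω = i ∧ J (((k + 1 : ℕ) : ℝ≥0) / n) ω = j) := by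
  let S : ℕ → ℕ → Set Ω := fun n k =>
    {ω | J ((k : ℝ≥0) / n) ω = i ∧ J (((k + 1 : ℕ) : ℝ≥0) / n) ω = j}
  have hset : ∀ n k, MeasurableSet (S n k) := fun n k =>
    (hJ.measurable _ (measurableSet_singleton i)).inter
      (hJ.measurable _ (measurableSet_singleton j))
  let f : ℕ → Ω → ℝ≥0∞ := fun n ω => ∑ k ∈ Finset.range (n * M), (S n k).indicator 1 ω
  have hf : ∀ n, Measurable (f n) := fun n =>
    Finset.measurable_sum _ fun k _ => measurable_one.indicator (hset n k)
  have hle : ∀ n, ∫⁻ ω, f n ω ∂μ ≤ ENNReal.ofReal (M * |n * stepMatrix q n i j|) := by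
    intro n
    rw [lintegral_finsetSum _ fun k _ => measurable_one.indicator (hset n k)]
    calc ∑ k ∈ Finset.range (n * M), ∫⁻ ω, (S n k).indicator 1 ω ∂μ
        ≤ ∑ k ∈ Finset.range (n * M), ENNReal.ofReal |stepMatrix q n i j| := by
          refine Finset.sum_le_sum fun k _ => ?_
          rw [lintegral_indicator_one (hset n k)]
          exact hJ.measure_step_le n k i j
      _ = ENNReal.ofReal (M * |n * stepMatrix q n i j|) := by
          rw [Finset.sum_const, Finset.card_range, nsmul_eq_mul, ← ENNReal.ofReal_natCast,
            ← ENNReal.ofReal_mul (by positivity), abs_mul, Nat.abs_cast]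
          congr 1
          push_cast
          ring
  have hlim : Tendsto (fun n : ℕ => ENNReal.ofReal (M * |n * stepMatrix q n i j|)) atTop (𝓝 0) := by
    have h := tendsto_stepMatrix q i j
    rw [hq] at h
    simp only [Matrix.one_apply_ne hij, sub_zero] at h
    have h2 := ENNReal.tendsto_ofReal ((h.abs).const_mul (M : ℝ))
    simpa using h2
  -- The mean number of steps from `i` to `j` tends to zero, so by Fatou its lower limit is almost
  -- surely zero. A count that is eventually at least `1` would contradict this.
  have h0 : ∫⁻ ω, liminf (fun n => f n ω) atTop ∂μ = 0 := by
    refine le_antisymm ((lintegral_liminf_le hf).trans ?_) zero_le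
    calc liminf (fun n => ∫⁻ ω, f n ω ∂μ) atTop
        ≤ liminf (fun n : ℕ => ENNReal.ofReal (M * |n * stepMatrix q n i j|)) atTop :=
          liminf_le_liminf (Eventually.of_forall hle)
      _ = 0 := hlim.liminf_eq
  rw [lintegral_eq_zero_iff (Measurable.liminf hf)] at h0
  filter_upwards [h0] with ω hω
  intro hev
  have : (1 : ℝ≥0∞) ≤ liminf (fun n => f n ω) atTop := by
    refine le_liminf_of_le (by isBoundedDefault) (hev.mono fun n hn => ?_)
    push Not at hn
    obtain ⟨k, hk, h1, h2⟩ := hn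
    have : (S n k).indicator (1 : Ω → ℝ≥0∞) ω = 1 := by
      rw [Set.indicator_of_mem (show ω ∈ S n k from ⟨h1, h2⟩)]; rfl
    rw [← this]
    exact Finset.single_le_sum (f := fun k => (S n k).indicator (1 : Ω → ℝ≥0∞) ω)
      (fun _ _ => zero_le) (Finset.mem_range.2 hk)
  rw [hω] at this
  simp at this

/-- An irreducible chain whose one-dimensional laws do not change charges every state. -/
theorem measure_ne_zero_of_stationary [IsProbabilityMeasure μ] (hJ : IsMarkovChain μ q J)
    (hrate : IsRateMatrix q) (hirr : IsIrreducibleRate q)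
    (hstat : ∀ t i, μ.real {ω | J t ω = i} = μ.real {ω | J 0 ω = i}) (i : Fin d) :
    μ (J 0 ⁻¹' {i}) ≠ 0 := by
  set p : Fin d → ℝ := fun i => μ.real {ω | J 0 ω = i} with hp
  have hmeas : ∀ t i, MeasurableSet {ω | J t ω = i} := fun t i =>
    hJ.measurable t (measurableSet_singleton i)
  have hstep : ∀ (n : ℕ) j, ∑ i, p i * stepMatrix q n i j = p j := by
    intro n j
    have h1 : ∀ i, p i * stepMatrix q n i j =
        μ.real {ω | J 0 ω = i ∧ J (1 / n) ω = j} := by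
      intro i
      rw [hJ.real_pair zero_le, stepMatrix]
      simp [hp]
    simp only [h1]
    rw [show p j = _ from (hstat (1 / n) j).symm]
    have hU : {ω | J (1 / n) ω = j} =
        ⋃ i ∈ (Finset.univ : Finset (Fin d)), {ω | J 0 ω = i ∧ J (1 / n) ω = j} := by
      ext ω; simp
    rw [hU, measureReal_biUnion_finset]
    · intro a _ b _ hab
      exact Set.disjoint_left.2 fun ω h1 h2 => hab (h1.1.symm.trans h2.1)
    · intro i _
      exact (hmeas 0 i).inter (hmeas _ j)
  -- Differentiating the invariance under `exp (q / n)` at time `0` yields the balance equations.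
  have hbal : ∀ j, ∑ i, p i * q i j = 0 := by
    intro j
    have h1 : Tendsto (fun n : ℕ => ∑ i, p i * (n * (stepMatrix q n i j -
        (1 : Matrix (Fin d) (Fin d) ℝ) i j))) atTop (𝓝 (∑ i, p i * q i j)) :=
      tendsto_finsetSum _ fun i _ => (tendsto_stepMatrix q i j).const_mul _
    refine tendsto_nhds_unique h1 (tendsto_const_nhds.congr fun n => ?_)
    have : ∑ i, p i * (n * (stepMatrix q n i j - (1 : Matrix (Fin d) (Fin d) ℝ) i j)) =
        n * (∑ i, p i * stepMatrix q n i j - ∑ i, p i * (1 : Matrix (Fin d) (Fin d) ℝ) i j) := by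
      rw [← Finset.sum_sub_distrib, Finset.mul_sum]
      exact Finset.sum_congr rfl fun i _ => by ring
    rw [this, hstep]
    simp [Matrix.one_apply]
  have hp0 : ∀ i, 0 ≤ p i := fun i => measureReal_nonneg
  -- If `p b = 0`, the negative diagonal rate drops out of the balance at `b` and all terms are
  -- nonnegative, hence zero. Null states thus propagate backward along edges, and irreducibility
  -- makes every state null.
  have hback : ∀ a b, a ≠ b ∧ 0 < q a b → p b = 0 → p a = 0 := by
    intro a b hab hb
    have hnn : ∀ c ∈ Finset.univ, 0 ≤ p c * q c b := by
      intro c _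
      by_cases hc : c = b
      · rw [hc, hb, zero_mul]
      · exact mul_nonneg (hp0 c) (hrate.nonneg c b hc)
    have := (Finset.sum_eq_zero_iff_of_nonneg hnn).1 (hbal b) a (Finset.mem_univ a)
    exact (mul_eq_zero.1 this).resolve_right hab.2.ne'
  intro hi
  have hpi : p i = 0 := by
    rw [hp]; exact (measureReal_eq_zero_iff).2 hi
  have hall : ∀ a, p a = 0 := fun a => by
    have h := hirr a i
    induction h using Relation.ReflTransGen.head_induction_on with
    | refl => exact hpi
    | head hab _ ih => exact hback _ _ hab ih
  have hsum : ∑ a, p a = 1 := by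
    have hU : (univ : Set Ω) = ⋃ a ∈ (Finset.univ : Finset (Fin d)), {ω | J 0 ω = a} := by
      ext ω; simp
    rw [← probReal_univ (μ := μ), hU, measureReal_biUnion_finset]
    · intro a _ b _ hab
      exact Set.disjoint_left.2 fun ω h1 h2 => hab (h1.symm.trans h2)
    · exact fun a _ => hmeas 0 a
  simp [hall] at hsum

end IsMarkovChain

end MAPQueue

namespace MAPQueue

variable {Ω : Type*} [MeasurableSpace Ω] {μ : Measure Ω} {d : ℕ}

/-! ### The negative part of a Markov additive process -/

/-- The total size of the jumps with index `m` that belong to possible transitions. -/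
noncomputable def jumpBound (q : Matrix (Fin d) (Fin d) ℝ) (u : ℕ → Fin d → Fin d → ℝ) (m : ℕ) :
    ℝ :=
  open Classical in ∑ i, ∑ j, if i ≠ j ∧ 0 < q i j then |u m i j| else 0

theorem jumpBound_nonneg (q : Matrix (Fin d) (Fin d) ℝ) (u : ℕ → Fin d → Fin d → ℝ) (m : ℕ) :
    0 ≤ jumpBound q u m :=
  Finset.sum_nonneg fun i _ => Finset.sum_nonneg fun j _ => by split_ifs <;> positivity

theorem le_jumpBound {q : Matrix (Fin d) (Fin d) ℝ} {i j : Fin d} (hij : i ≠ j) (hq : 0 < q i j)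
    (u : ℕ → Fin d → Fin d → ℝ) (m : ℕ) : |u m i j| ≤ jumpBound q u m := by
  classical
  have h0 : ∀ i j : Fin d, 0 ≤ if i ≠ j ∧ 0 < q i j then |u m i j| else 0 := fun i j => by
    split_ifs <;> positivity
  calc |u m i j| = if i ≠ j ∧ 0 < q i j then |u m i j| else 0 := by rw [if_pos ⟨hij, hq⟩]
    _ ≤ ∑ j, if i ≠ j ∧ 0 < q i j then |u m i j| else 0 :=
        Finset.single_le_sum (f := fun j => if i ≠ j ∧ 0 < q i j then |u m i j| else 0)
          (fun j _ => h0 i j) (Finset.mem_univ j)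
    _ ≤ ∑ i, ∑ j, if i ≠ j ∧ 0 < q i j then |u m i j| else 0 :=
        Finset.single_le_sum (f := fun i => ∑ j, if i ≠ j ∧ 0 < q i j then |u m i j| else 0)
          (fun i _ => Finset.sum_nonneg fun j _ => h0 i j) (Finset.mem_univ i)
    _ = jumpBound q u m := by
        unfold jumpBound
        congr! 2

theorem measurable_jumpBound (q : Matrix (Fin d) (Fin d) ℝ) (m : ℕ) :
    Measurable fun u : ℕ → Fin d → Fin d → ℝ => jumpBound q u m := by
  refine Finset.measurable_sum _ fun i _ => Finset.measurable_sum _ fun j _ => ?_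
  split_ifs
  · fun_prop
  · fun_prop

theorem measurable_frozenSum (n K : ℕ) (a : ℕ → Fin d) (i : Fin d) :
    Measurable fun l : Fin d → ℝ≥0 → ℝ => frozenSum l n K a i :=
  Finset.measurable_sum _ fun k _ => by fun_prop

theorem frozenSum_congr (l : Fin d → ℝ≥0 → ℝ) (n : ℕ) {K : ℕ} {a b : ℕ → Fin d}
    (h : ∀ k ≤ K, a k = b k) : frozenSum l n K a = frozenSum l n K b := by
  ext i
  unfold frozenSum
  refine Finset.sum_congr (Finset.filter_congr fun k hk => ?_) fun _ _ => rfl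
  rw [h k (Finset.mem_range.1 hk).le]

theorem changes_congr {K : ℕ} {a b : ℕ → Fin d} (h : ∀ k ≤ K, a k = b k) :
    changes K a = changes K b := by
  unfold changes
  congr 1
  refine Finset.filter_congr fun k hk => ?_
  rw [h k (Finset.mem_range.1 hk).le, h (k + 1) (Finset.mem_range.1 hk)]

namespace IsSNMAP

variable {q : Matrix (Fin d) (Fin d) ℝ} {J : ℝ≥0 → Ω → Fin d} {L : Fin d → ℝ≥0 → Ω → ℝ}
  {U : ℕ → Fin d → Fin d → Ω → ℝ} {X : ℝ≥0 → Ω → ℝ}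

theorem ae_isModulatedPath (h : IsSNMAP μ q J L U X) :
    ∀ᵐ ω ∂μ, IsModulatedPath (fun t => J t ω) (fun i t => L i t ω) (fun n i j => U n i j ω)
      (fun t => X t ω) := by
  have h1 : ∀ᵐ ω ∂μ, ∀ i, IsCadlag fun t => L i t ω := ae_all_iff.2 fun i => (h.levy i).cadlag
  have h2 : ∀ᵐ ω ∂μ, ∀ i t, L i t ω ≤ Function.leftLim (fun s => L i s ω) t :=
    ae_all_iff.2 fun i => (h.levy i).no_upward_jumps
  have h3 : ∀ᵐ ω ∂μ, ∀ n i j, i ≠ j → U n i j ω ≤ 0 := by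
    simp only [ae_all_iff]
    exact h.jump_nonpos
  filter_upwards [h.chain.cadlag, h1, h2, h3, h.sojourn, h.transition] with ω a1 a2 a3 a4 a5 a6
  exact ⟨a1, a2, a3, a4, a5, a6⟩

/-- An epoch of a rate-zero transition would appear as a step on all fine grids, whereas infinitely
many grids show none. It confines the jumps to those assumed integrable. -/
theorem ae_rate_pos [IsProbabilityMeasure μ] (h : IsSNMAP μ q J L U X) :
    ∀ᵐ ω ∂μ, ∀ M : ℕ, ∀ σ ∈ epochs (fun t => J t ω) M,
      0 < q (Function.leftLim (fun t => J t ω) σ) (J σ ω) := by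
  have h1 : ∀ᵐ ω ∂μ, ∀ i j, i ≠ j → q i j = 0 → ∀ M : ℕ, ∃ᶠ n : ℕ in atTop, ∀ k < n * M,
      ¬ (J ((k : ℝ≥0) / n) ω = i ∧ J (((k + 1 : ℕ) : ℝ≥0) / n) ω = j) := by
    simp only [ae_all_iff]
    exact fun i j hij hq M => h.chain.ae_frequently_no_step hij hq M
  filter_upwards [h1, h.ae_isModulatedPath] with ω hω hp M σ hσ
  refine lt_of_le_of_ne (h.rate.nonneg _ _ hσ.2) fun heq => ?_
  obtain ⟨n, hn, hn2⟩ := ((hω _ _ hσ.2 heq.symm M).and_eventually (hp.eventually_states M)).exists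
  obtain ⟨h2, h3, h4⟩ := hn2 σ hσ
  exact hn _ h2 ⟨h3, h4⟩

/-- The pathwise grid estimate in the form that Fatou's lemma takes; the error `ε` is arbitrary and
disappears in the lower limit. -/
theorem ae_ofReal_neg_le [IsProbabilityMeasure μ] (h : IsSNMAP μ q J L U X) (M : ℕ) :
    ∀ᵐ ω ∂μ, ENNReal.ofReal (-X M ω) ≤ liminf (fun n : ℕ =>
      (∑ i, ‖frozenSum (fun i t => L i t ω) n (n * M) (fun k => J ((k : ℝ≥0) / n) ω) i‖ₑ) +
      ∑ m ∈ Finset.Icc 1 (changes (n * M) fun k => J ((k : ℝ≥0) / n) ω),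
        ENNReal.ofReal (jumpBound q (fun n i j => U n i j ω) m)) atTop := by
  filter_upwards [h.ae_rate_pos, h.ae_isModulatedPath, h.zero] with ω hpos hp h0
  refine ENNReal.le_of_forall_pos_le_add fun ε hε _ => ?_
  rw [← tsub_le_iff_right]
  refine le_liminf_of_le (by isBoundedDefault) ?_
  have hB : ∀ σ ∈ epochs (fun t => J t ω) M, |U (epochs (fun t => J t ω) σ).ncard
      (Function.leftLim (fun t => J t ω) σ) (J σ ω) ω| ≤
      jumpBound q (fun n i j => U n i j ω) (epochs (fun t => J t ω) σ).ncard := fun σ hσ =>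
    le_jumpBound (u := fun n i j => U n i j ω) hσ.2 (hpos M σ hσ) _
  filter_upwards [hp.sum_frozenSum_le M (jumpBound_nonneg q _) hB
    (ε := ε) (by exact_mod_cast hε)] with n hn
  rw [tsub_le_iff_right]
  rw [h0, sub_zero] at hn
  set F := frozenSum (fun i t => L i t ω) n (n * M) (fun k => J ((k : ℝ≥0) / n) ω)
  have h1 : -X M ω ≤ ∑ i, |F i| + ∑ m ∈ Finset.Icc 1 (changes (n * M)
      fun k => J ((k : ℝ≥0) / n) ω), jumpBound q (fun n i j => U n i j ω) m + ε := by
    have : -∑ i, F i ≤ ∑ i, |F i| := by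
      rw [← Finset.sum_neg_distrib]
      exact Finset.sum_le_sum fun i _ => neg_le_abs _
    linarith
  refine (ENNReal.ofReal_le_ofReal h1).trans ?_
  refine ENNReal.ofReal_add_le.trans ?_
  refine add_le_add (ENNReal.ofReal_add_le.trans (add_le_add ?_ ?_)) (by simp)
  · rw [ENNReal.ofReal_sum_of_nonneg fun i _ => abs_nonneg _]
    simp [Real.enorm_eq_ofReal_abs]
  · rw [ENNReal.ofReal_sum_of_nonneg fun i _ => jumpBound_nonneg _ _ _]

theorem lintegral_jumpBound_le (h : IsSNMAP μ q J L U X) (m : ℕ) :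
    ∫⁻ ω, ENNReal.ofReal (jumpBound q (fun n i j => U n i j ω) m) ∂μ ≤
      ∑ i, ∑ j, open Classical in if i ≠ j ∧ 0 < q i j then ∫⁻ ω, ‖U 0 i j ω‖ₑ ∂μ else 0 := by
  classical
  have e : ∀ ω, ENNReal.ofReal (jumpBound q (fun n i j => U n i j ω) m) =
      ∑ i, ∑ j, if i ≠ j ∧ 0 < q i j then ‖U m i j ω‖ₑ else 0 := by
    intro ω
    unfold jumpBound
    rw [ENNReal.ofReal_sum_of_nonneg fun i _ => Finset.sum_nonneg fun j _ => by
      split_ifs <;> positivity]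
    refine Finset.sum_congr rfl fun i _ => ?_
    rw [ENNReal.ofReal_sum_of_nonneg fun j _ => by split_ifs <;> positivity]
    refine Finset.sum_congr rfl fun j _ => ?_
    split_ifs
    · rw [Real.enorm_eq_ofReal_abs]
    · simp
  have hm : ∀ i j, Measurable fun ω => if i ≠ j ∧ 0 < q i j then ‖U m i j ω‖ₑ else 0 := by
    intro i j
    split_ifs
    · exact (h.jump_measurable m i j).enorm
    · exact measurable_const
  simp only [e]
  rw [lintegral_finsetSum _ fun i _ => Finset.measurable_sum _ fun j _ => hm i j]
  refine Finset.sum_le_sum fun i _ => ?_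
  rw [lintegral_finsetSum _ fun j _ => hm i j]
  refine Finset.sum_le_sum fun j _ => ?_
  split_ifs
  · exact ((h.jump_identDistrib m i j).comp measurable_enorm).lintegral_eq.le
  · simp

theorem lintegral_frozenSum_le [IsProbabilityMeasure μ] (h : IsSNMAP μ q J L U X)
    (hL : ∀ i, Integrable (L i 1) μ) {n : ℕ} (hn : 0 < n) (M : ℕ) (a : ℕ → Fin d) (i : Fin d) :
    ∫⁻ ω, ‖frozenSum (fun i t => L i t ω) n (n * M) a i‖ₑ ∂μ ≤
      M * ENNReal.ofReal (3 * ∫ ω, |L i 1 ω| ∂μ) := by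
  have h1 := (h.levy i).integral_abs_sum_cellIncr_le (hL i) hn M
    (S := (Finset.range (n * M)).filter fun k => a k = i) (Finset.filter_subset _ _)
  have h2 : Integrable (fun ω => ∑ k ∈ Finset.range (n * M) with a k = i, cellIncr (L i) n k ω) μ :=
    integrable_finsetSum _ fun k _ => (h.levy i).integrable_cellIncr (hL i) hn k
  have h3 := ofReal_integral_norm_eq_lintegral_enorm h2
  calc ∫⁻ ω, ‖frozenSum (fun i t => L i t ω) n (n * M) a i‖ₑ ∂μ
      = ∫⁻ ω, ‖∑ k ∈ Finset.range (n * M) with a k = i, cellIncr (L i) n k ω‖ₑ ∂μ := by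
        simp only [frozenSum, cellIncr]
    _ ≤ ENNReal.ofReal (M * (3 * ∫ ω, |L i 1 ω| ∂μ)) := by
      rw [← h3]
      exact ENNReal.ofReal_le_ofReal h1
    _ = _ := by rw [ENNReal.ofReal_mul (by positivity), ENNReal.ofReal_natCast]

/-- The bound for `-X` that is provided by a grid with states `a`. -/
noncomputable def gridBound (q : Matrix (Fin d) (Fin d) ℝ) (n K : ℕ) (a : ℕ → Fin d)
    (z : (Fin d → ℝ≥0 → ℝ) × (ℕ → Fin d → Fin d → ℝ)) : ℝ≥0∞ :=
  (∑ i, ‖frozenSum z.1 n K a i‖ₑ) +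
    ∑ m ∈ Finset.Icc 1 (changes K a), ENNReal.ofReal (jumpBound q z.2 m)

theorem measurable_gridBound (q : Matrix (Fin d) (Fin d) ℝ) (n K : ℕ) (a : ℕ → Fin d) :
    Measurable (gridBound q n K a) :=
  (Finset.measurable_sum _ fun i _ =>
      ((measurable_frozenSum n K a i).comp measurable_fst).enorm).add
    (Finset.measurable_sum _ fun m _ =>
      ((measurable_jumpBound q m).comp measurable_snd).ennreal_ofReal)

theorem measurable_parts (h : IsSNMAP μ q J L U X) :
    Measurable fun ω => ((fun i t => L i t ω, fun n i j => U n i j ω) :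
      (Fin d → ℝ≥0 → ℝ) × (ℕ → Fin d → Fin d → ℝ)) :=
  (measurable_pi_lambda _ fun i => measurable_pi_lambda _ fun t => (h.levy i).measurable t).prodMk
    (measurable_pi_lambda _ fun n => measurable_pi_lambda _ fun i =>
      measurable_pi_lambda _ fun j => h.jump_measurable n i j)

theorem lintegral_gridBound_le [IsProbabilityMeasure μ] (h : IsSNMAP μ q J L U X)
    (hL : ∀ i, Integrable (L i 1) μ) {n : ℕ} (hn : 0 < n) (M : ℕ) (a : ℕ → Fin d) :
    ∫⁻ ω, gridBound q n (n * M) a (fun i t => L i t ω, fun n i j => U n i j ω) ∂μ ≤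
      M * (∑ i, ENNReal.ofReal (3 * ∫ ω, |L i 1 ω| ∂μ)) + changes (n * M) a *
        ∑ i, ∑ j, open Classical in if i ≠ j ∧ 0 < q i j then ∫⁻ ω, ‖U 0 i j ω‖ₑ ∂μ else 0 := by
  have m1 : ∀ i, Measurable fun ω => ‖frozenSum (fun i t => L i t ω) n (n * M) a i‖ₑ := fun i =>
    (((measurable_frozenSum n (n * M) a i).comp measurable_fst).comp h.measurable_parts).enorm
  have m2 : ∀ m, Measurable fun ω => ENNReal.ofReal (jumpBound q (fun n i j => U n i j ω) m) :=
    fun m => (((measurable_jumpBound q m).comp measurable_snd).comp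
      h.measurable_parts).ennreal_ofReal
  simp only [gridBound]
  rw [lintegral_add_left (Finset.measurable_sum _ fun i _ => m1 i),
    lintegral_finsetSum _ fun i _ => m1 i, lintegral_finsetSum _ fun m _ => m2 m]
  refine add_le_add ?_ ?_
  · rw [Finset.mul_sum]
    exact Finset.sum_le_sum fun i _ => h.lintegral_frozenSum_le hL hn M _ i
  · refine (Finset.sum_le_sum fun m _ => h.lintegral_jumpBound_le m).trans ?_
    rw [Finset.sum_const, Nat.card_Icc, Nat.add_sub_cancel, nsmul_eq_mul]

/-- A sequence of states given by its first `K + 1` members. -/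
def extendStates {K : ℕ} (a : Fin (K + 1) → Fin d) (k : ℕ) : Fin d := a (Fin.ofNat (K + 1) k)

theorem extendStates_apply {K k : ℕ} (hk : k ≤ K) (b : ℕ → Fin d) :
    b k = extendStates (fun i : Fin (K + 1) => b i) k := by
  simp only [extendStates, Fin.val_ofNat, Nat.mod_eq_of_lt (Nat.lt_succ_of_le hk)]

/-- The bound looks at the states up to index `K` only, so it factors through a finite type, over
which one can condition by a finite sum. -/
theorem gridBound_extendStates (q : Matrix (Fin d) (Fin d) ℝ) (n K : ℕ) (b : ℕ → Fin d) :
    gridBound q n K b = gridBound q n K (extendStates fun i : Fin (K + 1) => b i) := by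
  ext z
  have hb : ∀ k ≤ K, b k = extendStates (fun i : Fin (K + 1) => b i) k := fun k hk =>
    extendStates_apply hk b
  rw [gridBound, gridBound, frozenSum_congr _ n hb, changes_congr hb]

theorem measurable_gridStates (h : IsSNMAP μ q J L U X) (n K : ℕ) :
    Measurable fun ω (k : Fin (K + 1)) => J (((k : ℕ) : ℝ≥0) / n) ω :=
  measurable_pi_lambda _ fun _ => h.chain.measurable _

theorem measurable_gridBound_comp (h : IsSNMAP μ q J L U X) (n K : ℕ) :
    Measurable fun ω => gridBound q n K (fun k => J ((k : ℝ≥0) / n) ω)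
      (fun i t => L i t ω, fun n i j => U n i j ω) := by
  have h1 : Measurable fun p : (Fin (K + 1) → Fin d) ×
      ((Fin d → ℝ≥0 → ℝ) × (ℕ → Fin d → Fin d → ℝ)) =>
      gridBound q n K (extendStates p.1) p.2 :=
    measurable_from_prod_countable_right fun a => measurable_gridBound q n K _
  have h2 := h1.comp ((h.measurable_gridStates n K).prodMk h.measurable_parts)
  convert h2 using 2 with ω
  exact congrFun (gridBound_extendStates q n K _) _

/-- The chain is independent of the Lévy processes and the jumps: freeze the grid states, use the
bound for deterministic states, and average the number of changes. -/
theorem lintegral_gridBound_comp_le [IsProbabilityMeasure μ] (h : IsSNMAP μ q J L U X)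
    (hL : ∀ i, Integrable (L i 1) μ) {n : ℕ} (hn : 0 < n) (M : ℕ) {C : ℝ≥0}
    (hC : ∫⁻ ω, (changes (n * M) (fun k => J ((k : ℝ≥0) / n) ω) : ℝ≥0∞) ∂μ ≤ M * C) :
    ∫⁻ ω, gridBound q n (n * M) (fun k => J ((k : ℝ≥0) / n) ω)
        (fun i t => L i t ω, fun n i j => U n i j ω) ∂μ ≤
      M * ((∑ i, ENNReal.ofReal (3 * ∫ ω, |L i 1 ω| ∂μ)) + C *
        ∑ i, ∑ j, open Classical in if i ≠ j ∧ 0 < q i j then ∫⁻ ω, ‖U 0 i j ω‖ₑ ∂μ else 0) := by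
  set c₀ : ℝ≥0∞ := ∑ i, ENNReal.ofReal (3 * ∫ ω, |L i 1 ω| ∂μ)
  set b₀ : ℝ≥0∞ := ∑ i, ∑ j, open Classical in
    if i ≠ j ∧ 0 < q i j then ∫⁻ ω, ‖U 0 i j ω‖ₑ ∂μ else 0
  have hind : IndepFun (fun ω (k : Fin (n * M + 1)) => J (((k : ℕ) : ℝ≥0) / n) ω)
      (fun ω => ((fun i t => L i t ω, fun n i j => U n i j ω) :
        (Fin d → ℝ≥0 → ℝ) × (ℕ → Fin d → Fin d → ℝ))) μ :=
    h.chain_indep.comp (φ := fun (x : ℝ≥0 → Fin d) (k : Fin (n * M + 1)) =>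
      x (((k : ℕ) : ℝ≥0) / n)) (ψ := id)
      (measurable_pi_lambda _ fun k => measurable_pi_apply _) measurable_id
  have h1 := lintegral_comp_le_of_indepFun (h.measurable_gridStates n (n * M)) h.measurable_parts
    hind (F := fun a => gridBound q n (n * M) (extendStates a))
    (fun a => measurable_gridBound q n (n * M) _)
    (c := fun a => M * c₀ + changes (n * M) (extendStates a) * b₀)
    fun a => h.lintegral_gridBound_le hL hn M _
  have hch : Measurable fun ω => (changes (n * M)
      (extendStates fun k : Fin (n * M + 1) => J (((k : ℕ) : ℝ≥0) / n) ω) : ℝ≥0∞) :=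
    (measurable_of_countable fun a : Fin (n * M + 1) → Fin d =>
      (changes (n * M) (extendStates a) : ℝ≥0∞)).comp (h.measurable_gridStates n (n * M))
  have h2 : ∀ ω, changes (n * M)
      (extendStates fun k : Fin (n * M + 1) => J (((k : ℕ) : ℝ≥0) / n) ω) =
      changes (n * M) fun k => J ((k : ℝ≥0) / n) ω := fun ω =>
    (changes_congr fun _ hk => extendStates_apply hk fun k : ℕ => J ((k : ℝ≥0) / n) ω).symm
  rw [lintegral_add_left measurable_const, lintegral_const, measure_univ, mul_one,
    lintegral_mul_const _ hch] at h1
  simp only [h2] at h1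
  calc ∫⁻ ω, gridBound q n (n * M) (fun k => J ((k : ℝ≥0) / n) ω)
        (fun i t => L i t ω, fun n i j => U n i j ω) ∂μ
      = ∫⁻ ω, gridBound q n (n * M)
          (extendStates fun k : Fin (n * M + 1) => J (((k : ℕ) : ℝ≥0) / n) ω)
          (fun i t => L i t ω, fun n i j => U n i j ω) ∂μ :=
        lintegral_congr fun ω => congrFun (gridBound_extendStates q n _ _) _
    _ ≤ _ := h1
    _ ≤ M * c₀ + M * C * b₀ := by gcongr
    _ = M * (c₀ + C * b₀) := by ring

/-- The negative part of `X` has a mean that grows at most linearly. -/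
theorem exists_lintegral_neg_le [IsProbabilityMeasure μ] (h : IsSNMAP μ q J L U X)
    (hL : ∀ i, Integrable (L i 1) μ)
    (hU : ∀ i j, i ≠ j → 0 < q i j → Integrable (U 0 i j) μ) :
    ∃ C : ℝ≥0, ∀ M : ℕ, ∫⁻ ω, ENNReal.ofReal (-X M ω) ∂μ ≤ M * C := by
  classical
  obtain ⟨C, hC⟩ := h.chain.exists_lintegral_changes_le
  set c₀ : ℝ≥0∞ := ∑ i, ENNReal.ofReal (3 * ∫ ω, |L i 1 ω| ∂μ) with hc₀
  set b₀ : ℝ≥0∞ := ∑ i, ∑ j, open Classical in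
    if i ≠ j ∧ 0 < q i j then ∫⁻ ω, ‖U 0 i j ω‖ₑ ∂μ else 0 with hb₀
  have hb₀fin : b₀ ≠ ∞ := by
    refine ENNReal.sum_ne_top.2 fun i _ => ENNReal.sum_ne_top.2 fun j _ => ?_
    split_ifs with hij
    · exact (hU i j hij.1 hij.2).2.ne
    · exact ENNReal.zero_ne_top
  have hc₀fin : c₀ ≠ ∞ := ENNReal.sum_ne_top.2 fun i _ => ENNReal.ofReal_ne_top
  refine ⟨(c₀ + C * b₀).toNNReal, fun M => ?_⟩
  rw [ENNReal.coe_toNNReal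
    (ENNReal.add_ne_top.2 ⟨hc₀fin, ENNReal.mul_ne_top ENNReal.coe_ne_top hb₀fin⟩)]
  -- Fatou's lemma, followed by the bound uniform in the mesh.
  calc ∫⁻ ω, ENNReal.ofReal (-X M ω) ∂μ
      ≤ ∫⁻ ω, liminf (fun n : ℕ => gridBound q n (n * M) (fun k => J ((k : ℝ≥0) / n) ω)
          (fun i t => L i t ω, fun n i j => U n i j ω)) atTop ∂μ :=
        lintegral_mono_ae (h.ae_ofReal_neg_le M)
    _ ≤ liminf (fun n : ℕ => ∫⁻ ω, gridBound q n (n * M) (fun k => J ((k : ℝ≥0) / n) ω)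
          (fun i t => L i t ω, fun n i j => U n i j ω) ∂μ) atTop :=
        lintegral_liminf_le fun n => h.measurable_gridBound_comp n (n * M)
    _ ≤ M * (c₀ + C * b₀) := by
        refine liminf_le_of_frequently_le' (Eventually.frequently ?_)
        filter_upwards [eventually_gt_atTop 0] with n hn
          using h.lintegral_gridBound_comp_le hL hn M (hC n M)

end IsSNMAP

end MAPQueue

namespace MAPQueue

variable {Ω : Type*} [MeasurableSpace Ω] {μ : Measure Ω} {d : ℕ}

/-! ### Conditioning and independence -/

section Indep

variable {α β γ : Type*} [MeasurableSpace α] [MeasurableSpace β] [MeasurableSpace γ]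

theorem cond_preimage_of_indepFun [IsProbabilityMeasure μ] {T : Ω → α} {Z : Ω → β}
    (hZ : Measurable Z) (hTZ : IndepFun T Z μ) {B : Set β} (hB : MeasurableSet B)
    (hB0 : μ (Z ⁻¹' B) ≠ 0) {s : Set α} (hs : MeasurableSet s) :
    cond μ (Z ⁻¹' B) (T ⁻¹' s) = μ (T ⁻¹' s) := by
  rw [cond_apply (hZ hB), inter_comm,
    indepFun_iff_measure_inter_preimage_eq_mul.1 hTZ s B hs hB, mul_comm (μ (T ⁻¹' s)), ← mul_assoc,
    ENNReal.inv_mul_cancel hB0 (measure_ne_top _ _), one_mul]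

/-- The conditioning event belongs to `Z` and can be absorbed into the events of `Z`, from which `T`
is independent. -/
theorem indepFun_cond_preimage [IsProbabilityMeasure μ] {T : Ω → α} {Z : Ω → β}
    (hZ : Measurable Z) (hTZ : IndepFun T Z μ) {B : Set β} (hB : MeasurableSet B)
    (hB0 : μ (Z ⁻¹' B) ≠ 0) : IndepFun T Z (cond μ (Z ⁻¹' B)) := by
  rw [indepFun_iff_measure_inter_preimage_eq_mul]
  intro s t hs ht
  rw [cond_preimage_of_indepFun hZ hTZ hB hB0 hs, cond_apply (hZ hB), cond_apply (hZ hB)]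
  have e : Z ⁻¹' B ∩ (T ⁻¹' s ∩ Z ⁻¹' t) = T ⁻¹' s ∩ Z ⁻¹' (B ∩ t) := by
    rw [preimage_inter, inter_left_comm]
  rw [e, indepFun_iff_measure_inter_preimage_eq_mul.1 hTZ s _ hs (hB.inter ht), preimage_inter]
  ring

/-- The two hypotheses make the joint law a threefold product, which may be regrouped. -/
theorem indepFun_prodMk_of_indepFun [IsProbabilityMeasure μ] {T : Ω → α} {Q : Ω → β} {W : Ω → γ}
    (hT : AEMeasurable T μ) (hQ : Measurable Q) (hW : Measurable W)
    (h1 : IndepFun T (fun ω => (Q ω, W ω)) μ) (h2 : IndepFun Q W μ) :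
    IndepFun Q (fun ω => (T ω, W ω)) μ := by
  have hTW : IndepFun T W μ := h1.comp measurable_id measurable_snd
  have e1 := (indepFun_iff_map_prod_eq_prod_map_map hT (hQ.prodMk hW).aemeasurable).1 h1
  have e2 := (indepFun_iff_map_prod_eq_prod_map_map hQ.aemeasurable hW.aemeasurable).1 h2
  have e3 := (indepFun_iff_map_prod_eq_prod_map_map hT hW.aemeasurable).1 hTW
  rw [indepFun_iff_map_prod_eq_prod_map_map hQ.aemeasurable (hT.prodMk hW.aemeasurable), e3]
  have := Measure.isProbabilityMeasure_map (μ := μ) hT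
  have := Measure.isProbabilityMeasure_map (μ := μ) hQ.aemeasurable
  have := Measure.isProbabilityMeasure_map (μ := μ) hW.aemeasurable
  let g : α × (β × γ) → β × (α × γ) := fun p => (p.2.1, (p.1, p.2.2))
  have hg : Measurable g := by fun_prop
  have e4 : μ.map (fun ω => (Q ω, T ω, W ω)) = (μ.map fun ω => (T ω, Q ω, W ω)).map g := by
    rw [AEMeasurable.map_map_of_aemeasurable hg.aemeasurable
      (hT.prodMk (hQ.prodMk hW).aemeasurable)]
    rfl
  rw [e4, e1, e2, ← Measure.prodAssoc_prod, Measure.map_map hg MeasurableEquiv.prodAssoc.measurable,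
    ← Measure.prodAssoc_prod, ← Measure.prod_swap (μ := μ.map T) (ν := μ.map Q)]
  conv_rhs => rw [← Measure.map_id (μ := μ.map W),
    Measure.map_prod_map _ _ measurable_swap measurable_id,
    Measure.map_map MeasurableEquiv.prodAssoc.measurable (measurable_swap.prodMap measurable_id)]
  rfl

end Indep

/-! ### The exponential distribution -/

theorem lintegral_ofReal_expMeasure_lt_top {r : ℝ} (hr : 0 < r) :
    ∫⁻ t, ENNReal.ofReal t ∂(expMeasure r) < ∞ := by
  have h1 := integrableOn_rpow_mul_exp_neg_mul_rpow (p := 1) (s := 1) (b := r) (by norm_num)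
    one_pos hr
  have h2 : IntegrableOn (fun x : ℝ => r * (x * Real.exp (-r * x))) (Ioi 0) := by
    simp only [Real.rpow_one] at h1
    exact h1.const_mul r
  have hm : Measurable (gammaPDF 1 r) := (measurable_gammaPDFReal 1 r).ennreal_ofReal
  rw [expMeasure, gammaMeasure, lintegral_withDensity_eq_lintegral_mul _ hm (by fun_prop)]
  have h3 : ∫⁻ x in Ioi (0 : ℝ), ENNReal.ofReal (r * (x * Real.exp (-r * x))) < ∞ :=
    h2.lintegral_lt_top
  refine lt_of_eq_of_lt ?_ h3
  rw [← lintegral_indicator measurableSet_Ioi]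
  refine lintegral_congr fun x => ?_
  by_cases hx : 0 < x
  · rw [indicator_of_mem (show x ∈ Ioi (0 : ℝ) from hx)]
    have := exponentialPDF_of_nonneg (r := r) hx.le
    rw [exponentialPDF, exponentialPDFReal] at this
    rw [Pi.mul_apply, gammaPDF, this, ← ENNReal.ofReal_mul (by positivity)]
    congr 1
    rw [neg_mul]
    ring
  · rw [indicator_of_notMem (show x ∉ Ioi (0 : ℝ) from hx), Pi.mul_apply,
      ENNReal.ofReal_of_nonpos (not_lt.1 hx), mul_zero]

/-- The distribution function yields the open tail, and there are no atoms. The closed tail is what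
the event that the passage time is at most `T` calls for. -/
theorem expMeasure_real_Ici {r : ℝ} (hr : 0 < r) {t : ℝ} (ht : 0 ≤ t) :
    (expMeasure r).real (Ici t) = Real.exp (-r * t) := by
  have := isProbabilityMeasure_expMeasure hr
  have hac : expMeasure r ≪ volume := withDensity_absolutelyContinuous _ _
  have h0 : expMeasure r {t} = 0 := hac (by simp)
  have h1 : (expMeasure r).real (Ici t) = (expMeasure r).real (Ioi t) := by
    refine measureReal_congr ?_
    have : ({t} : Set ℝ) ∪ Ioi t = Ici t := by rw [union_comm, Ioi_union_left]
    rw [← this]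
    exact union_ae_eq_right_of_ae_eq_empty (ae_eq_empty.2 h0)
  have h2 := cdf_expMeasure_eq hr t
  rw [cdf_eq_real, if_pos ht] at h2
  rw [h1, ← compl_Iic, probReal_compl_eq_one_sub measurableSet_Iic, h2]
  ring_nf

end MAPQueue

namespace MAPQueue

variable {Ω : Type*} [MeasurableSpace Ω] {μ : Measure Ω} {d : ℕ}

/-! ### The input at an independent random time -/

section RandomTime

variable {γ : Type*} [MeasurableSpace γ]

theorem lintegral_comp_of_indepFun [IsProbabilityMeasure μ] {ρ : Measure ℝ} {T : Ω → ℝ}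
    (hT : HasLaw T ρ μ) {W : Ω → γ} (hW : Measurable W) (hTW : IndepFun T W μ)
    {F : ℝ × γ → ℝ≥0∞} (hF : Measurable F) :
    ∫⁻ ω, F (T ω, W ω) ∂μ = ∫⁻ t, ∫⁻ ω, F (t, W ω) ∂μ ∂ρ := by
  have e := (indepFun_iff_map_prod_eq_prod_map_map hT.aemeasurable hW.aemeasurable).1 hTW
  have := Measure.isProbabilityMeasure_map (μ := μ) hW.aemeasurable
  rw [hT.map_eq] at e
  rw [← lintegral_map' (μ := μ) (f := F) (g := fun ω => (T ω, W ω)) hF.aemeasurable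
    (hT.aemeasurable.prodMk hW.aemeasurable), e, lintegral_prod _ hF.aemeasurable]
  refine lintegral_congr fun t => ?_
  rw [lintegral_map (by fun_prop) hW]

theorem measure_comp_of_indepFun [IsProbabilityMeasure μ] {ρ : Measure ℝ} [IsProbabilityMeasure ρ]
    {T : Ω → ℝ} (hT : HasLaw T ρ μ) {W : Ω → γ} (hW : Measurable W) (hTW : IndepFun T W μ)
    {S : Set (ℝ × γ)} (hS : MeasurableSet S) :
    μ.real {ω | (T ω, W ω) ∈ S} = ∫ ω, ρ.real {t | (t, W ω) ∈ S} ∂μ := by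
  have e := (indepFun_iff_map_prod_eq_prod_map_map hT.aemeasurable hW.aemeasurable).1 hTW
  have := Measure.isProbabilityMeasure_map (μ := μ) hW.aemeasurable
  rw [hT.map_eq] at e
  have hm : Measurable fun w : γ => ρ ((fun t => (t, w)) ⁻¹' S) := measurable_measure_prodMk_right hS
  have h1 : μ {ω | (T ω, W ω) ∈ S} = ∫⁻ ω, ρ {t | (t, W ω) ∈ S} ∂μ := by
    have h2 : μ {ω | (T ω, W ω) ∈ S} = μ.map (fun ω => (T ω, W ω)) S :=
      (Measure.map_apply_of_aemeasurable (hT.aemeasurable.prodMk hW.aemeasurable) hS).symm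
    rw [h2, e, Measure.prod_apply_symm hS, lintegral_map hm hW]
    rfl
  have hm' : Measurable fun ω => ρ {t | (t, W ω) ∈ S} := hm.comp hW
  simp only [measureReal_def]
  rw [h1, integral_toReal hm'.aemeasurable]
  exact Eventually.of_forall fun ω => measure_lt_top _ _

end RandomTime

theorem runInf_nonpos {Ω : Type*} {X : ℝ≥0 → Ω → ℝ} {ω : Ω} (h : IsRegularPath fun t => X t ω)
    (h0 : X 0 ω = 0) (t : ℝ≥0) : runInf X t ω ≤ 0 :=
  (h.iInf_le (s := 0) zero_le).trans h0.le

namespace IsSNMAP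

variable {q : Matrix (Fin d) (Fin d) ℝ} {J : ℝ≥0 → Ω → Fin d} {L : Fin d → ℝ≥0 → Ω → ℝ}
  {U : ℕ → Fin d → Fin d → Ω → ℝ} {X : ℝ≥0 → Ω → ℝ}

theorem ae_isRegularPath (h : IsSNMAP μ q J L U X) :
    ∀ᵐ ω ∂μ, IsRegularPath (fun t => X t ω) ∧ X 0 ω = 0 := by
  filter_upwards [h.ae_isModulatedPath, h.zero] with ω h1 h2 using ⟨h1.isRegularPath, h2⟩

theorem measurable_path (h : IsSNMAP μ q J L U X) : Measurable fun ω t => X t ω :=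
  measurable_pi_lambda _ h.measurable

variable {T : Ω → ℝ}

theorem ae_randomTime_eq (h : IsSNMAP μ q J L U X) :
    ∀ᵐ ω ∂μ, pathEval ((T ω).toNNReal, fun t => X t ω) = X (T ω).toNNReal ω ∧
      pathInf ((T ω).toNNReal, fun t => X t ω) = runInf X (T ω).toNNReal ω := by
  filter_upwards [h.ae_isRegularPath] with ω hω using ⟨hω.1.pathEval_eq _, hω.1.pathInf_eq _⟩

/-- Evaluating a path at a random time is not a measurable operation on the full product space;
`pathEval` and `pathInf` are measurable and agree with the wanted quantities on regular paths. -/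
theorem aemeasurable_randomTime (h : IsSNMAP μ q J L U X) (hT : AEMeasurable T μ) :
    AEMeasurable (fun ω => X (T ω).toNNReal ω) μ ∧
      AEMeasurable (fun ω => runInf X (T ω).toNNReal ω) μ := by
  have hp : AEMeasurable (fun ω => ((T ω).toNNReal, fun t => X t ω)) μ :=
    hT.real_toNNReal.prodMk h.measurable_path.aemeasurable
  exact ⟨(measurable_pathEval.comp_aemeasurable hp).congr
      (h.ae_randomTime_eq.mono fun ω hω => hω.1),
    (measurable_pathInf.comp_aemeasurable hp).congr (h.ae_randomTime_eq.mono fun ω hω => hω.2)⟩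

variable {Q₀ : Ω → ℝ} {ϑ : ℝ}

theorem aemeasurable_workload (h : IsSNMAP μ q J L U X) (hQ : Measurable Q₀) (t : ℝ≥0) :
    AEMeasurable (workload X Q₀ t) μ := by
  have h1 := h.aemeasurable_randomTime (T := fun _ => (t : ℝ)) aemeasurable_const
  simp only [Real.toNNReal_coe] at h1
  exact h1.1.add (hQ.aemeasurable.max h1.2.neg)

/-- The workload at an independent random time has the stationary law. -/
theorem identDistrib_workloadAt [IsProbabilityMeasure μ] (h : IsSNMAP μ q J L U X)
    (hQ : IsStationaryQueue μ X J Q₀) {ρ : Measure ℝ} [IsProbabilityMeasure ρ] (hT : HasLaw T ρ μ)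
    (hTindep : IndepFun T (fun ω => (Q₀ ω, fun t => X t ω)) μ) :
    IdentDistrib (workloadAt X Q₀ T) Q₀ μ μ := by
  obtain ⟨m1, m2⟩ := h.aemeasurable_randomTime hT.aemeasurable
  refine ⟨m1.add (hQ.measurable.aemeasurable.max m2.neg), hQ.measurable.aemeasurable, ?_⟩
  have hmT : AEMeasurable (workloadAt X Q₀ T) μ := m1.add (hQ.measurable.aemeasurable.max m2.neg)
  ext s hs
  rw [Measure.map_apply_of_aemeasurable hmT hs, Measure.map_apply hQ.measurable hs]
  let G : ℝ × (ℝ × (ℝ≥0 → ℝ)) → ℝ := fun p => pathEval (p.1.toNNReal, p.2.2) +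
    max p.2.1 (-pathInf (p.1.toNNReal, p.2.2))
  have hG : Measurable G := by
    have e : Measurable fun p : ℝ × (ℝ × (ℝ≥0 → ℝ)) => (p.1.toNNReal, p.2.2) := by fun_prop
    exact (measurable_pathEval.comp e).add (measurable_snd.fst.max (measurable_pathInf.comp e).neg)
  have hF : Measurable fun p => (s.indicator 1 (G p) : ℝ≥0∞) :=
    (measurable_one.indicator hs).comp hG
  have h1 := lintegral_comp_of_indepFun hT (hQ.measurable.prodMk h.measurable_path) hTindep hF
  have h2 : ∫⁻ ω, (s.indicator 1 (G (T ω, Q₀ ω, fun t => X t ω)) : ℝ≥0∞) ∂μ =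
      μ (workloadAt X Q₀ T ⁻¹' s) := by
    rw [← lintegral_indicator_one₀ (hmT.nullMeasurable hs)]
    refine lintegral_congr_ae ?_
    filter_upwards [h.ae_randomTime_eq (T := T)] with ω hω
    simp only [G, hω.1, hω.2]
    rfl
  have h3 : ∀ t : ℝ, ∫⁻ ω, (s.indicator 1 (G (t, Q₀ ω, fun t => X t ω)) : ℝ≥0∞) ∂μ =
      μ (Q₀ ⁻¹' s) := by
    intro t
    have hst := (hQ.stationary t.toNNReal).comp measurable_fst
    have h4 := hst.measure_mem_eq hs
    refine Eq.trans ?_ h4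
    rw [← lintegral_indicator_one₀ (hst.aemeasurable_fst.nullMeasurable hs)]
    refine lintegral_congr_ae ?_
    filter_upwards [h.ae_randomTime_eq (T := fun _ => t)] with ω hω
    simp only [G, hω.1, hω.2]
    rfl
  rw [← h2, h1]
  simp only [h3]
  simp

/-- At the integer time `M = ⌈t⌉` one has `-X̲_t ≤ -X̲_M ≤ Q_M - X_M`, and `Q_M` has the law of
`Q₀`. -/
theorem lintegral_neg_runInf_le [IsProbabilityMeasure μ] (h : IsSNMAP μ q J L U X)
    (hQ : IsStationaryQueue μ X J Q₀) {C : ℝ≥0}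
    (hC : ∀ M : ℕ, ∫⁻ ω, ENNReal.ofReal (-X M ω) ∂μ ≤ M * C) (t : ℝ≥0) :
    ∫⁻ ω, ENNReal.ofReal (-runInf X t ω) ∂μ ≤ ∫⁻ ω, ENNReal.ofReal (Q₀ ω) ∂μ + ⌈t⌉₊ * C := by
  have hst := (hQ.stationary (⌈t⌉₊ : ℕ)).comp
    (measurable_fst.ennreal_ofReal : Measurable fun p : ℝ × Fin d => ENNReal.ofReal p.1)
  have h1 : ∫⁻ ω, ENNReal.ofReal (workload X Q₀ (⌈t⌉₊ : ℕ) ω) ∂μ =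
      ∫⁻ ω, ENNReal.ofReal (Q₀ ω) ∂μ := hst.lintegral_eq
  calc ∫⁻ ω, ENNReal.ofReal (-runInf X t ω) ∂μ
      ≤ ∫⁻ ω, (ENNReal.ofReal (workload X Q₀ (⌈t⌉₊ : ℕ) ω) +
          ENNReal.ofReal (-X (⌈t⌉₊ : ℕ) ω)) ∂μ := by
        refine lintegral_mono_ae ?_
        filter_upwards [h.ae_isRegularPath] with ω hω
        refine le_trans (ENNReal.ofReal_le_ofReal ?_) ENNReal.ofReal_add_le
        have h2 : runInf X (⌈t⌉₊ : ℕ) ω ≤ runInf X t ω := hω.1.iInf_anti (Nat.le_ceil t)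
        have h3 := le_max_right (Q₀ ω) (-runInf X (⌈t⌉₊ : ℕ) ω)
        rw [workload]
        linarith
    _ = ∫⁻ ω, ENNReal.ofReal (Q₀ ω) ∂μ + ∫⁻ ω, ENNReal.ofReal (-X (⌈t⌉₊ : ℕ) ω) ∂μ := by
        rw [lintegral_add_left' (h.aemeasurable_workload hQ.measurable _).ennreal_ofReal, h1]
    _ ≤ _ := by gcongr; exact hC _

/-- The bound at a fixed time is affine in that time, and `T` has a finite mean. -/
theorem integrable_runInf_randomTime [IsProbabilityMeasure μ] (h : IsSNMAP μ q J L U X)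
    (hL : ∀ i, Integrable (L i 1) μ) (hU : ∀ i j, i ≠ j → 0 < q i j → Integrable (U 0 i j) μ)
    (hQ : IsStationaryQueue μ X J Q₀) (hQi : Integrable Q₀ μ) (hϑ : 0 < ϑ)
    (hT : HasLaw T (expMeasure ϑ) μ) (hTindep : IndepFun T (fun ω => (Q₀ ω, fun t => X t ω)) μ) :
    Integrable (fun ω => runInf X (T ω).toNNReal ω) μ := by
  have := isProbabilityMeasure_expMeasure hϑ
  obtain ⟨C, hC⟩ := h.exists_lintegral_neg_le hL hU
  refine ⟨(h.aemeasurable_randomTime hT.aemeasurable).2.aestronglyMeasurable, ?_⟩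
  have hTX : IndepFun T (fun ω t => X t ω) μ := hTindep.comp measurable_id measurable_snd
  have hF : Measurable fun p : ℝ × (ℝ≥0 → ℝ) =>
      ENNReal.ofReal (-pathInf (p.1.toNNReal, p.2)) :=
    (measurable_pathInf.comp (by fun_prop :
      Measurable fun p : ℝ × (ℝ≥0 → ℝ) => (p.1.toNNReal, p.2))).neg.ennreal_ofReal
  have h1 := lintegral_comp_of_indepFun hT h.measurable_path hTX hF
  have h2 : ∫⁻ ω, ‖runInf X (T ω).toNNReal ω‖ₑ ∂μ =
      ∫⁻ ω, ENNReal.ofReal (-pathInf ((T ω).toNNReal, fun t => X t ω)) ∂μ := by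
    refine lintegral_congr_ae ?_
    filter_upwards [h.ae_randomTime_eq (T := T), h.ae_isRegularPath] with ω hω hr
    rw [hω.2, Real.enorm_eq_ofReal_abs, abs_of_nonpos (runInf_nonpos hr.1 hr.2 _)]
  have hQfin : ∫⁻ ω, ENNReal.ofReal (Q₀ ω) ∂μ < ∞ := hQi.lintegral_lt_top
  have h3 : ∀ t : ℝ, ∫⁻ ω, ENNReal.ofReal (-pathInf (t.toNNReal, fun t => X t ω)) ∂μ ≤
      (∫⁻ ω, ENNReal.ofReal (Q₀ ω) ∂μ + C) + ENNReal.ofReal t * C := by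
    intro t
    have e : ∫⁻ ω, ENNReal.ofReal (-pathInf (t.toNNReal, fun t => X t ω)) ∂μ =
        ∫⁻ ω, ENNReal.ofReal (-runInf X t.toNNReal ω) ∂μ := by
      refine lintegral_congr_ae ?_
      filter_upwards [h.ae_randomTime_eq (T := fun _ => t)] with ω hω
      rw [hω.2]
    rw [e]
    refine (h.lintegral_neg_runInf_le hQ hC _).trans ?_
    have h4 : (⌈t.toNNReal⌉₊ : ℝ≥0∞) ≤ ENNReal.ofReal t + 1 := by
      have : (⌈t.toNNReal⌉₊ : ℝ≥0) ≤ t.toNNReal + 1 := (Nat.ceil_lt_add_one zero_le).le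
      rw [ENNReal.ofReal]
      exact_mod_cast this
    calc ∫⁻ ω, ENNReal.ofReal (Q₀ ω) ∂μ + ⌈t.toNNReal⌉₊ * C
        ≤ ∫⁻ ω, ENNReal.ofReal (Q₀ ω) ∂μ + (ENNReal.ofReal t + 1) * C := by gcongr
      _ = _ := by ring
  rw [HasFiniteIntegral, h2, h1]
  refine (lintegral_mono h3).trans_lt ?_
  rw [lintegral_add_left measurable_const, lintegral_const, measure_univ, mul_one,
    lintegral_mul_const _ (by fun_prop)]
  have := lintegral_ofReal_expMeasure_lt_top hϑ
  exact ENNReal.add_lt_top.2 ⟨ENNReal.add_lt_top.2 ⟨hQfin, ENNReal.coe_lt_top⟩,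
    ENNReal.mul_lt_top this ENNReal.coe_lt_top⟩

/-- From `max(a, b) = a + (b - a)⁺`; the covariance is computed term by term from this form. -/
theorem ae_workloadAt_eq (h : IsSNMAP μ q J L U X) :
    ∀ᵐ ω ∂μ, workloadAt X Q₀ T ω = X (T ω).toNNReal ω + Q₀ ω +
        max (-runInf X (T ω).toNNReal ω - Q₀ ω) 0 ∧
      runInf X (T ω).toNNReal ω ≤ X (T ω).toNNReal ω ∧ runInf X (T ω).toNNReal ω ≤ 0 := by
  filter_upwards [h.ae_isRegularPath] with ω hω
  refine ⟨?_, hω.1.iInf_le le_rfl, runInf_nonpos hω.1 hω.2 _⟩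
  rw [workloadAt, workload, add_assoc]
  congr 1
  rw [← max_add_add_left, add_sub_cancel, add_zero, max_comm]

/-- The input is squeezed: `X̲_T ≤ X_T ≤ Q_T`. -/
theorem integrable_randomTime [IsProbabilityMeasure μ] (h : IsSNMAP μ q J L U X)
    (hT : AEMeasurable T μ) (hQ0 : ∀ᵐ ω ∂μ, 0 ≤ Q₀ ω)
    (hY : Integrable (fun ω => runInf X (T ω).toNNReal ω) μ)
    (hQT : Integrable (workloadAt X Q₀ T) μ) : Integrable (fun ω => X (T ω).toNNReal ω) μ := by
  refine (hY.abs.add hQT.abs).mono' (h.aemeasurable_randomTime hT).1.aestronglyMeasurable ?_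
  filter_upwards [h.ae_workloadAt_eq (T := T) (Q₀ := Q₀), hQ0] with ω hω h0
  obtain ⟨h1, h2, h3⟩ := hω
  have h4 := le_max_right (-runInf X (T ω).toNNReal ω - Q₀ ω) 0
  rw [Real.norm_eq_abs, Pi.add_apply, abs_le]
  have h5 := neg_abs_le (runInf X (T ω).toNNReal ω)
  have h6 := le_abs_self (workloadAt X Q₀ T ω)
  have h7 := abs_nonneg (workloadAt X Q₀ T ω)
  have h8 := abs_nonneg (runInf X (T ω).toNNReal ω)
  constructor <;> linarith

end IsSNMAP

end MAPQueue

namespace MAPQueue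

variable {Ω : Type*} [MeasurableSpace Ω]

/-! ### Transforms of a nonnegative random variable -/

theorem norm_cexp_neg_mul_le_one {z : ℂ} (hz : 0 ≤ z.re) {y : ℝ} (hy : 0 ≤ y) :
    ‖Complex.exp (-z * y)‖ ≤ 1 := by
  rw [Complex.norm_exp]
  simp only [Complex.mul_re, Complex.neg_re, Complex.neg_im, Complex.ofReal_re, Complex.ofReal_im,
    mul_zero, sub_zero, Real.exp_le_one_iff]
  nlinarith

theorem norm_cexp_neg_mul (z : ℂ) (y : ℝ) :
    ‖Complex.exp (-z * y)‖ = Real.exp (-z.re * y) := by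
  rw [Complex.norm_exp]
  simp

theorem setIntegral_Ioi_ite_le {f : ℝ → ℂ} {x : ℝ} (hx : 0 ≤ x) :
    ∫ y in Ioi (0 : ℝ), (if y ≤ x then f y else 0) = ∫ y in (0 : ℝ)..x, f y := by
  rw [intervalIntegral.integral_of_le hx]
  have h : (fun y => if y ≤ x then f y else 0) = (Iic x).indicator f := by
    ext y
    simp [Set.indicator_apply]
  rw [h, setIntegral_indicator measurableSet_Iic, Ioi_inter_Iic]

/-- The transform of the tail of a nonnegative random variable. -/
theorem integral_cexp_mul_tail {ν : Measure Ω} [IsProbabilityMeasure ν] {Y : Ω → ℝ}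
    (hY0 : ∀ᵐ ω ∂ν, 0 ≤ Y ω) (hYi : Integrable Y ν) {z : ℂ} (hz : 0 ≤ z.re) :
    IntegrableOn (fun y : ℝ => Complex.exp (-z * y) * (ν.real {ω | y ≤ Y ω} : ℂ)) (Ioi 0) ∧
      ∫ y in Ioi (0 : ℝ), Complex.exp (-z * y) * (ν.real {ω | y ≤ Y ω} : ℂ) =
        ∫ ω, (∫ y in (0 : ℝ)..Y ω, Complex.exp (-z * y)) ∂ν := by
  have hYm : AEMeasurable Y ν := hYi.aestronglyMeasurable.aemeasurable
  set ρ := ν.map Y with hρ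
  have hρp : IsProbabilityMeasure ρ := Measure.isProbabilityMeasure_map hYm
  have hρ0 : ∀ᵐ x ∂ρ, 0 ≤ x := (ae_map_iff hYm measurableSet_Ici).2 hY0
  have hρi : Integrable (fun x : ℝ => x) ρ :=
    (integrable_map_measure (g := fun x : ℝ => x) (by fun_prop) hYm).2 hYi
  let F : ℝ × ℝ → ℂ := fun p => if p.1 ≤ p.2 then Complex.exp (-z * p.1) else 0
  have hF : Measurable F := by
    refine Measurable.ite (measurableSet_le measurable_fst measurable_snd) ?_ measurable_const
    fun_prop
  -- The kernel is dominated by the indicator of `y ≤ x`, of total mass `E Y`; no decay of the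
  -- exponential is needed, so `z.re = 0` is allowed.
  have hFi : Integrable F ((volume.restrict (Ioi 0)).prod ρ) := by
    refine ⟨hF.aestronglyMeasurable, ?_⟩
    rw [HasFiniteIntegral, lintegral_prod_symm' _ hF.enorm]
    refine lt_of_le_of_lt (lintegral_mono fun x => ?_) hρi.lintegral_lt_top
    calc ∫⁻ y in Ioi (0 : ℝ), ‖F (y, x)‖ₑ ≤ ∫⁻ y in Ioi (0 : ℝ), (Iic x).indicator 1 y := by
          refine setLIntegral_mono (measurable_one.indicator measurableSet_Iic) fun y hy => ?_
          by_cases hyx : y ≤ x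
          · rw [indicator_of_mem (show y ∈ Iic x from hyx)]
            simp only [F, if_pos hyx, Pi.one_apply]
            rw [← ofReal_norm, ← ENNReal.ofReal_one]
            exact ENNReal.ofReal_le_ofReal (norm_cexp_neg_mul_le_one hz (le_of_lt hy))
          · simp [F, if_neg hyx]
      _ = ENNReal.ofReal x := by
          rw [lintegral_indicator_one measurableSet_Iic, Measure.restrict_apply measurableSet_Iic,
            inter_comm, Ioi_inter_Iic, Real.volume_Ioc, sub_zero]
  have htail : ∀ y : ℝ, ∫ x, F (y, x) ∂ρ =
      Complex.exp (-z * y) * (ν.real {ω | y ≤ Y ω} : ℂ) := by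
    intro y
    have h1 : (fun x => F (y, x)) = (Ici y).indicator fun _ => Complex.exp (-z * y) := by
      ext x; simp [F, Set.indicator_apply]
    have h2 : ρ.real (Ici y) = ν.real {ω | y ≤ Y ω} := by
      rw [hρ, map_measureReal_apply_of_aemeasurable hYm measurableSet_Ici]
      rfl
    rw [h1, integral_indicator_const _ measurableSet_Ici, h2, Complex.real_smul, mul_comm]
  have h1 := hFi.integral_prod_left
  have h2 : ∫ y in Ioi (0 : ℝ), ∫ x, F (y, x) ∂ρ = ∫ x, (∫ y in Ioi (0 : ℝ), F (y, x)) ∂ρ :=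
    integral_integral_swap (f := fun a b => F (a, b)) hFi
  simp only [htail] at h1 h2
  refine ⟨h1, h2.trans ?_⟩
  have h3 : ∫ x, (∫ y in Ioi (0 : ℝ), F (y, x)) ∂ρ =
      ∫ ω, (∫ y in Ioi (0 : ℝ), F (y, Y ω)) ∂ν :=
    integral_map hYm hFi.integral_prod_right.aestronglyMeasurable
  rw [h3]
  refine integral_congr_ae ?_
  filter_upwards [hY0] with ω hω
  exact setIntegral_Ioi_ite_le hω

theorem intervalIntegral_cexp_neg_mul {z : ℂ} (hz : z ≠ 0) (x : ℝ) :
    ∫ y in (0 : ℝ)..x, Complex.exp (-z * y) = (1 - Complex.exp (-z * x)) / z := by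
  rw [integral_exp_mul_complex (neg_ne_zero.2 hz)]
  simp only [Complex.ofReal_zero, mul_zero, Complex.exp_zero]
  rw [div_neg, ← neg_div, neg_sub]

theorem intervalIntegral_overshoot {z : ℂ} (hz : z ≠ 0) (y : ℝ) :
    ∫ x in (0 : ℝ)..y, Complex.exp (-z * x) * (x * (y - x) : ℂ) =
      y / z ^ 2 * (1 + Complex.exp (-z * y)) - 2 / z ^ 3 * (1 - Complex.exp (-z * y)) := by
  -- The quadratic factor `P` solves `P' - z P = x (y - x)`.
  let H : ℝ → ℂ := fun x => Complex.exp (-z * x) *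
    (x ^ 2 / z + (2 / z - y) / z * x + (2 / z - y) / z ^ 2)
  have hH : ∀ x ∈ uIcc 0 y, HasDerivAt H (Complex.exp (-z * x) * (x * (y - x) : ℂ)) x := by
    intro x _
    have h0 : HasDerivAt (fun x : ℝ => (x : ℂ)) 1 x := Complex.ofRealCLM.hasDerivAt
    have h1 : HasDerivAt (fun x : ℝ => Complex.exp (-z * x)) (Complex.exp (-z * x) * (-z * 1)) x :=
      (h0.const_mul (-z)).cexp
    have h2 : HasDerivAt (fun x : ℝ => ((x : ℂ) ^ 2 / z + (2 / z - y) / z * x + (2 / z - y) / z ^ 2))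
        ((2 : ℕ) * (x : ℂ) ^ (2 - 1) * 1 / z + (2 / z - y) / z * 1) x :=
      (((h0.pow 2).div_const z).add (h0.const_mul _)).add_const _
    refine (h1.mul h2).congr_deriv ?_
    field_simp
    push_cast
    ring
  rw [intervalIntegral.integral_eq_sub_of_hasDerivAt hH
    (Continuous.intervalIntegrable (by fun_prop) _ _)]
  simp only [H, Complex.ofReal_zero, mul_zero, Complex.exp_zero]
  field_simp
  ring

/-- The transform of `x ↦ x E (Y - x)⁺`. -/
theorem integral_cexp_mul_overshoot {ν : Measure Ω} [IsProbabilityMeasure ν] {Y : Ω → ℝ}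
    (hY0 : ∀ᵐ ω ∂ν, 0 ≤ Y ω) (hYi : Integrable Y ν) {z : ℂ} (hz : 0 < z.re) :
    IntegrableOn (fun x : ℝ => Complex.exp (-z * x) *
        ((x * ∫ ω, max (Y ω - x) 0 ∂ν : ℝ) : ℂ)) (Ioi 0) ∧
      ∫ x in Ioi (0 : ℝ), Complex.exp (-z * x) * ((x * ∫ ω, max (Y ω - x) 0 ∂ν : ℝ) : ℂ) =
        ∫ ω, (Y ω / z ^ 2 * (1 + Complex.exp (-z * Y ω)) -
          2 / z ^ 3 * (1 - Complex.exp (-z * Y ω))) ∂ν := by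
  have hz0 : z ≠ 0 := by rintro rfl; simp at hz
  have hYm : AEMeasurable Y ν := hYi.aestronglyMeasurable.aemeasurable
  set ρ := ν.map Y with hρ
  have hρp : IsProbabilityMeasure ρ := Measure.isProbabilityMeasure_map hYm
  have hρ0 : ∀ᵐ x ∂ρ, 0 ≤ x := (ae_map_iff hYm measurableSet_Ici).2 hY0
  have hρi : Integrable (fun x : ℝ => x) ρ :=
    (integrable_map_measure (g := fun x : ℝ => x) (by fun_prop) hYm).2 hYi
  let F : ℝ × ℝ → ℂ := fun p => Complex.exp (-z * p.1) * ((p.1 * max (p.2 - p.1) 0 : ℝ) : ℂ)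
  have hF : Measurable F := by fun_prop
  have hdec : IntegrableOn (fun x : ℝ => x * Real.exp (-z.re * x)) (Ioi 0) := by
    have h1 := integrableOn_rpow_mul_exp_neg_mul_rpow (p := 1) (s := 1) (b := z.re) (by norm_num)
      one_pos hz
    simpa only [Real.rpow_one] using h1
  -- Because `(y - x)⁺ ≤ y`, the product of `x exp(-x Re z)` and `y` dominates; here `0 < z.re` is
  -- essential.
  have hFi : Integrable F ((volume.restrict (Ioi 0)).prod ρ) := by
    refine (Integrable.mul_prod hdec hρi).mono' hF.aestronglyMeasurable ?_
    have h1 : ∀ᵐ p ∂((volume.restrict (Ioi (0 : ℝ))).prod ρ), p.1 ∈ Ioi (0 : ℝ) :=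
      Measure.quasiMeasurePreserving_fst.ae (ae_restrict_mem measurableSet_Ioi)
    have h2 : ∀ᵐ p ∂((volume.restrict (Ioi (0 : ℝ))).prod ρ), 0 ≤ p.2 :=
      Measure.quasiMeasurePreserving_snd.ae hρ0
    filter_upwards [h1, h2] with p hp1 hp2
    have hp1' : 0 < p.1 := hp1
    have h3 : max (p.2 - p.1) 0 ≤ p.2 := max_le (by linarith) hp2
    have h4 : 0 ≤ max (p.2 - p.1) 0 := le_max_right _ _
    rw [norm_mul, norm_cexp_neg_mul, Complex.norm_real, Real.norm_eq_abs,
      abs_of_nonneg (mul_nonneg hp1'.le h4)]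
    calc Real.exp (-z.re * p.1) * (p.1 * max (p.2 - p.1) 0)
        ≤ Real.exp (-z.re * p.1) * (p.1 * p.2) := by gcongr
      _ = p.1 * Real.exp (-z.re * p.1) * p.2 := by ring
  have hin : ∀ x : ℝ, ∫ y, F (x, y) ∂ρ =
      Complex.exp (-z * x) * ((x * ∫ ω, max (Y ω - x) 0 ∂ν : ℝ) : ℂ) := by
    intro x
    simp only [F]
    rw [integral_const_mul, integral_complex_ofReal, integral_const_mul, hρ,
      integral_map hYm (f := fun y => max (y - x) 0) (by fun_prop)]
  have h1 := hFi.integral_prod_left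
  have h2 : ∫ x in Ioi (0 : ℝ), ∫ y, F (x, y) ∂ρ = ∫ y, (∫ x in Ioi (0 : ℝ), F (x, y)) ∂ρ :=
    integral_integral_swap (f := fun a b => F (a, b)) hFi
  simp only [hin] at h1 h2
  refine ⟨h1, h2.trans ?_⟩
  have h3 : ∫ y, (∫ x in Ioi (0 : ℝ), F (x, y)) ∂ρ = ∫ ω, (∫ x in Ioi (0 : ℝ), F (x, Y ω)) ∂ν :=
    integral_map hYm hFi.integral_prod_right.aestronglyMeasurable
  rw [h3]
  refine integral_congr_ae ?_
  filter_upwards [hY0] with ω hω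
  rw [← intervalIntegral_overshoot hz0, ← setIntegral_Ioi_ite_le hω]
  refine setIntegral_congr_fun measurableSet_Ioi fun x _ => ?_
  dsimp only [F]
  split_ifs with hx
  · rw [max_eq_left (by linarith)]
    push_cast
    rfl
  · rw [max_eq_right (by linarith)]
    simp

/-! ### The derivative of the transform -/

theorem nonneg_subset_integrableExpSet {ν : Measure Ω} [IsProbabilityMeasure ν] {R : Ω → ℝ}
    (hR : AEMeasurable R ν) (hR0 : ∀ᵐ ω ∂ν, R ω ≤ 0) : Ici 0 ⊆ integrableExpSet R ν := by
  intro t ht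
  refine Integrable.of_bound (C := 1) (by fun_prop) ?_
  filter_upwards [hR0] with ω hω
  rw [Real.norm_eq_abs, Real.abs_exp, Real.exp_le_one_iff]
  exact mul_nonpos_of_nonneg_of_nonpos ht hω

theorem mem_interior_integrableExpSet {ν : Measure Ω} [IsProbabilityMeasure ν] {R : Ω → ℝ}
    (hR : AEMeasurable R ν) (hR0 : ∀ᵐ ω ∂ν, R ω ≤ 0) {t : ℝ} (ht : 0 < t) :
    t ∈ interior (integrableExpSet R ν) :=
  interior_mono (nonneg_subset_integrableExpSet hR hR0) (by rw [interior_Ici]; exact ht)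

theorem integrable_cexp_mul {ν : Measure Ω} [IsProbabilityMeasure ν] {R : Ω → ℝ}
    (hR : AEMeasurable R ν) (hR0 : ∀ᵐ ω ∂ν, R ω ≤ 0) {z : ℂ} (hz : 0 ≤ z.re) :
    Integrable (fun ω => Complex.exp (z * R ω)) ν := by
  refine Integrable.of_bound (C := 1) (by fun_prop) ?_
  filter_upwards [hR0] with ω hω
  have := norm_cexp_neg_mul_le_one hz (y := -R ω) (by linarith)
  simpa using this

end MAPQueue

namespace MAPQueue

variable {Ω : Type*} [MeasurableSpace Ω] {μ : Measure Ω} {d : ℕ} {J : ℝ≥0 → Ω → Fin d}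
  {X : ℝ≥0 → Ω → ℝ} {T : Ω → ℝ} {i : Fin d}

/-! ### The function `OmBar` -/

theorem OmBar_eq_integral [IsProbabilityMeasure (lawFrom μ J i)]
    (hR : Integrable (fun ω => runInf X (T ω).toNNReal ω) (lawFrom μ J i))
    (hR0 : ∀ᵐ ω ∂(lawFrom μ J i), runInf X (T ω).toNNReal ω ≤ 0) {z : ℂ} (hz : 0 ≤ z.re) :
    OmBar μ X J T i z = ∫ ω, (∫ y in (0 : ℝ)..(-runInf X (T ω).toNNReal ω),
      Complex.exp (-z * y)) ∂(lawFrom μ J i) := by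
  unfold OmBar
  split_ifs with h0
  · subst h0
    simp only [neg_zero, zero_mul, Complex.exp_zero, intervalIntegral.integral_const, sub_zero,
      Complex.real_smul, mul_one]
    rw [integral_complex_ofReal, integral_neg]
  · simp only [intervalIntegral_cexp_neg_mul h0, Complex.ofReal_neg, neg_mul_neg]
    rw [integral_div, integral_sub (integrable_const _)
      (integrable_cexp_mul hR.aestronglyMeasurable.aemeasurable hR0 hz)]
    simp [Om]

/-- `Om` is the complex moment generating function of a nonpositive variable, hence analytic in the
right half-plane; the rest is the quotient rule away from `0`. -/
theorem hasDerivAt_OmBar [IsProbabilityMeasure (lawFrom μ J i)]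
    (hR : AEMeasurable (fun ω => runInf X (T ω).toNNReal ω) (lawFrom μ J i))
    (hR0 : ∀ᵐ ω ∂(lawFrom μ J i), runInf X (T ω).toNNReal ω ≤ 0) {z : ℂ} (hz : 0 < z.re) :
    HasDerivAt (OmBar μ X J T i)
      ((-(∫ ω, (runInf X (T ω).toNNReal ω : ℂ) *
        Complex.exp (z * runInf X (T ω).toNNReal ω) ∂(lawFrom μ J i)) * z -
        (1 - Om μ X J T i z) * 1) / z ^ 2) z := by
  have hz0 : z ≠ 0 := by rintro rfl; simp at hz
  have h1 : HasDerivAt (Om μ X J T i) _ z :=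
    hasDerivAt_complexMGF (mem_interior_integrableExpSet hR hR0 hz)
  have h2 := (h1.const_sub 1).div (hasDerivAt_id z) hz0
  refine h2.congr_of_eventuallyEq ?_
  filter_upwards [isOpen_ne.mem_nhds hz0] with w hw
  simp [OmBar, if_neg hw]

/-- With `Y` the negated running infimum, `z OmBar'(z) = E Y exp(-zY) - OmBar(z)`, so the left
bracket is `E Y + E Y exp(-zY) - 2 OmBar(z)`: the mean of `intervalIntegral_overshoot` at `y = Y`,
times `z ^ 2`. -/
theorem OmBar_combination [IsProbabilityMeasure (lawFrom μ J i)]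
    (hR : Integrable (fun ω => runInf X (T ω).toNNReal ω) (lawFrom μ J i))
    (hR0 : ∀ᵐ ω ∂(lawFrom μ J i), runInf X (T ω).toNNReal ω ≤ 0) {z : ℂ} (hz : 0 < z.re) :
    1 / z ^ 2 * (OmBar μ X J T i 0 - OmBar μ X J T i z + z * deriv (OmBar μ X J T i) z) =
      ∫ ω, (((-runInf X (T ω).toNNReal ω : ℝ) : ℂ) / z ^ 2 *
          (1 + Complex.exp (-z * (-runInf X (T ω).toNNReal ω : ℝ))) -
        2 / z ^ 3 * (1 - Complex.exp (-z * (-runInf X (T ω).toNNReal ω : ℝ)))) ∂(lawFrom μ J i) := by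
  have hz0 : z ≠ 0 := by rintro rfl; simp at hz
  have hRm := hR.aestronglyMeasurable.aemeasurable
  rw [(hasDerivAt_OmBar hRm hR0 hz).deriv]
  set R := fun ω => runInf X (T ω).toNNReal ω with hRdef
  have hexp := integrable_cexp_mul hRm hR0 hz.le
  have hRexp : Integrable (fun ω => (R ω : ℂ) * Complex.exp (z * R ω)) (lawFrom μ J i) := by
    refine hR.norm.mono' (by fun_prop) ?_
    filter_upwards [hR0] with ω hω
    rw [norm_mul, Complex.norm_real]
    have := norm_cexp_neg_mul_le_one hz.le (y := -R ω) (by simpa [hRdef] using hω)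
    simp only [Complex.ofReal_neg, neg_mul_neg] at this
    exact mul_le_of_le_one_right (norm_nonneg _) this
  have hRc : Integrable (fun ω => (R ω : ℂ)) (lawFrom μ J i) := hR.ofReal
  have e1 : OmBar μ X J T i 0 = -∫ ω, (R ω : ℂ) ∂(lawFrom μ J i) := by
    rw [OmBar, if_pos rfl, Complex.ofReal_neg, integral_complex_ofReal]
  have e2 : OmBar μ X J T i z = (1 - Om μ X J T i z) / z := by rw [OmBar, if_neg hz0]
  have e3 : ∀ ω, (((-R ω : ℝ) : ℂ) / z ^ 2 * (1 + Complex.exp (-z * (-R ω : ℝ))) -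
      2 / z ^ 3 * (1 - Complex.exp (-z * (-R ω : ℝ)))) =
      (-1 / z ^ 2) * ((R ω : ℂ) + (R ω : ℂ) * Complex.exp (z * R ω)) -
        2 / z ^ 3 * (1 - Complex.exp (z * R ω)) := by
    intro ω
    simp only [Complex.ofReal_neg, neg_mul_neg]
    ring
  have e4 : Om μ X J T i z = ∫ ω, Complex.exp (z * R ω) ∂(lawFrom μ J i) := rfl
  have e5 : ∫ ω, (((-R ω : ℝ) : ℂ) / z ^ 2 * (1 + Complex.exp (-z * (-R ω : ℝ))) -
      2 / z ^ 3 * (1 - Complex.exp (-z * (-R ω : ℝ)))) ∂(lawFrom μ J i) =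
      (-1 / z ^ 2) * (∫ ω, (R ω : ℂ) ∂(lawFrom μ J i) +
        ∫ ω, (R ω : ℂ) * Complex.exp (z * R ω) ∂(lawFrom μ J i)) -
        2 / z ^ 3 * (1 - Om μ X J T i z) := by
    simp only [e3]
    have i1 : Integrable (fun ω => (-1 / z ^ 2) * ((R ω : ℂ) + (R ω : ℂ) *
        Complex.exp (z * R ω))) (lawFrom μ J i) := (hRc.add hRexp).const_mul _
    have i2 : Integrable (fun ω => 2 / z ^ 3 * (1 - Complex.exp (z * R ω))) (lawFrom μ J i) :=
      ((integrable_const _).sub hexp).const_mul _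
    rw [integral_sub i1 i2, integral_const_mul, integral_const_mul, integral_add hRc hRexp,
      integral_sub (integrable_const _) hexp, e4]
    simp
  rw [e1, e2]
  refine Eq.trans ?_ e5.symm
  field_simp
  ring

/-! ### The law of the stationary workload -/

section Density

variable {Q₀ : Ω → ℝ} {p : Fin d → ℝ → ℝ} {ζ : Fin d → Fin d → ℂ} {η : Fin d → ℂ}

theorem aemeasurable_density (hexpand : ∀ i, ∀ x : ℝ, 0 < x →
    (p i x : ℂ) = ∑ j, ζ i j * Complex.exp (-η j * x)) (i : Fin d) :
    AEMeasurable (p i) (volume.restrict (Ioi 0)) := by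
  have h : Measurable fun x : ℝ => (∑ j, ζ i j * Complex.exp (-η j * x)).re := by fun_prop
  refine h.aemeasurable.congr ?_
  filter_upwards [ae_restrict_mem measurableSet_Ioi] with x hx
  rw [← hexpand i x hx, Complex.ofReal_re]

/-- The condition `g 0 = 0` removes a possible atom at `0`, leaving the density on the positive
half-line. -/
theorem integral_comp_workload (hQ : Measurable Q₀) (hQ0 : ∀ᵐ ω ∂μ, 0 ≤ Q₀ ω)
    (hp : IsWorkloadDensity μ J Q₀ p) (hpm : ∀ i, AEMeasurable (p i) (volume.restrict (Ioi 0)))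
    {g : ℝ → ℝ} (hg : Measurable g) (hg0 : g 0 = 0) (i : Fin d) :
    ∫ ω in J 0 ⁻¹' {i}, g (Q₀ ω) ∂μ = ∫ x in Ioi (0 : ℝ), p i x * g x := by
  have h1 : ∫ ω in J 0 ⁻¹' {i}, g (Q₀ ω) ∂μ =
      ∫ ω in J 0 ⁻¹' {i}, (Ioi 0).indicator g (Q₀ ω) ∂μ := by
    refine integral_congr_ae ?_
    filter_upwards [ae_restrict_of_ae hQ0] with ω hω
    rcases hω.eq_or_lt with h | h
    · rw [← h, hg0]; simp
    · rw [indicator_of_mem (show Q₀ ω ∈ Ioi 0 from h)]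
  have hgm : Measurable ((Ioi 0).indicator g) := hg.indicator measurableSet_Ioi
  rw [h1, ← integral_map (φ := Q₀) (f := (Ioi 0).indicator g) hQ.aemeasurable
    hgm.aestronglyMeasurable, integral_indicator measurableSet_Ioi, (hp i).2,
    integral_withDensity_eq_integral_toReal_smul₀ (hpm i).ennreal_ofReal
      (Eventually.of_forall fun _ => ENNReal.ofReal_lt_top)]
  refine setIntegral_congr_fun measurableSet_Ioi fun x hx => ?_
  simp only [ENNReal.toReal_ofReal ((hp i).1 x hx), smul_eq_mul]

theorem exists_rate_bound (hη : ∀ j, 0 < (η j).re) : ∃ c > 0, ∀ j, c ≤ (η j).re := by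
  rcases isEmpty_or_nonempty (Fin d) with h | h
  · exact ⟨1, one_pos, fun j => h.elim j⟩
  · obtain ⟨j, hj⟩ := Finite.exists_min fun j => (η j).re
    exact ⟨(η j).re, hη j, hj⟩

theorem density_le (hp : IsWorkloadDensity μ J Q₀ p) (hexpand : ∀ i, ∀ x : ℝ, 0 < x →
    (p i x : ℂ) = ∑ j, ζ i j * Complex.exp (-η j * x)) {c : ℝ} (hc : ∀ j, c ≤ (η j).re)
    (i : Fin d) {x : ℝ} (hx : 0 < x) :
    p i x ≤ (∑ j, ‖ζ i j‖) * Real.exp (-c * x) := by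
  have h1 : p i x = ‖(p i x : ℂ)‖ := by
    rw [Complex.norm_real, Real.norm_eq_abs, abs_of_nonneg ((hp i).1 x hx)]
  rw [h1, hexpand i x hx, Finset.sum_mul]
  refine (norm_sum_le _ _).trans (Finset.sum_le_sum fun j _ => ?_)
  rw [norm_mul, norm_cexp_neg_mul]
  gcongr
  exact hc j

theorem integrable_exp_workload_restrict [IsFiniteMeasure μ] (hQ : Measurable Q₀)
    (hp : IsWorkloadDensity μ J Q₀ p) (hexpand : ∀ i, ∀ x : ℝ, 0 < x →
    (p i x : ℂ) = ∑ j, ζ i j * Complex.exp (-η j * x)) {c : ℝ} (hc0 : 0 < c)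
    (hc : ∀ j, c ≤ (η j).re) (i : Fin d) :
    Integrable (fun ω => Real.exp (c / 2 * Q₀ ω)) (μ.restrict (J 0 ⁻¹' {i})) := by
  refine ⟨by fun_prop, ?_⟩
  have hg : Measurable fun x : ℝ => ENNReal.ofReal (Real.exp (c / 2 * x)) := by fun_prop
  have hpm := (aemeasurable_density hexpand i).ennreal_ofReal
  have hIoi : ∫⁻ x in Ioi (0 : ℝ), ENNReal.ofReal (Real.exp (c / 2 * x))
      ∂((μ.restrict (J 0 ⁻¹' {i})).map Q₀) < ∞ := by
    rw [(hp i).2, lintegral_withDensity_eq_lintegral_mul₀ hpm hg.aemeasurable]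
    -- The density decays at rate `c`; an exponential moment of order `c / 2` leaves the rate `c /
    -- 2` for integrability.
    have h1 : IntegrableOn (fun x : ℝ => (∑ j, ‖ζ i j‖) * Real.exp (-(c / 2) * x)) (Ioi 0) :=
      (integrableOn_exp_mul_Ioi (by linarith) 0).const_mul _
    refine lt_of_le_of_lt (setLIntegral_mono (by fun_prop) fun x hx => ?_) h1.lintegral_lt_top
    rw [Pi.mul_apply, ← ENNReal.ofReal_mul ((hp i).1 x hx)]
    refine ENNReal.ofReal_le_ofReal ?_
    calc p i x * Real.exp (c / 2 * x)
        ≤ (∑ j, ‖ζ i j‖) * Real.exp (-c * x) * Real.exp (c / 2 * x) := by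
          gcongr; exact density_le hp hexpand hc i hx
      _ = (∑ j, ‖ζ i j‖) * Real.exp (-(c / 2) * x) := by
          rw [mul_assoc, ← Real.exp_add]; ring_nf
  have hIic : ∫⁻ x in Iic (0 : ℝ), ENNReal.ofReal (Real.exp (c / 2 * x))
      ∂((μ.restrict (J 0 ⁻¹' {i})).map Q₀) < ∞ := by
    have : IsFiniteMeasure ((μ.restrict (J 0 ⁻¹' {i})).map Q₀) := inferInstance
    refine lt_of_le_of_lt (setLIntegral_mono (g := fun _ => 1) measurable_const fun x hx => ?_) ?_
    · rw [← ENNReal.ofReal_one]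
      refine ENNReal.ofReal_le_ofReal (Real.exp_le_one_iff.2 ?_)
      exact mul_nonpos_of_nonneg_of_nonpos (by linarith) hx
    · rw [setLIntegral_const, one_mul]
      exact measure_lt_top _ _
  have e : ∫⁻ ω in J 0 ⁻¹' {i}, ‖Real.exp (c / 2 * Q₀ ω)‖ₑ ∂μ =
      ∫⁻ x, ENNReal.ofReal (Real.exp (c / 2 * x)) ∂((μ.restrict (J 0 ⁻¹' {i})).map Q₀) := by
    rw [lintegral_map hg hQ]
    refine lintegral_congr fun ω => ?_
    rw [Real.enorm_eq_ofReal_abs, Real.abs_exp]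
  rw [HasFiniteIntegral, e, ← lintegral_add_compl _ (measurableSet_Ioi (a := (0 : ℝ))), compl_Ioi]
  exact ENNReal.add_lt_top.2 ⟨hIoi, hIic⟩

/-- The set of admissible exponents is convex and contains `-c` and `1`. With `0` in its interior,
the transforms are analytic there and their derivatives are moments. -/
theorem zero_mem_interior_integrableExpSet {ν : Measure Ω} [IsFiniteMeasure ν] (hQ : Measurable Q₀)
    (hQ0 : ∀ᵐ ω ∂ν, 0 ≤ Q₀ ω) {c : ℝ} (hc : 0 < c)
    (h : Integrable (fun ω => Real.exp (c * Q₀ ω)) ν) :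
    (0 : ℝ) ∈ interior (integrableExpSet (fun ω => -Q₀ ω) ν) := by
  have h1 : -c ∈ integrableExpSet (fun ω => -Q₀ ω) ν := by
    change Integrable (fun ω => Real.exp (-c * -Q₀ ω)) ν
    simpa using h
  have h2 : (1 : ℝ) ∈ integrableExpSet (fun ω => -Q₀ ω) ν := by
    refine Integrable.of_bound (C := 1) (by fun_prop) ?_
    filter_upwards [hQ0] with ω hω
    rw [Real.norm_eq_abs, Real.abs_exp, Real.exp_le_one_iff]
    linarith
  have h3 := convex_integrableExpSet.ordConnected.out h1 h2
  refine interior_mono h3 ?_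
  rw [interior_Icc]
  exact ⟨by linarith, one_pos⟩

theorem integrable_exp_workload [IsFiniteMeasure μ] {c : ℝ}
    (h : ∀ i, Integrable (fun ω => Real.exp (c * Q₀ ω)) (μ.restrict (J 0 ⁻¹' {i}))) :
    Integrable (fun ω => Real.exp (c * Q₀ ω)) μ := by
  have hU : (univ : Set Ω) = ⋃ i ∈ (Finset.univ : Finset (Fin d)), J 0 ⁻¹' {i} := by
    ext ω; simp
  rw [← integrableOn_univ, hU, integrableOn_finset_iUnion]
  exact fun i _ => h i

end Density

end MAPQueue

namespace MAPQueue

variable {Ω : Type*} [MeasurableSpace Ω] {μ : Measure Ω} {d : ℕ}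

/-! ### Decomposition along the initial state -/

theorem setIntegral_eq_mul_integral_cond [IsFiniteMeasure μ] {s : Set Ω} (hs0 : μ s ≠ 0)
    (f : Ω → ℝ) : ∫ ω in s, f ω ∂μ = μ.real s * ∫ ω, f ω ∂(cond μ s) := by
  rw [ProbabilityTheory.cond, integral_smul_measure, smul_eq_mul, ← mul_assoc, measureReal_def, ENNReal.toReal_inv,
    mul_inv_cancel₀, one_mul]
  exact ENNReal.toReal_ne_zero.2 ⟨hs0, measure_ne_top _ _⟩

theorem integral_eq_sum_states {J₀ : Ω → Fin d} (hJ : Measurable J₀) {f : Ω → ℝ}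
    (hf : Integrable f μ) : ∫ ω, f ω ∂μ = ∑ i, ∫ ω in J₀ ⁻¹' {i}, f ω ∂μ := by
  have hU : (univ : Set Ω) = ⋃ i, J₀ ⁻¹' {i} := by
    ext ω; simp
  rw [← setIntegral_univ, hU]
  refine integral_iUnion_fintype (fun i => hJ (measurableSet_singleton i)) ?_
    fun i => hf.integrableOn
  intro a b hab
  exact Set.disjoint_left.2 fun ω h1 h2 => hab (Eq.trans (Eq.symm h1) h2)

/-- Freezing the first of two independent random variables. -/
theorem integral_mul_overshoot_of_indepFun {ν : Measure Ω} [IsProbabilityMeasure ν] {Q Y : Ω → ℝ}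
    (hQ : Measurable Q) (hQ0 : ∀ᵐ ω ∂ν, 0 ≤ Q ω) (hQi : Integrable Q ν) (hYi : Integrable Y ν)
    (hQY : IndepFun Q Y ν) :
    Integrable (fun ω => Q ω * max (Y ω - Q ω) 0) ν ∧
    ∫ ω, Q ω * max (Y ω - Q ω) 0 ∂ν = ∫ ω, Q ω * ∫ ω', max (Y ω' - Q ω) 0 ∂ν ∂ν := by
  have hYm := hYi.aestronglyMeasurable.aemeasurable
  have hint : Integrable (fun ω => Q ω * max (Y ω - Q ω) 0) ν := by
    refine (hQY.integrable_mul hQi hYi).norm.mono' (by fun_prop) ?_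
    filter_upwards [hQ0] with ω hω
    rw [Pi.mul_apply, norm_mul, norm_mul]
    gcongr
    rw [Real.norm_eq_abs, Real.norm_eq_abs, abs_of_nonneg (le_max_right _ _)]
    exact max_le ((sub_le_self _ hω).trans (le_abs_self _)) (abs_nonneg _)
  refine ⟨hint, ?_⟩
  have e := (indepFun_iff_map_prod_eq_prod_map_map hQ.aemeasurable hYm).1 hQY
  have := Measure.isProbabilityMeasure_map (μ := ν) hQ.aemeasurable
  have := Measure.isProbabilityMeasure_map (μ := ν) hYm
  have hprod : Integrable (fun p : ℝ × ℝ => p.1 * max (p.2 - p.1) 0) ((ν.map Q).prod (ν.map Y)) := by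
    rw [← e]
    exact (integrable_map_measure (by fun_prop) (by fun_prop)).2 hint
  have h1 : ∫ ω, Q ω * max (Y ω - Q ω) 0 ∂ν =
      ∫ x, ∫ y, x * max (y - x) 0 ∂(ν.map Y) ∂(ν.map Q) := by
    rw [← integral_prod (f := fun p : ℝ × ℝ => p.1 * max (p.2 - p.1) 0) hprod, ← e,
      integral_map (by fun_prop) (by fun_prop)]
  rw [h1, integral_map hQ.aemeasurable hprod.integral_prod_left.aestronglyMeasurable]
  refine integral_congr_ae (Eventually.of_forall fun ω => ?_)
  dsimp only
  rw [integral_const_mul, integral_map hYm (f := fun y => max (y - Q ω) 0) (by fun_prop)]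

theorem measurable_mul_integral_overshoot {ν : Measure Ω} [IsProbabilityMeasure ν] {Y : Ω → ℝ}
    (hYm : AEMeasurable Y ν) : Measurable fun x : ℝ => x * ∫ ω, max (Y ω - x) 0 ∂ν := by
  have := Measure.isProbabilityMeasure_map (μ := ν) hYm
  have h1 : Measurable fun p : ℝ × ℝ => max (p.2 - p.1) 0 := by fun_prop
  have h2 : Measurable fun x : ℝ => ∫ y, max (y - x) 0 ∂(ν.map Y) :=
    (h1.stronglyMeasurable.integral_prod_right (ν := ν.map Y)).measurable
  have h3 : (fun x : ℝ => x * ∫ ω, max (Y ω - x) 0 ∂ν) =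
      fun x : ℝ => x * ∫ y, max (y - x) 0 ∂(ν.map Y) := by
    ext x
    rw [integral_map hYm (f := fun y => max (y - x) 0) (by fun_prop)]
  rw [h3]
  exact measurable_id.mul h2

/-! ### Laws and independence given the initial state -/

section Laws

variable {q : Matrix (Fin d) (Fin d) ℝ} {J : ℝ≥0 → Ω → Fin d} {L : Fin d → ℝ≥0 → Ω → ℝ}
  {U : ℕ → Fin d → Fin d → Ω → ℝ} {X : ℝ≥0 → Ω → ℝ} {T Q₀ : Ω → ℝ} {ϑ : ℝ}

/-- Stationarity of the pair makes the law of the background state constant in time. Conditioning on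
a null event would give the zero measure, so this underlies every use of `lawFrom`. -/
theorem IsSNMAP.measure_state_ne_zero [IsProbabilityMeasure μ] (h : IsSNMAP μ q J L U X)
    (hQ : IsStationaryQueue μ X J Q₀) (i : Fin d) : μ (J 0 ⁻¹' {i}) ≠ 0 := by
  refine h.chain.measure_ne_zero_of_stationary h.rate h.irreducible (fun t i => ?_) i
  have := ((hQ.stationary t).comp measurable_snd).measure_mem_eq (measurableSet_singleton i)
  rw [measureReal_def, measureReal_def]
  exact congrArg ENNReal.toReal this

theorem hasLaw_lawFrom [IsProbabilityMeasure μ] {ρ : Measure ℝ} (hT : HasLaw T ρ μ)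
    (hQm : Measurable Q₀) (hXm : ∀ t, Measurable (X t)) (hJm : ∀ t, Measurable (J t))
    (hTindep : IndepFun T (fun ω => (Q₀ ω, (fun t => X t ω), (fun t => J t ω))) μ)
    {i : Fin d} (hi : μ (J 0 ⁻¹' {i}) ≠ 0) :
    HasLaw T ρ (lawFrom μ J i) ∧
      IndepFun T (fun ω => (Q₀ ω, (fun t => X t ω), (fun t => J t ω))) (lawFrom μ J i) := by
  let Z : Ω → ℝ × (ℝ≥0 → ℝ) × (ℝ≥0 → Fin d) := fun ω =>
    (Q₀ ω, (fun t => X t ω), (fun t => J t ω))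
  let B : Set (ℝ × (ℝ≥0 → ℝ) × (ℝ≥0 → Fin d)) := (fun z => z.2.2 0) ⁻¹' {i}
  have hZ : Measurable Z :=
    hQm.prodMk ((measurable_pi_lambda _ hXm).prodMk (measurable_pi_lambda _ hJm))
  have hB : MeasurableSet B :=
    ((measurable_pi_apply 0).comp (measurable_snd.comp measurable_snd)) (measurableSet_singleton i)
  have hpre : J 0 ⁻¹' {i} = Z ⁻¹' B := rfl
  have hT' : AEMeasurable T (lawFrom μ J i) := hT.aemeasurable.mono_ac cond_absolutelyContinuous
  rw [hpre] at hi
  unfold lawFrom at hT' ⊢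
  rw [hpre] at hT' ⊢
  refine ⟨⟨hT', ?_⟩, indepFun_cond_preimage hZ hTindep hB hi⟩
  rw [← hT.map_eq]
  ext s hs
  rw [Measure.map_apply_of_aemeasurable hT' hs,
    Measure.map_apply_of_aemeasurable hT.aemeasurable hs]
  exact cond_preimage_of_indepFun hZ hTindep hB hi hs

/-- Under P_i the time is independent of `(Q₀, X)` and `Q₀` of `X`, so `Q₀` is independent of the
pair `(T, X)` and of measurable functions of it. -/
theorem IsSNMAP.indepFun_workload_randomTime [IsProbabilityMeasure μ] (h : IsSNMAP μ q J L U X)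
    (hQ : IsStationaryQueue μ X J Q₀) {ρ : Measure ℝ} (hT : HasLaw T ρ μ)
    (hTindep : IndepFun T (fun ω => (Q₀ ω, (fun t => X t ω), (fun t => J t ω))) μ) (i : Fin d) :
    IndepFun Q₀ (fun ω => X (T ω).toNNReal ω) (lawFrom μ J i) ∧
      IndepFun Q₀ (fun ω => runInf X (T ω).toNNReal ω) (lawFrom μ J i) := by
  have hi := h.measure_state_ne_zero hQ i
  have : IsProbabilityMeasure (lawFrom μ J i) := cond_isProbabilityMeasure hi
  obtain ⟨hT', hind⟩ := hasLaw_lawFrom hT hQ.measurable h.measurable h.chain.measurable hTindep hi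
  have h1 : IndepFun T (fun ω => (Q₀ ω, fun t => X t ω)) (lawFrom μ J i) :=
    hind.comp measurable_id (measurable_fst.prodMk measurable_snd.fst)
  have h2 : IndepFun Q₀ (fun ω t => X t ω) (lawFrom μ J i) :=
    (hQ.condIndep i).comp measurable_id measurable_fst
  have h3 := indepFun_prodMk_of_indepFun hT'.aemeasurable hQ.measurable h.measurable_path h1 h2
  have hm : Measurable fun p : ℝ × (ℝ≥0 → ℝ) => (p.1.toNNReal, p.2) := by fun_prop
  have hae : ∀ᵐ ω ∂(lawFrom μ J i), pathEval ((T ω).toNNReal, fun t => X t ω) =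
      X (T ω).toNNReal ω ∧ pathInf ((T ω).toNNReal, fun t => X t ω) =
        runInf X (T ω).toNNReal ω :=
    cond_absolutelyContinuous.ae_le h.ae_randomTime_eq
  exact ⟨(h3.comp measurable_id (measurable_pathEval.comp hm)).congr .rfl
      (hae.mono fun ω hω => hω.1),
    (h3.comp measurable_id (measurable_pathInf.comp hm)).congr .rfl (hae.mono fun ω hω => hω.2)⟩

/-- The Laplace transform of a first passage time is the probability that an independent exponential
time exceeds it. -/
theorem IsSNMAP.xi_eq [IsProbabilityMeasure μ] (h : IsSNMAP μ q J L U X)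
    (hQ : IsStationaryQueue μ X J Q₀) (hϑ : 0 < ϑ) (hT : HasLaw T (expMeasure ϑ) μ)
    (hTindep : IndepFun T (fun ω => (Q₀ ω, (fun t => X t ω), (fun t => J t ω))) μ) (i : Fin d)
    (y : ℝ) :
    xi μ X J ϑ i y = (lawFrom μ J i).real {ω | y ≤ -runInf X (T ω).toNNReal ω} := by
  have hi := h.measure_state_ne_zero hQ i
  have : IsProbabilityMeasure (lawFrom μ J i) := cond_isProbabilityMeasure hi
  have := isProbabilityMeasure_expMeasure hϑ
  obtain ⟨hT', hind⟩ := hasLaw_lawFrom hT hQ.measurable h.measurable h.chain.measurable hTindep hi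
  have hm : Measurable fun p : ℝ × (ℝ≥0 → ℝ) => (p.1.toNNReal, p.2) := by fun_prop
  have hS : MeasurableSet {p : ℝ × (ℝ≥0 → ℝ) | pathInf (p.1.toNNReal, p.2) ≤ -y} :=
    measurableSet_le (measurable_pathInf.comp hm) measurable_const
  have h1 := measure_comp_of_indepFun hT' h.measurable_path
    (hind.comp measurable_id measurable_snd.fst) hS
  have hac : lawFrom μ J i ≪ μ := cond_absolutelyContinuous
  have h2 : (lawFrom μ J i).real {ω | y ≤ -runInf X (T ω).toNNReal ω} = (lawFrom μ J i).real
      {ω | (T ω, fun t => X t ω) ∈ {p : ℝ × (ℝ≥0 → ℝ) | pathInf (p.1.toNNReal, p.2) ≤ -y}} := by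
    refine measureReal_congr ?_
    filter_upwards [hac.ae_le (h.ae_randomTime_eq (T := T))] with ω hω
    refine propext ?_
    change y ≤ -runInf X (T ω).toNNReal ω ↔ pathInf ((T ω).toNNReal, fun t => X t ω) ≤ -y
    rw [hω.2]
    exact le_neg
  rw [h2, h1, xi]
  refine integral_congr_ae ?_
  filter_upwards [hac.ae_le h.ae_isRegularPath] with ω hω
  have h3 : {t : ℝ | pathInf (t.toNNReal, fun t => X t ω) ≤ -y} =
      {t : ℝ | tau X y ω ≤ t.toNNReal} := by
    ext t
    change pathInf (t.toNNReal, fun t => X t ω) ≤ -y ↔ _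
    rw [hω.1.pathInf_eq]
    exact hω.1.iInf_le_neg_iff y t.toNNReal
  change _ = (expMeasure ϑ).real {t : ℝ | pathInf (t.toNNReal, fun t => X t ω) ≤ -y}
  rw [h3]
  split_ifs with htop
  · rw [htop]
    have h4 : {t : ℝ | (∞ : ℝ≥0∞) ≤ t.toNNReal} = ∅ :=
      eq_empty_of_forall_notMem fun t ht => ENNReal.coe_ne_top (top_le_iff.1 ht)
    rw [h4, measureReal_empty]
  · obtain ⟨a, ha⟩ : ∃ a : ℝ≥0, (a : ℝ≥0∞) = tau X y ω := ⟨_, ENNReal.coe_toNNReal htop⟩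
    rw [← ha, ENNReal.coe_toReal]
    -- The value `0` is separate: `Real.toNNReal` sends negative times to `0`, so the set is then
    -- the whole line and not `Ici 0`.
    rcases eq_zero_or_pos a with rfl | hapos
    · have h4 : {t : ℝ | ((0 : ℝ≥0) : ℝ≥0∞) ≤ t.toNNReal} = univ :=
        eq_univ_of_forall fun t => by
          change ((0 : ℝ≥0) : ℝ≥0∞) ≤ _
          simp
      rw [h4, probReal_univ]
      simp
    · have h4 : {t : ℝ | (a : ℝ≥0∞) ≤ t.toNNReal} = Ici (a : ℝ) := by
        ext t
        change (a : ℝ≥0∞) ≤ t.toNNReal ↔ (a : ℝ) ≤ t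
        rw [ENNReal.coe_le_coe, Real.le_toNNReal_iff_coe_le' hapos]
      rw [h4, expMeasure_real_Ici hϑ a.coe_nonneg]

theorem kappa_eq_mgf (μ : Measure Ω) (Q₀ : Ω → ℝ) : kappa μ Q₀ = mgf (fun ω => -Q₀ ω) μ := by
  ext α
  simp only [kappa, mgf, neg_mul, mul_neg]

theorem kappaState_eq_mgf (μ : Measure Ω) (J : ℝ≥0 → Ω → Fin d) (Q₀ : Ω → ℝ) (i : Fin d) :
    kappaState μ J Q₀ i = mgf (fun ω => -Q₀ ω) (μ.restrict (J 0 ⁻¹' {i})) := by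
  ext α
  simp only [kappaState, mgf, neg_mul, mul_neg]

end Laws

end MAPQueue

/-! ### The overshoot term -/

namespace MAPQueue

variable {Ω : Type*} [MeasurableSpace Ω] {μ : Measure Ω} {d : ℕ} {J : ℝ≥0 → Ω → Fin d}
  {X : ℝ≥0 → Ω → ℝ} {T Q₀ : Ω → ℝ} {p : Fin d → ℝ → ℝ} {ζ : Fin d → Fin d → ℂ} {η : Fin d → ℂ}

/-- The contribution of the initial state `i` to `E Q₀ (-X̲_T - Q₀)⁺`. -/
theorem setIntegral_mul_overshoot [IsProbabilityMeasure μ] (hQ : Measurable Q₀)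
    (hQ0 : ∀ᵐ ω ∂μ, 0 ≤ Q₀ ω) (hp : IsWorkloadDensity μ J Q₀ p) (hη : ∀ j, 0 < (η j).re)
    (hexpand : ∀ i, ∀ x : ℝ, 0 < x → (p i x : ℂ) = ∑ j, ζ i j * Complex.exp (-η j * x))
    {i : Fin d} (hi : μ (J 0 ⁻¹' {i}) ≠ 0) (hQi : Integrable Q₀ (lawFrom μ J i))
    (hR : Integrable (fun ω => runInf X (T ω).toNNReal ω) (lawFrom μ J i))
    (hR0 : ∀ᵐ ω ∂(lawFrom μ J i), runInf X (T ω).toNNReal ω ≤ 0)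
    (hind : IndepFun Q₀ (fun ω => runInf X (T ω).toNNReal ω) (lawFrom μ J i)) :
    ((∫ ω in J 0 ⁻¹' {i}, Q₀ ω * max (-runInf X (T ω).toNNReal ω - Q₀ ω) 0 ∂μ : ℝ) : ℂ) =
      ∑ j, ζ i j / η j ^ 2 * (OmBar μ X J T i 0 - OmBar μ X J T i (η j) +
        η j * deriv (OmBar μ X J T i) (η j)) := by
  have : IsProbabilityMeasure (lawFrom μ J i) := cond_isProbabilityMeasure hi
  set Y : Ω → ℝ := fun ω => -runInf X (T ω).toNNReal ω with hY
  have hYi : Integrable Y (lawFrom μ J i) := hR.neg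
  have hY0 : ∀ᵐ ω ∂(lawFrom μ J i), 0 ≤ Y ω := hR0.mono fun ω hω => neg_nonneg.2 hω
  set φ : ℝ → ℝ := fun x => x * ∫ ω, max (Y ω - x) 0 ∂(lawFrom μ J i) with hφ
  have hφm : Measurable φ :=
    measurable_mul_integral_overshoot hYi.aestronglyMeasurable.aemeasurable
  -- By independence under P_i the variable `Y` can be averaged out first; `φ` vanishes at `0`, so
  -- the density then takes over.
  have h1 : ∫ ω in J 0 ⁻¹' {i}, Q₀ ω * max (Y ω - Q₀ ω) 0 ∂μ =
      ∫ ω in J 0 ⁻¹' {i}, φ (Q₀ ω) ∂μ := by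
    rw [setIntegral_eq_mul_integral_cond hi, setIntegral_eq_mul_integral_cond hi]
    congr 1
    exact (integral_mul_overshoot_of_indepFun (ν := lawFrom μ J i) hQ (cond_absolutelyContinuous.ae_le hQ0) hQi hYi
      (hind.comp measurable_id measurable_neg)).2
  have h2 := integral_comp_workload hQ hQ0 hp (aemeasurable_density hexpand) hφm (by simp [hφ]) i
  have h3 : ((∫ x in Ioi (0 : ℝ), p i x * φ x : ℝ) : ℂ) =
      ∫ x in Ioi (0 : ℝ), ∑ j, ζ i j * (Complex.exp (-η j * x) * (φ x : ℂ)) := by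
    rw [← integral_complex_ofReal]
    refine setIntegral_congr_fun measurableSet_Ioi fun x hx => ?_
    rw [Complex.ofReal_mul, hexpand i x hx, Finset.sum_mul]
    simp only [mul_assoc]
  have hover := fun j => integral_cexp_mul_overshoot hY0 hYi (hη j)
  have h4 : ∫ x in Ioi (0 : ℝ), ∑ j, ζ i j * (Complex.exp (-η j * x) * (φ x : ℂ)) =
      ∑ j, ζ i j * ∫ x in Ioi (0 : ℝ), Complex.exp (-η j * x) * (φ x : ℂ) := by
    rw [integral_finsetSum _ fun j _ => (hover j).1.const_mul (ζ i j)]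
    exact Finset.sum_congr rfl fun j _ => integral_const_mul _ _
  rw [h1, h2, h3, h4]
  refine Finset.sum_congr rfl fun j _ => ?_
  rw [(hover j).2, ← OmBar_combination hR hR0 (hη j)]
  ring

end MAPQueue

/-! ### The covariance formula -/

theorem theorem4 {Ω : Type*} [MeasurableSpace Ω] (μ : Measure Ω) [IsProbabilityMeasure μ] (d : ℕ)
    -- the spectrally negative Markov additive input and its stability
    (q : Matrix (Fin d) (Fin d) ℝ) (J : ℝ≥0 → Ω → Fin d) (L : Fin d → ℝ≥0 → Ω → ℝ)
    (U : ℕ → Fin d → Fin d → Ω → ℝ) (X : ℝ≥0 → Ω → ℝ) (hX : IsSNMAP μ q J L U X)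
    (π : Fin d → ℝ) (hπ : IsStationaryDist q π) (hstable : IsStableInput μ q π L U)
    -- the stationary queue
    (Q₀ : Ω → ℝ) (hQ : IsStationaryQueue μ X J Q₀)
    -- the independent exponential time
    (ϑ : ℝ) (hϑ : 0 < ϑ) (T : Ω → ℝ) (hT : HasLaw T (expMeasure ϑ) μ)
    (hTindep : IndepFun T (fun ω => (Q₀ ω, (fun t => X t ω), (fun t => J t ω))) μ)
    -- the expansion of the stationary density
    (p : Fin d → ℝ → ℝ) (hp : IsWorkloadDensity μ J Q₀ p)
    (ζ : Fin d → Fin d → ℂ) (η : Fin d → ℂ) (hη : ∀ j, 0 < (η j).re)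
    (hexpand : ∀ i, ∀ x : ℝ, 0 < x → (p i x : ℂ) = ∑ j, ζ i j * Complex.exp (-η j * x)) :
    -- all quantities in the formula are well defined
    (MemLp Q₀ 2 μ ∧ MemLp (workloadAt X Q₀ T) 2 μ ∧
      ContDiffAt ℝ 2 (kappa μ Q₀) 0 ∧
      (∀ i, DifferentiableAt ℝ (kappaState μ J Q₀ i) 0) ∧
      (∀ i, Integrable (fun ω => X (T ω).toNNReal ω) (lawFrom μ J i)) ∧
      (∀ i j, DifferentiableAt ℂ (OmBar μ X J T i) (η j))) ∧
    -- `OmBar` is the transform of `xi`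
    (∀ i, ∀ z : ℂ, 0 ≤ z.re →
      IntegrableOn (fun y : ℝ => Complex.exp (-z * y) * (xi μ X J ϑ i y : ℂ)) (Ioi 0) ∧
      ∫ y in Ioi (0 : ℝ), Complex.exp (-z * y) * (xi μ X J ϑ i y : ℂ) = OmBar μ X J T i z) ∧
    -- the formula for the covariance
    (gamma μ X Q₀ T : ℂ) =
      ((iteratedDeriv 2 (kappa μ Q₀) 0 - deriv (kappa μ Q₀) 0 ^ 2 : ℝ) : ℂ)
        + ∑ i, ∑ j, ζ i j / η j ^ 2 *
            (OmBar μ X J T i 0 - OmBar μ X J T i (η j) + η j * deriv (OmBar μ X J T i) (η j))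
        - ((∑ i, nu μ X J T i * deriv (kappaState μ J Q₀ i) 0 : ℝ) : ℂ) := by
  have hJ0 : Measurable (J 0) := hX.chain.measurable 0
  have hQm := hQ.measurable
  have hQ0 := hQ.nonneg
  have hstate := hX.measure_state_ne_zero hQ
  have hprob : ∀ i, IsProbabilityMeasure (lawFrom μ J i) := fun i =>
    cond_isProbabilityMeasure (hstate i)
  have hac : ∀ i, lawFrom μ J i ≪ μ := fun i => cond_absolutelyContinuous
  have hexpp := isProbabilityMeasure_expMeasure hϑ
  have hTQX : IndepFun T (fun ω => (Q₀ ω, fun t => X t ω)) μ :=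
    hTindep.comp measurable_id (measurable_fst.prodMk measurable_snd.fst)
  -- P_i is a restriction of `μ` rescaled by a finite constant, since the state has positive
  -- probability.
  have toLaw : ∀ i {f : Ω → ℝ}, Integrable f μ → Integrable f (lawFrom μ J i) := fun i f hf =>
    hf.restrict.smul_measure (ENNReal.inv_ne_top.2 (hstate i))
  -- exponential moments of the stationary workload
  obtain ⟨c, hc0, hc⟩ := exists_rate_bound hη
  have hexpi := integrable_exp_workload_restrict hQm hp hexpand hc0 hc
  have hint0 : (0 : ℝ) ∈ interior (integrableExpSet (fun ω => -Q₀ ω) μ) :=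
    zero_mem_interior_integrableExpSet hQm hQ0 (half_pos hc0) (integrable_exp_workload hexpi)
  have hint0i : ∀ i, (0 : ℝ) ∈ interior (integrableExpSet (fun ω => -Q₀ ω)
      (μ.restrict (J 0 ⁻¹' {i}))) := fun i =>
    zero_mem_interior_integrableExpSet hQm (ae_restrict_of_ae hQ0) (half_pos hc0) (hexpi i)
  have hQ2 : MemLp Q₀ 2 μ := by
    have := (memLp_of_mem_interior_integrableExpSet hint0 2).neg
    simpa [Pi.neg_def] using this
  have hQi : Integrable Q₀ μ := hQ2.integrable (by norm_num)
  have hident := hX.identDistrib_workloadAt hQ hT hTQX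
  have hQT2 : MemLp (workloadAt X Q₀ T) 2 μ := hident.memLp_iff.2 hQ2
  have hQTi : Integrable (workloadAt X Q₀ T) μ := hQT2.integrable (by norm_num)
  -- the input at time `T`
  have hR : Integrable (fun ω => runInf X (T ω).toNNReal ω) μ :=
    hX.integrable_runInf_randomTime hstable.integrable_levy hstable.integrable_jump hQ hQi hϑ hT hTQX
  have hXT : Integrable (fun ω => X (T ω).toNNReal ω) μ :=
    hX.integrable_randomTime hT.aemeasurable hQ0 hR hQTi
  have hR0 : ∀ᵐ ω ∂μ, runInf X (T ω).toNNReal ω ≤ 0 :=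
    (hX.ae_workloadAt_eq (T := T) (Q₀ := Q₀)).mono fun ω hω => hω.2.2
  have hR0i : ∀ i, ∀ᵐ ω ∂(lawFrom μ J i), runInf X (T ω).toNNReal ω ≤ 0 := fun i =>
    (hac i).ae_le hR0
  have hindep := hX.indepFun_workload_randomTime hQ hT hTindep
  have hder : ∀ i, deriv (kappaState μ J Q₀ i) 0 = -∫ ω in J 0 ⁻¹' {i}, Q₀ ω ∂μ := fun i => by
    rw [kappaState_eq_mgf, deriv_mgf_zero (hint0i i), integral_neg]
  refine ⟨⟨hQ2, hQT2, ?_, fun i => ?_, fun i => toLaw i hXT, fun i j => ?_⟩, fun i z hz => ?_, ?_⟩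
  · rw [kappa_eq_mgf]
    exact (analyticAt_mgf hint0).contDiffAt
  · rw [kappaState_eq_mgf]
    exact (analyticAt_mgf (hint0i i)).differentiableAt
  · exact (hasDerivAt_OmBar (toLaw i hR).aestronglyMeasurable.aemeasurable (hR0i i)
      (hη j)).differentiableAt
  · have h := integral_cexp_mul_tail (ν := lawFrom μ J i)
      (Y := fun ω => -runInf X (T ω).toNNReal ω)
      ((hR0i i).mono fun ω hω => neg_nonneg.2 hω) (toLaw i hR).neg hz
    simp only [hX.xi_eq hQ hϑ hT hTindep i]
    exact ⟨h.1, h.2.trans (OmBar_eq_integral (toLaw i hR) (hR0i i) hz).symm⟩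
  · have hκ1 : deriv (kappa μ Q₀) 0 = -∫ ω, Q₀ ω ∂μ := by
      rw [kappa_eq_mgf, deriv_mgf_zero hint0, integral_neg]
    have hκ2 : iteratedDeriv 2 (kappa μ Q₀) 0 = ∫ ω, Q₀ ω ^ 2 ∂μ := by
      rw [kappa_eq_mgf, iteratedDeriv_mgf_zero hint0]
      simp
    -- the mixed moment of `Q₀` and `X_T`
    have hQX : Integrable (fun ω => Q₀ ω * X (T ω).toNNReal ω) μ ∧
        Integrable (fun ω => Q₀ ω * max (-runInf X (T ω).toNNReal ω - Q₀ ω) 0) μ := by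
      have hU : (univ : Set Ω) = ⋃ i ∈ (Finset.univ : Finset (Fin d)), J 0 ⁻¹' {i} := by
        ext ω; simp
      have hrestr : ∀ i {f : Ω → ℝ}, Integrable f (lawFrom μ J i) →
          IntegrableOn f (J 0 ⁻¹' {i}) μ := by
        intro i f hf
        have h1 := hf.smul_measure (measure_ne_top μ (J 0 ⁻¹' {i}))
        rw [lawFrom, ProbabilityTheory.cond, smul_smul,
          ENNReal.mul_inv_cancel (hstate i) (measure_ne_top _ _), one_smul] at h1
        exact h1
      constructor
      · rw [← integrableOn_univ, hU, integrableOn_finset_iUnion]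
        exact fun i _ => hrestr i ((hindep i).1.integrable_mul (toLaw i hQi) (toLaw i hXT))
      · rw [← integrableOn_univ, hU, integrableOn_finset_iUnion]
        exact fun i _ => hrestr i (integral_mul_overshoot_of_indepFun hQm ((hac i).ae_le hQ0)
          (toLaw i hQi) (toLaw i hR).neg ((hindep i).2.comp measurable_id measurable_neg)).1
    -- The mean factorizes under each P_i; the sign comes from `κ_i'(0) = -E(Q₀; J₀ = i)`, and the
    -- probability of the state is absorbed there.
    have hmix : ∫ ω, Q₀ ω * X (T ω).toNNReal ω ∂μ =
        -∑ i, nu μ X J T i * deriv (kappaState μ J Q₀ i) 0 := by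
      rw [integral_eq_sum_states hJ0 hQX.1, ← Finset.sum_neg_distrib]
      refine Finset.sum_congr rfl fun i _ => ?_
      have h1 : ∫ ω, Q₀ ω * X (T ω).toNNReal ω ∂(lawFrom μ J i) =
          (∫ ω, Q₀ ω ∂(lawFrom μ J i)) * ∫ ω, X (T ω).toNNReal ω ∂(lawFrom μ J i) :=
        (hindep i).1.integral_mul_eq_mul_integral (toLaw i hQi).aestronglyMeasurable
          (toLaw i hXT).aestronglyMeasurable
      have h2 : ∫ ω in J 0 ⁻¹' {i}, Q₀ ω * X (T ω).toNNReal ω ∂μ =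
          μ.real (J 0 ⁻¹' {i}) * ∫ ω, Q₀ ω * X (T ω).toNNReal ω ∂(lawFrom μ J i) :=
        setIntegral_eq_mul_integral_cond (hstate i) _
      have h3 : ∫ ω in J 0 ⁻¹' {i}, Q₀ ω ∂μ =
          μ.real (J 0 ⁻¹' {i}) * ∫ ω, Q₀ ω ∂(lawFrom μ J i) :=
        setIntegral_eq_mul_integral_cond (hstate i) _
      rw [hder, h2, h1, h3, nu]
      ring
    have hover : ((∫ ω, Q₀ ω * max (-runInf X (T ω).toNNReal ω - Q₀ ω) 0 ∂μ : ℝ) : ℂ) =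
        ∑ i, ∑ j, ζ i j / η j ^ 2 * (OmBar μ X J T i 0 - OmBar μ X J T i (η j) +
          η j * deriv (OmBar μ X J T i) (η j)) := by
      rw [integral_eq_sum_states hJ0 hQX.2, Complex.ofReal_sum]
      exact Finset.sum_congr rfl fun i _ => setIntegral_mul_overshoot hQm hQ0 hp hη hexpand
        (hstate i) (toLaw i hQi) (toLaw i hR) (hR0i i) (hindep i).2
    have hprod : ∫ ω, Q₀ ω * workloadAt X Q₀ T ω ∂μ = ∫ ω, Q₀ ω * X (T ω).toNNReal ω ∂μ +
        ∫ ω, Q₀ ω ^ 2 ∂μ + ∫ ω, Q₀ ω * max (-runInf X (T ω).toNNReal ω - Q₀ ω) 0 ∂μ := by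
      have hsq : Integrable (fun ω => Q₀ ω ^ 2) μ := hQ2.integrable_sq
      have hsum : Integrable (fun ω => Q₀ ω * X (T ω).toNNReal ω + Q₀ ω ^ 2) μ := hQX.1.add hsq
      rw [← integral_add hQX.1 hsq, ← integral_add hsum hQX.2]
      refine integral_congr_ae ?_
      filter_upwards [hX.ae_workloadAt_eq (T := T) (Q₀ := Q₀)] with ω hω
      rw [hω.1]
      ring
    have hgamma : gamma μ X Q₀ T = (iteratedDeriv 2 (kappa μ Q₀) 0 - deriv (kappa μ Q₀) 0 ^ 2) +
        ∫ ω, Q₀ ω * max (-runInf X (T ω).toNNReal ω - Q₀ ω) 0 ∂μ -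
        ∑ i, nu μ X J T i * deriv (kappaState μ J Q₀ i) 0 := by
      have h1 : gamma μ X Q₀ T = ∫ ω, Q₀ ω * workloadAt X Q₀ T ω ∂μ -
          (∫ ω, Q₀ ω ∂μ) * ∫ ω, workloadAt X Q₀ T ω ∂μ := covariance_eq_sub hQ2 hQT2
      -- Stationarity at `T` turns the product of the two means into `κ'(0)²`.
      rw [h1, hident.integral_eq, hprod, hmix, hκ1, hκ2]
      ring
    rw [hgamma, Complex.ofReal_sub, Complex.ofReal_add, hover]
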